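/- Let $n \ge 4$ be even. For a pseudo-Riemannian $n$-manifold $(M,g)$ let $R_{abcd}$ be the Riemann tensor, with $\nabla_a\nabla_b\tau_c-\nabla_b\nabla_a\tau_c=R_{abc}{}^d\tau_d$, let $R_{ab}=R_{acb}{}^c$ and $R$ be the Ricci and scalar curvature, let $\mathsf J=\frac{R}{2(n-1)}$ be the trace of the Schouten tensor, and let $\Delta=\nabla^a\nabla_a$. For a covariant four-tensor $T$ and $\ell\ge 0$ put $$\mathrm{Pf}_\ell(T)=2^{-\ell}(2\ell-1)!!\;\delta^{[a_1}_{[b_1}\cdots\delta^{a_{2\ell}]}_{b_{2\ell}]}\;T_{a_1a_2}{}^{b_1b_2}\cdots T_{a_{2\ell-1}a_{2\ell}}{}^{b_{2\ell-1}b_{2\ell}},$$ $\mathrm{Pf}_0(T)=1$, $(-1)!!=1$, and let $\mathrm{Pf}=\mathrm{Pf}_{n/2}(\mathrm{Rm})$ be the Pfaffian. A scalar Riemannian invariant is a real linear combination of complete contractions of tensors $\nabla^{N_1}\mathrm{Rm}\otimes\cdots\otimes\nabla^{N_j}\mathrm{Rm}\otimes g^{\otimes l}$. A straight and normal ambient space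 of $(M,g)$ ($n$ even) is $\widetilde{\mathcal G}=(0,\infty)_t\times M\times(-\varepsilon,\varepsilon)_\rho$, $\varepsilon>0$, with a metric $\widetilde g=2\rho\,dt^2+2t\,dt\,d\rho+t^2g_\rho$, where $g_\rho$ is a smooth one-parameter family of metrics on $M$ with $g_0=g$, such that $\widetilde{\mathrm{Ric}}=O(\rho^{n/2-1})$ and $\widetilde R=O(\rho^{n/2})$ along $\{\rho=0\}$. Write $\widetilde W$ and $\widetilde\Delta$ for its Weyl tensor and Laplacian, $i(x)=(1,x,0)$, and $$\mathcal P_{\ell,n}:=i^*\bigl(\widetilde\Delta^{\,n/2-\ell}\,\mathrm{Pf}_\ell(\widetilde W)\bigr).$$ Then there is a scalar Riemannian invariant $U$, depending only on $n$, such that for every pseudo-Riemannian Einstein manifold $(M^n,g)$ (that is, $\mathrm{Ric}=2\lambda(n-1)g$ for some constant $\lambda\in\mathbb R$), the function $U^g$ is smooth on $M$ and, for every straight and normal ambient space of $(M,g)$, $$\mathrm{Pf}=(n-1)!!\Bigl(\frac{2}{n}\mathsf J\Bigr)^{n/2}+\sum_{\ell=2}^{n/2}(-2)^{\ell-n/2}\,\frac{(\ell-1)!}{(n/2-1)!}\,\mathcal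 P_{\ell,n}+\Delta U^g\qquad\text{on }M .$$ -/

import Mathlib

open scoped Manifold ContDiff Nat

universe u

noncomputable section

/-! ## Local pseudo-Riemannian geometry in coordinates

Throughout, `V` is a normed space, `e : ι → V` is the constant coordinate frame `∂_i`, and a metric is
given by its component matrix `G : V → Matrix ι ι ℝ`, meaningful on an open subset of `V`.
Since only derivatives of germs occur, values of `G` outside that open set play no role. -/

namespace Coord

section

variable {ι V : Type} [Fintype ι] [DecidableEq ι] [NormedAddCommGroup V] [NormedSpace ℝ V]

/-- The partial derivative `∂_a f`. -/
def pd (e : ι → V) (a : ι) (f : V → ℝ) (p : V) : ℝ := fderiv ℝ f p (e a)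

/-- The inverse metric `g^{ab}`. -/
def inv (G : V → Matrix ι ι ℝ) (p : V) (a b : ι) : ℝ := (G p)⁻¹ a b

/-- The Christoffel symbol `Γ^c_{ab}` of the Levi-Civita connection. -/
def christoffel (e : ι → V) (G : V → Matrix ι ι ℝ) (p : V) (c a b : ι) : ℝ :=
  (1 / 2) * ∑ d, inv G p c d *
    (pd e a (fun q => G q d b) p + pd e b (fun q => G q d a) p - pd e d (fun q => G q a b) p)

/-- The curvature `R_{abc}{}^d`, with the convention
`∇_a ∇_b τ_c - ∇_b ∇_a τ_c = R_{abc}{}^d τ_d`. -/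
def riemUp (e : ι → V) (G : V → Matrix ι ι ℝ) (p : V) (a b c d : ι) : ℝ :=
  pd e b (fun q => christoffel e G q d a c) p - pd e a (fun q => christoffel e G q d b c) p
    + ∑ f, (christoffel e G p f a c * christoffel e G p d b f
      - christoffel e G p f b c * christoffel e G p d a f)

/-- The Riemann tensor `R_{abcd} = R_{abc}{}^f g_{fd}`. -/
def riem (e : ι → V) (G : V → Matrix ι ι ℝ) (p : V) (a b c d : ι) : ℝ :=
  ∑ f, riemUp e G p a b c f * G p f d

/-- The Ricci tensor `R_{ab} = R_{acb}{}^c`. -/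
def ricci (e : ι → V) (G : V → Matrix ι ι ℝ) (p : V) (a b : ι) : ℝ :=
  ∑ c, riemUp e G p a c b c

/-- The scalar curvature `R = g^{ab} R_{ab}`. -/
def scalar (e : ι → V) (G : V → Matrix ι ι ℝ) (p : V) : ℝ :=
  ∑ a, ∑ b, inv G p a b * ricci e G p a b

/-- `J = R / (2(N-1))`, `N` the dimension. This is the trace of the Schouten tensor below. -/
def schoutenTrace (e : ι → V) (G : V → Matrix ι ι ℝ) (p : V) : ℝ :=
  scalar e G p / (2 * ((Fintype.card ι : ℝ) - 1))

/-- The Schouten tensor `P_{ab} = (R_{ab} - J g_{ab}) / (N-2)`, `N` the dimension. -/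
def schouten (e : ι → V) (G : V → Matrix ι ι ℝ) (p : V) (a b : ι) : ℝ :=
  (ricci e G p a b - schoutenTrace e G p * G p a b) / ((Fintype.card ι : ℝ) - 2)

/-- The Weyl tensor `W_{abcd} = R_{abcd} - 2 P_{a[c} g_{d]b} + 2 P_{b[c} g_{d]a}`. -/
def weyl (e : ι → V) (G : V → Matrix ι ι ℝ) (p : V) (a b c d : ι) : ℝ :=
  riem e G p a b c d
    - (schouten e G p a c * G p d b - schouten e G p a d * G p c b)
    + (schouten e G p b c * G p d a - schouten e G p b d * G p c a)

/-- The Laplacian `Δ f = g^{ab} ∇_a ∇_b f` on functions. -/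
def laplacian (e : ι → V) (G : V → Matrix ι ι ℝ) (f : V → ℝ) (p : V) : ℝ :=
  ∑ a, ∑ b, inv G p a b *
    (pd e a (pd e b f) p - ∑ c, christoffel e G p c a b * pd e c f p)

/-- `δ^{a_1 ⋯ a_k}_{b_1 ⋯ b_k} = δ^{[a_1}_{[b_1} ⋯ δ^{a_k]}_{b_k]}`, the generalized Kronecker delta
divided by `k!`, for index families labelled by a finite type `S` of `k` slots. -/
def genDelta {S : Type} [Fintype S] [DecidableEq S] (a b : S → ι) : ℝ :=
  (∑ σ : Equiv.Perm S, ((Equiv.Perm.sign σ : ℤ) : ℝ) * ∏ s, if a s = b (σ s) then 1 else 0)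
    / ((Fintype.card S)! : ℝ)

/-- `T_{ab}{}^{cd}`: raise the last two indices of a covariant four-tensor. -/
def raiseLast (G : V → Matrix ι ι ℝ) (T : V → ι → ι → ι → ι → ℝ) (p : V) (a b c d : ι) : ℝ :=
  ∑ c', ∑ d', inv G p c c' * inv G p d d' * T p a b c' d'

/-- `Pf_ℓ(T) = 2^{-ℓ} (2ℓ-1)!! δ^{a_1 ⋯ a_{2ℓ}}_{b_1 ⋯ b_{2ℓ}}
T_{a_1 a_2}{}^{b_1 b_2} ⋯ T_{a_{2ℓ-1} a_{2ℓ}}{}^{b_{2ℓ-1} b_{2ℓ}}`. The `2ℓ` slots are labelled by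
`Fin ℓ × Fin 2`, the slots `(i, 0)` and `(i, 1)` being those of the `i`-th factor; `Pf_0 = 1`. -/
def pf (G : V → Matrix ι ι ℝ) (ℓ : ℕ) (T : V → ι → ι → ι → ι → ℝ) (p : V) : ℝ :=
  (1 / 2) ^ ℓ * ((2 * ℓ - 1)‼ : ℝ) *
    ∑ a : Fin ℓ × Fin 2 → ι, ∑ b : Fin ℓ × Fin 2 → ι,
      genDelta a b * ∏ i, raiseLast G T p (a (i, 0)) (a (i, 1)) (b (i, 0)) (b (i, 1))

/-- The covariant derivative of a covariant `k`-tensor; the new index comes first. -/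
def covDeriv (e : ι → V) (G : V → Matrix ι ι ℝ) {k : ℕ} (T : V → (Fin k → ι) → ℝ)
    (p : V) (a : Fin (k + 1) → ι) : ℝ :=
  pd e (a 0) (fun q => T q (Fin.tail a)) p
    - ∑ j : Fin k, ∑ c, christoffel e G p c (a 0) (a j.succ)
        * T p (Function.update (Fin.tail a) j c)

/-- The iterated covariant derivative `∇^N Rm`, a covariant tensor of rank `4 + N`. -/
def iterCovRiem (e : ι → V) (G : V → Matrix ι ι ℝ) : (N : ℕ) → V → (Fin (4 + N) → ι) → ℝ
  | 0 => fun p a => riem e G p (a 0) (a 1) (a 2) (a 3)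
  | N + 1 => covDeriv e G (iterCovRiem e G N)

end

end Coord

/-! ## Scalar Riemannian invariants -/

/-- The combinatorial datum of a complete contraction of
`∇^{N_1} Rm ⊗ ⋯ ⊗ ∇^{N_j} Rm ⊗ g^{⊗ l}`: all index slots are grouped into `m` pairs. -/
structure CompleteContraction where
  j : ℕ
  N : Fin j → ℕ
  l : ℕ
  m : ℕ
  pairing : Fin m × Fin 2 ≃ ((i : Fin j) × Fin (4 + N i)) ⊕ (Fin l × Fin 2)

/-- The value of a complete contraction, each pair of slots being contracted with `g^{-1}`. -/
def CompleteContraction.evalCoord {ι V : Type} [Fintype ι] [DecidableEq ι]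
    [NormedAddCommGroup V] [NormedSpace ℝ V] (C : CompleteContraction)
    (e : ι → V) (G : V → Matrix ι ι ℝ) (p : V) : ℝ :=
  ∑ a : ((i : Fin C.j) × Fin (4 + C.N i)) ⊕ (Fin C.l × Fin 2) → ι,
    (∏ q : Fin C.m, Coord.inv G p (a (C.pairing (q, 0))) (a (C.pairing (q, 1))))
      * (∏ i : Fin C.j, Coord.iterCovRiem e G (C.N i) p (fun s => a (Sum.inl ⟨i, s⟩)))
      * (∏ r : Fin C.l, G p (a (Sum.inr (r, 0))) (a (Sum.inr (r, 1))))

/-- A scalar Riemannian invariant: a formal `ℝ`-linear combination of complete contractions of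
tensors `∇^{N_1} Rm ⊗ ⋯ ⊗ ∇^{N_j} Rm ⊗ g^{⊗ l}`. -/
abbrev ScalarRiemannianInvariant : Type := CompleteContraction →₀ ℝ

/-- The value of a scalar Riemannian invariant for a metric in coordinates. -/
def ScalarRiemannianInvariant.evalCoord {ι V : Type} [Fintype ι] [DecidableEq ι]
    [NormedAddCommGroup V] [NormedSpace ℝ V] (I : ScalarRiemannianInvariant)
    (e : ι → V) (G : V → Matrix ι ι ℝ) (p : V) : ℝ :=
  I.sum fun C c => c * C.evalCoord e G p

/-! ## Pseudo-Riemannian manifolds -/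

/-- The model space of `n`-dimensional manifolds. -/
abbrev Model (n : ℕ) : Type := EuclideanSpace ℝ (Fin n)

/-- The coordinate frame of the model space. -/
def stdFrame (n : ℕ) (i : Fin n) : Model n := EuclideanSpace.single i 1

section

variable (n : ℕ) (M : Type u) [TopologicalSpace M] [ChartedSpace (Model n) M]

/-- The components `g_{ij}` of a field of bilinear forms on `M`, in the preferred chart at `x₀`,
as a function on the target of that chart. -/
def chartComponents
    (b : ∀ x : M, TangentSpace 𝓘(ℝ, Model n) x →L[ℝ] TangentSpace 𝓘(ℝ, Model n) x →L[ℝ] ℝ)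
    (x₀ : M) (p : Model n) : Matrix (Fin n) (Fin n) ℝ :=
  Matrix.of fun i j =>
    b ((chartAt (Model n) x₀).symm p)
      (mfderiv 𝓘(ℝ, Model n) 𝓘(ℝ, Model n) (chartAt (Model n) x₀).symm p (stdFrame n i))
      (mfderiv 𝓘(ℝ, Model n) 𝓘(ℝ, Model n) (chartAt (Model n) x₀).symm p (stdFrame n j))

/-- A smooth pseudo-Riemannian metric (of arbitrary signature) on an `n`-manifold. -/
structure PseudoRiemannianMetric where
  toFun : ∀ x : M, TangentSpace 𝓘(ℝ, Model n) x →L[ℝ] TangentSpace 𝓘(ℝ, Model n) x →L[ℝ] ℝ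
  symm : ∀ x v w, toFun x v w = toFun x w v
  nondegenerate : ∀ x v, (∀ w, toFun x v w = 0) → v = 0
  smooth : ∀ (x₀ : M) (i j : Fin n),
    ContDiffOn ℝ ∞ (fun p => chartComponents n M toFun x₀ p i j) (chartAt (Model n) x₀).target

end

namespace PseudoRiemannianMetric

section

variable {n : ℕ} {M : Type u} [TopologicalSpace M] [ChartedSpace (Model n) M]
  (g : PseudoRiemannianMetric n M)

/-- The component matrix of the metric in the preferred chart at `x₀`. -/
def comp (x₀ : M) : Model n → Matrix (Fin n) (Fin n) ℝ := chartComponents n M g.toFun x₀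

/-- `Ric = 2 λ (n-1) g` for a constant `λ`. -/
def IsEinstein : Prop :=
  ∃ lam : ℝ, ∀ x₀ : M, ∀ p ∈ (chartAt (Model n) x₀).target, ∀ a b : Fin n,
    Coord.ricci (stdFrame n) (g.comp x₀) p a b = 2 * lam * ((n : ℝ) - 1) * g.comp x₀ p a b

/-- The trace `J` of the Schouten tensor, as a function on `M`. -/
def J (x : M) : ℝ :=
  Coord.schoutenTrace (stdFrame n) (g.comp x) (chartAt (Model n) x x)

/-- The Pfaffian `Pf = Pf_{n/2}(Rm)` (for even `n`), as a function on `M`. -/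
def pfaffian (x : M) : ℝ :=
  Coord.pf (g.comp x) (n / 2) (Coord.riem (stdFrame n) (g.comp x)) (chartAt (Model n) x x)

/-- The Laplacian on functions on `M`. -/
def laplacian (f : M → ℝ) (x : M) : ℝ :=
  Coord.laplacian (stdFrame n) (g.comp x) (f ∘ (chartAt (Model n) x).symm)
    (chartAt (Model n) x x)

/-- The value `I^g : M → ℝ` of a scalar Riemannian invariant. -/
def evalInvariant (I : ScalarRiemannianInvariant) (x : M) : ℝ :=
  I.evalCoord (stdFrame n) (g.comp x) (chartAt (Model n) x x)

end

end PseudoRiemannianMetric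

/-! ## The ambient space -/

/-- Index set of the ambient coordinates `(t, x, ρ)`: one index `0`, the indices of `M`, and one
index `∞`. -/
abbrev AmbientIndex (n : ℕ) : Type := Unit ⊕ Fin n ⊕ Unit

/-- The coordinate frame `∂_t, ∂_{x^i}, ∂_ρ` of `ℝ × ℝⁿ × ℝ`. -/
def ambientFrame (n : ℕ) : AmbientIndex n → ℝ × Model n × ℝ
  | .inl _ => (1, 0, 0)
  | .inr (.inl i) => (0, stdFrame n i, 0)
  | .inr (.inr _) => (0, 0, 1)

/-- The components of `2 ρ dt² + 2 t dt dρ + t² g_ρ` in coordinates `(t, x, ρ)`, where `h ρ` is the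
component matrix of `g_ρ`. -/
def ambientComponents {n : ℕ} (h : ℝ → Model n → Matrix (Fin n) (Fin n) ℝ)
    (q : ℝ × Model n × ℝ) : Matrix (AmbientIndex n) (AmbientIndex n) ℝ :=
  Matrix.of fun A B =>
    match A, B with
    | .inl _, .inl _ => 2 * q.2.2
    | .inl _, .inr (.inr _) => q.1
    | .inr (.inr _), .inl _ => q.1
    | .inr (.inl i), .inr (.inl j) => q.1 ^ 2 * h q.2.2 q.2.1 i j
    | _, _ => 0

section

variable {n : ℕ} {M : Type u} [TopologicalSpace M] [ChartedSpace (Model n) M]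

/-- The components of `2 ρ dt² + 2 t dt dρ + t² g_ρ` on `(0,∞) × M × (-ε,ε)`, in the chart that is
the product of the identity, the preferred chart of `M` at `x₀`, and the identity. -/
def ambientMetric (family : ℝ → PseudoRiemannianMetric n M) (x₀ : M) :
    ℝ × Model n × ℝ → Matrix (AmbientIndex n) (AmbientIndex n) ℝ :=
  ambientComponents fun ρ => (family ρ).comp x₀

/-- A straight and normal ambient space of `(M, g)`: the manifold `(0,∞) × M × (-ε,ε)` with the
metric `2 ρ dt² + 2 t dt dρ + t² g_ρ`, where `g_ρ` is a smooth one-parameter family of metrics with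
`g_0 = g` whose ambient metric is Ricci flat along `ρ = 0` to the order that its dimension allows.
The values of `family ρ` for `|ρ| ≥ ε` are irrelevant. -/
structure StraightNormalAmbientSpace (g : PseudoRiemannianMetric n M) where
  ε : ℝ
  ε_pos : 0 < ε
  family : ℝ → PseudoRiemannianMetric n M
  smooth : ∀ (x₀ : M) (i j : Fin n),
    ContDiffOn ℝ ∞ (fun z : Model n × ℝ => (family z.2).comp x₀ z.1 i j)
      ((chartAt (Model n) x₀).target ×ˢ Set.Ioo (-ε) ε)
  family_zero : family 0 = g
  /-- If `n` is odd, then `Ric = O(ρ^∞)`. -/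
  ricci_odd : Odd n → ∀ x₀ : M, ∀ p ∈ (chartAt (Model n) x₀).target, ∀ t : ℝ, 0 < t →
    ∀ (A B : AmbientIndex n) (k : ℕ),
      iteratedDeriv k
        (fun ρ => Coord.ricci (ambientFrame n) (ambientMetric family x₀) (t, p, ρ) A B) 0 = 0
  /-- If `n` is even, then `Ric = O(ρ^{n/2-1})`. -/
  ricci_even : Even n → ∀ x₀ : M, ∀ p ∈ (chartAt (Model n) x₀).target, ∀ t : ℝ, 0 < t →
    ∀ (A B : AmbientIndex n) (k : ℕ), k < n / 2 - 1 →
      iteratedDeriv k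
        (fun ρ => Coord.ricci (ambientFrame n) (ambientMetric family x₀) (t, p, ρ) A B) 0 = 0
  /-- If `n` is even, then the scalar curvature is `O(ρ^{n/2})`. -/
  scalar_even : Even n → ∀ x₀ : M, ∀ p ∈ (chartAt (Model n) x₀).target, ∀ t : ℝ, 0 < t →
    ∀ k : ℕ, k < n / 2 →
      iteratedDeriv k
        (fun ρ => Coord.scalar (ambientFrame n) (ambientMetric family x₀) (t, p, ρ)) 0 = 0

/-- `𝒫_{ℓ,n} = i^*(Δ̃^{n/2-ℓ} Pf_ℓ(W̃))`, where `i(x) = (1, x, 0)`, as a function on `M`. -/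
def StraightNormalAmbientSpace.P {g : PseudoRiemannianMetric n M}
    (A : StraightNormalAmbientSpace g) (ℓ : ℕ) (x : M) : ℝ :=
  ((Coord.laplacian (ambientFrame n) (ambientMetric A.family x))^[n / 2 - ℓ]
    (Coord.pf (ambientMetric A.family x) ℓ
      (Coord.weyl (ambientFrame n) (ambientMetric A.family x))))
    (1, chartAt (Model n) x x, 0)

end

end

/-! Write Ric = 2λ(n-1)g and m = n/2. The Schouten tensor is λg, so R_{ab}^{cd} = W_{ab}^{cd} +
2λ(δ_a^c δ_b^d - δ_a^d δ_b^c). Expanding Pf_m multilinearly and contracting away the Kronecker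
factors (`deltaContract_option`, `deltaContract_add`) gives Pf = Σ_l (2(m-l)-1)!! (2λ)^{m-l}
Pf_l(W). Since J = nλ, the term l = 0 is the constant term of the theorem; the term l = 1 drops out
because W is trace free (`pf_riem_eq`). It remains to compare Pf_l(W) with P_l for l ≥ 2.

There is an explicit ambient model, g_ρ = (1+λρ)² g. For λ ≠ 0 it is the product of a line and a
metric cone over (M, g) with radial function a multiple of σ = t(1+λρ). Its curvature is annihilated
by t∂_t and ∂_ρ, and the tangential raised components are σ^{-2} W. Its Laplacian sends σ^{-N} f to
σ^{-N-2}(Δ + 2N(N+1-n)λ) f (`laplacian_einsteinFamily`). Hence in the model P_l is the product of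
the operators Δ + c_j λ, for 0 ≤ j < m-l and c_j = 2(2l+2j)(2l+2j+1-n), applied to Pf_l(W).
Multiplied out, this is (Π c_j) λ^{m-l} Pf_l(W) plus a Laplacian (`exists_shiftedLaplacian_eq`), and
the constant in front of P_l turns Π c_j into 2^{m-l}(2(m-l)-1)!!
(`coefficient_mul_prod_gjmsConst`).

A general straight and normal ambient metric is determined only to finite order. Its tangential
Ricci tensor is a singular second order operator in ρ acting on g_ρ, and comparing it with the model
order by order (`congrTo_succ`) gives g_ρ = (1+λρ)² g + O(ρ^m). This suffices because few orders are
lost afterwards. In Pf_l the generalized delta forces upper and lower indices to match; components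
with a lower t or an upper ρ are negligible, so only tangential components survive, and these lose
one order although curvature contains second derivatives (`congrTo_pf`). Each ambient Laplacian
loses one order, not two, because the ρρ entry of the inverse metric is divisible by ρ
(`congrTo_laplacian`). After m-l Laplacians the error is O(ρ^{l-1}), which vanishes on ρ = 0
precisely because l ≥ 2.

The potential under the Laplacian is a scalar invariant: λ is a constant multiple of R, Pf_l(W) is a
polynomial in λ and the Pf_j(Rm), and the Laplacian of a complete contraction is again a sum of
complete contractions because the inverse metric is parallel. Complete contractions take the same
value in all charts (`CurvScalar.eq_of_isIsometryOn`), so the potential is globally smooth and its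
Laplacian may be computed in a single chart. -/

namespace Coord

/-! ### Calculus of coordinate partial derivatives. -/

section Calculus

variable {ι V : Type} [NormedAddCommGroup V] [NormedSpace ℝ V] {e : ι → V} {U : Set V}
  {f g : V → ℝ} {p : V}

theorem contDiffOn_pd (hU : IsOpen U) (a : ι) (hf : ContDiffOn ℝ ∞ f U) :
    ContDiffOn ℝ ∞ (pd e a f) U :=
  (hf.fderiv_of_isOpen hU (by simp)).clm_apply contDiffOn_const

theorem differentiableAt_of_contDiffOn (hU : IsOpen U) (hf : ContDiffOn ℝ ∞ f U) (hp : p ∈ U) :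
    DifferentiableAt ℝ f p :=
  (hf.contDiffAt (hU.mem_nhds hp)).differentiableAt (by simp)

theorem pd_congr (hU : IsOpen U) (h : Set.EqOn f g U) (hp : p ∈ U) (a : ι) :
    pd e a f p = pd e a g p := by
  unfold pd
  rw [Filter.EventuallyEq.fderiv_eq (h.eventuallyEq_of_mem (hU.mem_nhds hp))]

theorem pd_const (c : ℝ) (a : ι) : pd e a (fun _ => c) p = 0 := by
  simp [pd]

theorem pd_add (hf : DifferentiableAt ℝ f p) (hg : DifferentiableAt ℝ g p) (a : ι) :
    pd e a (fun q => f q + g q) p = pd e a f p + pd e a g p := by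
  simp [pd, fderiv_fun_add hf hg]

theorem pd_sub (hf : DifferentiableAt ℝ f p) (hg : DifferentiableAt ℝ g p) (a : ι) :
    pd e a (fun q => f q - g q) p = pd e a f p - pd e a g p := by
  simp [pd, fderiv_fun_sub hf hg]

theorem pd_mul (hf : DifferentiableAt ℝ f p) (hg : DifferentiableAt ℝ g p) (a : ι) :
    pd e a (fun q => f q * g q) p = pd e a f p * g p + f p * pd e a g p := by
  simp [pd, fderiv_fun_mul hf hg]; ring

theorem pd_const_mul (hf : DifferentiableAt ℝ f p) (c : ℝ) (a : ι) :
    pd e a (fun q => c * f q) p = c * pd e a f p := by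
  rw [pd_mul (by fun_prop) hf, pd_const]; ring

theorem pd_sum {κ : Type*} {s : Finset κ} {F : κ → V → ℝ}
    (hF : ∀ k ∈ s, DifferentiableAt ℝ (F k) p) (a : ι) :
    pd e a (fun q => ∑ k ∈ s, F k q) p = ∑ k ∈ s, pd e a (F k) p := by
  simp [pd, fderiv_fun_sum hF]

theorem pd_prod {κ : Type*} [DecidableEq κ] {s : Finset κ} {F : κ → V → ℝ}
    (hF : ∀ k ∈ s, DifferentiableAt ℝ (F k) p) (a : ι) :
    pd e a (fun q => ∏ k ∈ s, F k q) p
      = ∑ k ∈ s, pd e a (F k) p * ∏ l ∈ s.erase k, F l p := by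
  simp only [pd, fderiv_finsetProd hF]
  simp [mul_comm]

theorem pd_comm (hU : IsOpen U) (hf : ContDiffOn ℝ ∞ f U) (hp : p ∈ U) (a b : ι) :
    pd e a (pd e b f) p = pd e b (pd e a f) p := by
  have hs : IsSymmSndFDerivAt ℝ f p :=
    (hf.contDiffAt (hU.mem_nhds hp)).isSymmSndFDerivAt
      (by simpa using (WithTop.coe_le_coe.2 le_top : ((2 : ℕ∞) : ℕ∞ω) ≤ ((⊤ : ℕ∞) : ℕ∞ω)))
  have hd : DifferentiableAt ℝ (fderiv ℝ f) p :=
    ((hf.fderiv_of_isOpen hU (m := ∞) (by simp)).contDiffAt (hU.mem_nhds hp)).differentiableAt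
      (by simp)
  have key : ∀ c d : ι, pd e c (pd e d f) p = fderiv ℝ (fderiv ℝ f) p (e c) (e d) := by
    intro c d
    unfold pd
    rw [fderiv_clm_apply hd (by fun_prop)]
    simp
  rw [key, key, hs.eq]

end Calculus

/-! ### The Levi-Civita connection and its curvature in coordinates. -/

section Metric

variable {ι V : Type} [Fintype ι] [DecidableEq ι] [NormedAddCommGroup V] [NormedSpace ℝ V]
  {e : ι → V} {U : Set V} {G : V → Matrix ι ι ℝ} {p : V}

/-- `G` is the component matrix of a smooth pseudo-Riemannian metric on the open set `U`. -/
structure IsMetricOn (G : V → Matrix ι ι ℝ) (U : Set V) : Prop where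
  isOpen : IsOpen U
  smooth : ∀ i j, ContDiffOn ℝ ∞ (fun p => G p i j) U
  symm : ∀ p ∈ U, ∀ i j, G p i j = G p j i
  det_ne : ∀ p ∈ U, (G p).det ≠ 0

theorem contDiffOn_det {A : V → Matrix ι ι ℝ}
    (hA : ∀ i j, ContDiffOn ℝ ∞ (fun p => A p i j) U) :
    ContDiffOn ℝ ∞ (fun p => (A p).det) U := by
  simp only [Matrix.det_apply']
  exact ContDiffOn.sum fun σ _ => contDiffOn_const.mul (contDiffOn_prod fun i _ => hA _ _)

/-- Cramer's rule: every entry is a cofactor divided by the determinant, and a cofactor is the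
determinant of the matrix with one row replaced by a constant row. -/
theorem contDiffOn_matrix_inv {A : V → Matrix ι ι ℝ}
    (hA : ∀ i j, ContDiffOn ℝ ∞ (fun p => A p i j) U) (hdet : ∀ p ∈ U, (A p).det ≠ 0) (i j : ι) :
    ContDiffOn ℝ ∞ (fun p => (A p)⁻¹ i j) U := by
  simp only [Matrix.inv_def, Matrix.smul_apply, Matrix.adjugate_apply, Ring.inverse_eq_inv',
    smul_eq_mul]
  refine ((contDiffOn_det hA).inv hdet).mul (contDiffOn_det fun k l => ?_)
  by_cases hk : k = j
  · subst hk; simpa using contDiffOn_const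
  · simpa [Matrix.updateRow_ne hk] using hA k l

namespace IsMetricOn

variable (hG : IsMetricOn G U)
include hG

theorem contDiffOn_inv (a b : ι) : ContDiffOn ℝ ∞ (fun p => inv G p a b) U :=
  contDiffOn_matrix_inv hG.smooth hG.det_ne a b

theorem isUnit_det (hp : p ∈ U) : IsUnit (G p).det := (hG.det_ne p hp).isUnit

theorem inv_mul (hp : p ∈ U) (a c : ι) :
    ∑ b, inv G p a b * G p b c = if a = c then 1 else 0 := by
  have := congrFun (congrFun (Matrix.nonsing_inv_mul (G p) (hG.isUnit_det hp)) a) c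
  simpa [Matrix.mul_apply, Matrix.one_apply, inv] using this

theorem mul_inv (hp : p ∈ U) (a c : ι) :
    ∑ b, G p a b * inv G p b c = if a = c then 1 else 0 := by
  have := congrFun (congrFun (Matrix.mul_nonsing_inv (G p) (hG.isUnit_det hp)) a) c
  simpa [Matrix.mul_apply, Matrix.one_apply, inv] using this

theorem inv_symm (hp : p ∈ U) (a b : ι) : inv G p a b = inv G p b a := by
  have h : (G p).transpose = G p := by ext i j; exact hG.symm p hp j i
  have := congrFun (congrFun (Matrix.transpose_nonsing_inv (G p)) a) b
  rw [h] at this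
  exact this.symm

/-- Nondegeneracy. It allows identities for quantities with an upper index to be checked after
lowering that index, where the inverse metric disappears. -/
theorem eq_of_lower_eq {x y : ι → ℝ} (hp : p ∈ U)
    (h : ∀ a, ∑ b, G p a b * x b = ∑ b, G p a b * y b) : x = y := by
  have : ∀ z : ι → ℝ, ∀ c, z c = ∑ a, inv G p c a * ∑ b, G p a b * z b := by
    intro z c
    simp_rw [Finset.mul_sum, ← mul_assoc]
    rw [Finset.sum_comm]
    simp_rw [← Finset.sum_mul, hG.inv_mul hp]
    simp
  funext c
  rw [this x c, this y c]
  simp_rw [h]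

theorem contDiffOn_christoffel (c a b : ι) :
    ContDiffOn ℝ ∞ (fun p => christoffel e G p c a b) U := by
  unfold christoffel
  refine contDiffOn_const.mul (ContDiffOn.sum fun d _ => (hG.contDiffOn_inv c d).mul ?_)
  exact ((contDiffOn_pd hG.isOpen _ (hG.smooth _ _)).add
    (contDiffOn_pd hG.isOpen _ (hG.smooth _ _))).sub (contDiffOn_pd hG.isOpen _ (hG.smooth _ _))

theorem pd_symm (hp : p ∈ U) (a b c : ι) :
    pd e a (fun q => G q b c) p = pd e a (fun q => G q c b) p :=
  pd_congr hG.isOpen (fun q hq => hG.symm q hq b c) hp a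

theorem christoffel_symm (hp : p ∈ U) (c a b : ι) :
    christoffel e G p c a b = christoffel e G p c b a := by
  unfold christoffel
  congr 1
  refine Finset.sum_congr rfl fun d _ => ?_
  rw [hG.pd_symm hp d a b]
  ring

theorem lower_christoffel (hp : p ∈ U) (d a b : ι) :
    ∑ c, G p d c * christoffel e G p c a b = (1 / 2) * (pd e a (fun q => G q d b) p
      + pd e b (fun q => G q d a) p - pd e d (fun q => G q a b) p) := by
  unfold christoffel
  have : ∀ x : ι → ℝ, ∑ c, G p d c * ((1 / 2) * ∑ f, inv G p c f * x f) = (1 / 2) * x d := by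
    intro x
    have : ∀ c, G p d c * ((1 / 2) * ∑ f, inv G p c f * x f)
        = ∑ f, (1 / 2) * ((G p d c * inv G p c f) * x f) := by
      intro c; rw [Finset.mul_sum, Finset.mul_sum]; exact Finset.sum_congr rfl fun _ _ => by ring
    simp_rw [this]
    rw [Finset.sum_comm]
    simp_rw [← Finset.mul_sum, ← Finset.sum_mul, hG.mul_inv hp]
    simp
  exact this _

/-- The Levi-Civita connection is metric. -/
theorem pd_eq_christoffel (hp : p ∈ U) (a b c : ι) :
    pd e a (fun q => G q b c) p
      = ∑ d, christoffel e G p d a b * G p d c + ∑ d, christoffel e G p d a c * G p b d := by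
  have h1 := hG.lower_christoffel (e := e) hp c a b
  have h2 := hG.lower_christoffel (e := e) hp b a c
  have e1 : ∑ d, christoffel e G p d a b * G p d c
      = ∑ d, G p c d * christoffel e G p d a b :=
    Finset.sum_congr rfl fun d _ => by rw [hG.symm p hp d c]; ring
  have e2 : ∑ d, christoffel e G p d a c * G p b d
      = ∑ d, G p b d * christoffel e G p d a c :=
    Finset.sum_congr rfl fun d _ => by ring
  rw [e1, e2, h1, h2, hG.pd_symm hp a c b, hG.pd_symm hp b a c, hG.pd_symm hp c a b]
  ring

/-- The Levi-Civita connection is the only symmetric metric connection. -/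
theorem christoffel_unique (hp : p ∈ U) {C : ι → ι → ι → ℝ}
    (hsymm : ∀ c a b, C c a b = C c b a)
    (hC : ∀ a b c, pd e a (fun q => G q b c) p
      = ∑ d, C d a b * G p d c + ∑ d, C d a c * G p b d) (c a b : ι) :
    christoffel e G p c a b = C c a b := by
  refine congrFun (hG.eq_of_lower_eq hp (x := fun c => christoffel e G p c a b)
    (y := fun c => C c a b) fun d => ?_) c
  rw [hG.lower_christoffel hp, hC, hC, hC]
  have hs : ∀ x y z, ∑ f, C f x y * G p f z = ∑ f, C f x y * G p z f := fun x y z =>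
    Finset.sum_congr rfl fun f _ => by rw [hG.symm p hp f z]
  have hs' : ∀ x y z, ∑ f, C f x y * G p z f = ∑ f, C f y x * G p z f := fun x y z =>
    Finset.sum_congr rfl fun f _ => by rw [hsymm f x y]
  simp_rw [hs]
  rw [hs' b a d, hs' d a b, hs' d b a, hs' b d a]
  simp_rw [mul_comm (G p d _)]
  ring

theorem contDiffOn_riemUp (a b c d : ι) :
    ContDiffOn ℝ ∞ (fun p => riemUp e G p a b c d) U := by
  unfold riemUp
  have := fun x y z => hG.contDiffOn_christoffel (e := e) x y z
  exact ((contDiffOn_pd hG.isOpen _ (this _ _ _)).sub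
    (contDiffOn_pd hG.isOpen _ (this _ _ _))).add
      (ContDiffOn.sum fun _ _ => ((this _ _ _).mul (this _ _ _)).sub ((this _ _ _).mul (this _ _ _)))

theorem contDiffOn_riem (a b c d : ι) :
    ContDiffOn ℝ ∞ (fun p => riem e G p a b c d) U :=
  ContDiffOn.sum fun _ _ => (hG.contDiffOn_riemUp _ _ _ _).mul (hG.smooth _ _)

theorem contDiffOn_ricci (a b : ι) : ContDiffOn ℝ ∞ (fun p => ricci e G p a b) U :=
  ContDiffOn.sum fun _ _ => hG.contDiffOn_riemUp _ _ _ _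

theorem contDiffOn_covDeriv {k : ℕ} {T : V → (Fin k → ι) → ℝ}
    (hT : ∀ a, ContDiffOn ℝ ∞ (fun p => T p a) U) (a : Fin (k + 1) → ι) :
    ContDiffOn ℝ ∞ (fun p => covDeriv e G T p a) U := by
  unfold covDeriv
  exact (contDiffOn_pd hG.isOpen _ (hT _)).sub (ContDiffOn.sum fun j _ => ContDiffOn.sum fun c _ =>
    (hG.contDiffOn_christoffel _ _ _).mul (hT _))

theorem contDiffOn_iterCovRiem (N : ℕ) (a : Fin (4 + N) → ι) :
    ContDiffOn ℝ ∞ (fun p => iterCovRiem e G N p a) U := by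
  induction N with
  | zero => exact hG.contDiffOn_riem _ _ _ _
  | succ N ih => exact hG.contDiffOn_covDeriv (k := 4 + N) ih a

theorem contDiffOn_laplacian {f : V → ℝ} (hf : ContDiffOn ℝ ∞ f U) :
    ContDiffOn ℝ ∞ (laplacian e G f) U := by
  unfold laplacian
  exact ContDiffOn.sum fun a _ => ContDiffOn.sum fun b _ => (hG.contDiffOn_inv _ _).mul
    ((contDiffOn_pd hG.isOpen _ (contDiffOn_pd hG.isOpen _ hf)).sub (ContDiffOn.sum fun c _ =>
      (hG.contDiffOn_christoffel _ _ _).mul (contDiffOn_pd hG.isOpen _ hf)))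

theorem laplacian_congr {f g : V → ℝ} (h : Set.EqOn f g U) (hp : p ∈ U) :
    laplacian e G f p = laplacian e G g p := by
  unfold laplacian
  have h1 : ∀ b, Set.EqOn (pd e b f) (pd e b g) U := fun b q hq => pd_congr hG.isOpen h hq b
  simp_rw [fun a b => pd_congr (e := e) hG.isOpen (h1 b) hp a, fun b => h1 b hp]

theorem laplacian_add {f g : V → ℝ} (hf : ContDiffOn ℝ ∞ f U) (hg : ContDiffOn ℝ ∞ g U)
    (hp : p ∈ U) :
    laplacian e G (fun q => f q + g q) p = laplacian e G f p + laplacian e G g p := by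
  have hU := hG.isOpen
  have h1 : ∀ b, Set.EqOn (pd e b fun q => f q + g q) (fun q => pd e b f q + pd e b g q) U :=
    fun b q hq => pd_add (differentiableAt_of_contDiffOn hU hf hq)
      (differentiableAt_of_contDiffOn hU hg hq) b
  have h2 : ∀ a b, pd e a (pd e b fun q => f q + g q) p
      = pd e a (pd e b f) p + pd e a (pd e b g) p := fun a b => by
    rw [pd_congr hU (h1 b) hp a, pd_add
      (differentiableAt_of_contDiffOn hU (contDiffOn_pd hU b hf) hp)
      (differentiableAt_of_contDiffOn hU (contDiffOn_pd hU b hg) hp)]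
  unfold laplacian
  simp_rw [h2, fun b => h1 b hp, ← Finset.sum_add_distrib]
  refine Finset.sum_congr rfl fun a _ => Finset.sum_congr rfl fun b _ => ?_
  simp_rw [mul_add, Finset.sum_add_distrib]
  ring

theorem laplacian_const_mul {f : V → ℝ} (hf : ContDiffOn ℝ ∞ f U) (c : ℝ) (hp : p ∈ U) :
    laplacian e G (fun q => c * f q) p = c * laplacian e G f p := by
  have hU := hG.isOpen
  have h1 : ∀ b, Set.EqOn (pd e b fun q => c * f q) (fun q => c * pd e b f q) U :=
    fun b q hq => pd_const_mul (differentiableAt_of_contDiffOn hU hf hq) c b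
  have h2 : ∀ a b, pd e a (pd e b fun q => c * f q) p = c * pd e a (pd e b f) p := fun a b => by
    rw [pd_congr hU (h1 b) hp a, pd_const_mul
      (differentiableAt_of_contDiffOn hU (contDiffOn_pd hU b hf) hp)]
  unfold laplacian
  simp_rw [h2, fun b => h1 b hp, Finset.mul_sum]
  refine Finset.sum_congr rfl fun a _ => Finset.sum_congr rfl fun b _ => ?_
  simp_rw [mul_left_comm _ c, ← Finset.mul_sum, ← mul_sub]
  ring

/-- The inverse metric is parallel. Differentiating g⁻¹g = 1 and substituting metric compatibility
gives the formula after lowering an index, which is enough by `eq_of_lower_eq`. -/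
theorem pd_inv (hp : p ∈ U) (a b c : ι) :
    pd e a (fun q => inv G q b c) p
      = -∑ d, christoffel e G p b a d * inv G p d c - ∑ d, christoffel e G p c a d * inv G p b d := by
  have hU := hG.isOpen
  have hd : ∀ x y, DifferentiableAt ℝ (fun q => inv G q x y) p := fun x y =>
    differentiableAt_of_contDiffOn hU (hG.contDiffOn_inv x y) hp
  have hg : ∀ x y, DifferentiableAt ℝ (fun q => G q x y) p := fun x y =>
    differentiableAt_of_contDiffOn hU (hG.smooth x y) hp
  have h0 : ∀ x, ∑ y, (pd e a (fun q => inv G q b y) p * G p y x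
      + inv G p b y * pd e a (fun q => G q y x) p) = 0 := by
    intro x
    have := pd_congr (e := e) hU (f := fun q => ∑ y, inv G q b y * G q y x)
      (g := fun _ => if b = x then 1 else 0) (fun q hq => hG.inv_mul hq b x) hp a
    rw [pd_const, pd_sum (fun y _ => (hd b y).fun_mul (hg y x))] at this
    rw [← this]
    exact Finset.sum_congr rfl fun y _ => (pd_mul (hd b y) (hg y x) a).symm
  refine congrFun (hG.eq_of_lower_eq hp (x := fun c => pd e a (fun q => inv G q b c) p)
    (y := fun c => -∑ d, christoffel e G p b a d * inv G p d c
      - ∑ d, christoffel e G p c a d * inv G p b d) fun x => ?_) c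
  have h1 : ∑ y, G p x y * pd e a (fun q => inv G q b y) p
      = -∑ y, inv G p b y * pd e a (fun q => G q y x) p := by
    rw [eq_neg_iff_add_eq_zero, ← Finset.sum_add_distrib, ← h0 x]
    exact Finset.sum_congr rfl fun y _ => by rw [hG.symm p hp x y]; ring
  rw [h1]
  simp_rw [hG.pd_eq_christoffel hp, mul_add, mul_sub, mul_neg, Finset.sum_add_distrib,
    Finset.sum_sub_distrib, Finset.sum_neg_distrib, Finset.mul_sum]
  have e1 : ∑ y, ∑ d, inv G p b y * (christoffel e G p d a x * G p y d)
      = ∑ y, ∑ d, G p x y * (christoffel e G p b a d * inv G p d y) := by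
    have l : ∑ y, ∑ d, inv G p b y * (christoffel e G p d a x * G p y d)
        = christoffel e G p b a x := by
      rw [Finset.sum_comm]
      have : ∀ d, ∑ y, inv G p b y * (christoffel e G p d a x * G p y d)
          = christoffel e G p d a x * if b = d then 1 else 0 := by
        intro d; rw [← hG.inv_mul hp b d, Finset.mul_sum]
        exact Finset.sum_congr rfl fun _ _ => by ring
      simp [this]
    have r : ∑ y, ∑ d, G p x y * (christoffel e G p b a d * inv G p d y)
        = christoffel e G p b a x := by
      rw [Finset.sum_comm]
      have : ∀ d, ∑ y, G p x y * (christoffel e G p b a d * inv G p d y)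
          = christoffel e G p b a d * if d = x then 1 else 0 := by
        intro d; rw [← hG.inv_mul hp d x, Finset.mul_sum]
        exact Finset.sum_congr rfl fun y _ => by rw [hG.symm p hp x y]; ring
      simp [this]
    rw [l, r]
  have e2 : ∑ y, ∑ d, inv G p b y * (christoffel e G p d a y * G p d x)
      = ∑ y, ∑ d, G p x y * (christoffel e G p y a d * inv G p b d) := by
    rw [Finset.sum_comm]
    exact Finset.sum_congr rfl fun y _ => Finset.sum_congr rfl fun d _ => by
      rw [hG.symm p hp x y]; ring
  rw [e1, e2]
  ring

theorem sum_riem_mul_inv (hp : p ∈ U) (a b c d : ι) :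
    ∑ f, riem e G p a b c f * inv G p d f = riemUp e G p a b c d := by
  unfold riem
  simp_rw [Finset.sum_mul]
  rw [Finset.sum_comm]
  have : ∀ x, ∑ y, riemUp e G p a b c x * G p x y * inv G p d y
      = riemUp e G p a b c x * if x = d then 1 else 0 := by
    intro x
    rw [← hG.mul_inv hp x d, Finset.mul_sum]
    exact Finset.sum_congr rfl fun y _ => by rw [hG.inv_symm hp d y]; ring
  simp [this]

/-- Raising the fourth index undoes the lowering in `riem`. The resulting form has a single inverse
metric, so the ambient estimates can work with `riemUp`, whose upper index ρ is better behaved than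
a lowered one. -/
theorem raiseLast_riem (hp : p ∈ U) (a b c d : ι) :
    raiseLast G (riem e G) p a b c d = ∑ c', inv G p c c' * riemUp e G p a b c' d := by
  unfold raiseLast
  refine Finset.sum_congr rfl fun c' _ => ?_
  rw [← hG.sum_riem_mul_inv hp, Finset.mul_sum]
  exact Finset.sum_congr rfl fun y _ => by ring

end IsMetricOn

theorem riemUp_antisymm (e : ι → V) (G : V → Matrix ι ι ℝ) (p : V) (a b c d : ι) :
    riemUp e G p a b c d = -riemUp e G p b a c d := by
  unfold riemUp
  have : ∑ f, (christoffel e G p f a c * christoffel e G p d b f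
      - christoffel e G p f b c * christoffel e G p d a f)
      = -∑ f, (christoffel e G p f b c * christoffel e G p d a f
      - christoffel e G p f a c * christoffel e G p d b f) := by
    rw [← Finset.sum_neg_distrib]; exact Finset.sum_congr rfl fun _ _ => by ring
  rw [this]; ring

theorem riem_antisymm (e : ι → V) (G : V → Matrix ι ι ℝ) (p : V) (a b c d : ι) :
    riem e G p a b c d = -riem e G p b a c d := by
  unfold riem
  rw [← Finset.sum_neg_distrib]
  exact Finset.sum_congr rfl fun _ _ => by rw [riemUp_antisymm]; ring

end Metric


/-! ### The Ricci identity for one-forms. -/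

section RicciIdentity

variable {ι V : Type} [Fintype ι] [DecidableEq ι] [NormedAddCommGroup V] [NormedSpace ℝ V]
  {e : ι → V} {U : Set V} {G : V → Matrix ι ι ℝ} {p : V}

theorem covDeriv_one (e : ι → V) (G : V → Matrix ι ι ℝ) (T : V → (Fin 1 → ι) → ℝ) (p : V)
    (a b : ι) : covDeriv e G T p ![a, b]
      = pd e a (fun q => T q ![b]) p - ∑ c, christoffel e G p c a b * T p ![c] := by
  have h1 : (Fin.tail ![a, b] : Fin 1 → ι) = ![b] := by ext i; fin_cases i; rfl
  have h2 : ∀ c, Function.update (![b] : Fin 1 → ι) 0 c = ![c] := by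
    intro c; ext i; fin_cases i; rfl
  simp [covDeriv, h1, h2]

theorem covDeriv_two (e : ι → V) (G : V → Matrix ι ι ℝ) (T : V → (Fin 2 → ι) → ℝ) (p : V)
    (a b c : ι) : covDeriv e G T p ![a, b, c]
      = pd e a (fun q => T q ![b, c]) p - (∑ d, christoffel e G p d a b * T p ![d, c]
        + ∑ d, christoffel e G p d a c * T p ![b, d]) := by
  have h1 : (Fin.tail ![a, b, c] : Fin 2 → ι) = ![b, c] := by ext i; fin_cases i <;> rfl
  have h2 : ∀ d, Function.update (![b, c] : Fin 2 → ι) 0 d = ![d, c] := by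
    intro d; ext i; fin_cases i <;> rfl
  have h3 : ∀ d, Function.update (![b, c] : Fin 2 → ι) 1 d = ![b, d] := by
    intro d; ext i; fin_cases i <;> rfl
  simp [covDeriv, h1, Fin.sum_univ_two, h2, h3]

/-- Second derivatives cancel because partial derivatives commute, first derivatives because the
connection is torsion free. It expresses the curvature through covariant derivatives, whose
behaviour under pullback is known; this is how tensoriality of the curvature is obtained in
`riemUp_contract`. -/
theorem IsMetricOn.ricci_identity (hG : IsMetricOn G U) (hp : p ∈ U) {T : V → (Fin 1 → ι) → ℝ}
    (hT : ∀ a, ContDiffOn ℝ ∞ (fun p => T p a) U) (a b c : ι) :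
    covDeriv e G (covDeriv e G T) p ![a, b, c] - covDeriv e G (covDeriv e G T) p ![b, a, c]
      = ∑ d, riemUp e G p a b c d * T p ![d] := by
  have hU := hG.isOpen
  have hd : ∀ x, DifferentiableAt ℝ (fun q => T q x) p := fun x =>
    differentiableAt_of_contDiffOn hU (hT x) hp
  have hc : ∀ x y z, DifferentiableAt ℝ (fun q => christoffel e G q x y z) p := fun x y z =>
    differentiableAt_of_contDiffOn hU (hG.contDiffOn_christoffel x y z) hp
  have hpd : ∀ x y, DifferentiableAt ℝ (pd e y (fun q => T q x)) p := fun x y =>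
    differentiableAt_of_contDiffOn hU (contDiffOn_pd hU y (hT x)) hp
  have h1 : ∀ a b c, pd e a (fun q => covDeriv e G T q ![b, c]) p
      = pd e a (pd e b (fun q => T q ![c])) p
        - ∑ d, (pd e a (fun q => christoffel e G q d b c) p * T p ![d]
          + christoffel e G p d b c * pd e a (fun q => T q ![d]) p) := by
    intro a b c
    simp_rw [covDeriv_one]
    rw [pd_sub (hpd _ _) (DifferentiableAt.fun_sum fun d _ => (hc _ _ _).fun_mul (hd _)),
      pd_sum fun d _ => (hc _ _ _).fun_mul (hd _)]
    congr 1
    exact Finset.sum_congr rfl fun d _ => pd_mul (hc _ _ _) (hd _) a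
  rw [covDeriv_two, covDeriv_two, h1, h1, pd_comm hU (hT ![c]) hp a b]
  have h2 : ∑ d, christoffel e G p d b a * covDeriv e G T p ![d, c]
      = ∑ d, christoffel e G p d a b * covDeriv e G T p ![d, c] :=
    Finset.sum_congr rfl fun d _ => by rw [hG.christoffel_symm hp]
  rw [h2]
  simp only [covDeriv_one, riemUp, mul_sub, add_mul, sub_mul, Finset.sum_add_distrib,
    Finset.sum_sub_distrib, Finset.mul_sum, Finset.sum_mul, sub_mul, Finset.sum_sub_distrib]
  have h3 : ∀ a b, ∑ d, ∑ f, christoffel e G p d a c * (christoffel e G p f b d * T p ![f])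
      = ∑ d, ∑ f, christoffel e G p f a c * christoffel e G p d b f * T p ![d] := by
    intro a b
    rw [Finset.sum_comm]
    exact Finset.sum_congr rfl fun d _ => Finset.sum_congr rfl fun f _ => by ring
  rw [h3, h3]
  ring

end RicciIdentity

/-! ### Naturality of connection and curvature under isometries. -/

section Transition

variable {n : ℕ} {U U' : Set (Model n)} {Φ : Model n → Model n}
  {G G' : Model n → Matrix (Fin n) (Fin n) ℝ} {p : Model n}

/-- The Jacobian matrix `∂_i Φ^k`. -/
noncomputable def jac (Φ : Model n → Model n) (p : Model n) (k i : Fin n) : ℝ :=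
  pd (stdFrame n) i (fun q => Φ q k) p

/-- The smooth map `Φ` pulls the metric `G'` on `U'` back to the metric `G` on `U`. -/
structure IsIsometryOn (Φ : Model n → Model n) (G G' : Model n → Matrix (Fin n) (Fin n) ℝ)
    (U U' : Set (Model n)) : Prop where
  metric : IsMetricOn G U
  metric' : IsMetricOn G' U'
  smooth : ContDiffOn ℝ ∞ Φ U
  mapsTo : Set.MapsTo Φ U U'
  pullback : ∀ p ∈ U, ∀ i j,
    G p i j = ∑ k, ∑ l, jac Φ p k i * jac Φ p l j * G' (Φ p) k l

theorem pd_comp {f : Model n → ℝ} (hf : DifferentiableAt ℝ f (Φ p)) (hΦ : DifferentiableAt ℝ Φ p)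
    (i : Fin n) : pd (stdFrame n) i (fun q => f (Φ q)) p
      = ∑ k, jac Φ p k i * pd (stdFrame n) k f (Φ p) := by
  have h1 : pd (stdFrame n) i (fun q => f (Φ q)) p
      = fderiv ℝ f (Φ p) (fderiv ℝ Φ p (stdFrame n i)) := by
    unfold pd
    rw [show (fun q => f (Φ q)) = f ∘ Φ from rfl, fderiv_comp p hf hΦ]
    rfl
  have h2 : ∀ k, jac Φ p k i = (fderiv ℝ Φ p (stdFrame n i)) k := by
    intro k
    unfold jac pd
    have : (fun q => Φ q k) = (EuclideanSpace.proj k : Model n →L[ℝ] ℝ) ∘ Φ := rfl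
    rw [this, fderiv_comp p (by fun_prop) hΦ, ContinuousLinearMap.fderiv]
    rfl
  have h3 : ∀ v : Model n, v = ∑ k, v k • stdFrame n k := by
    intro v
    have := ((EuclideanSpace.basisFun (Fin n) ℝ).sum_repr v).symm
    simpa [stdFrame] using this
  rw [h1, h3 (fderiv ℝ Φ p (stdFrame n i)), map_sum]
  simp [h2, pd]

namespace IsIsometryOn

variable (h : IsIsometryOn Φ G G' U U')
include h

theorem contDiffOn_apply (k : Fin n) : ContDiffOn ℝ ∞ (fun q => Φ q k) U :=
  (EuclideanSpace.proj k : Model n →L[ℝ] ℝ).contDiff.comp_contDiffOn h.smooth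

theorem contDiffOn_jac (k i : Fin n) : ContDiffOn ℝ ∞ (fun q => jac Φ q k i) U :=
  contDiffOn_pd h.metric.isOpen i (h.contDiffOn_apply k)

theorem differentiableAt_jac (hp : p ∈ U) (k i : Fin n) :
    DifferentiableAt ℝ (fun q => jac Φ q k i) p :=
  differentiableAt_of_contDiffOn h.metric.isOpen (h.contDiffOn_jac k i) hp

theorem contDiffOn_comp {f : Model n → ℝ} (hf : ContDiffOn ℝ ∞ f U') :
    ContDiffOn ℝ ∞ (fun q => f (Φ q)) U := hf.comp h.smooth h.mapsTo

theorem pd_comp (hp : p ∈ U) {f : Model n → ℝ} (hf : ContDiffOn ℝ ∞ f U') (i : Fin n) :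
    pd (stdFrame n) i (fun q => f (Φ q)) p
      = ∑ k, jac Φ p k i * pd (stdFrame n) k f (Φ p) :=
  Coord.pd_comp (differentiableAt_of_contDiffOn h.metric'.isOpen hf (h.mapsTo hp))
    ((h.smooth.contDiffAt (h.metric.isOpen.mem_nhds hp)).differentiableAt (by simp)) i

theorem eq_transpose_mul (hp : p ∈ U) :
    G p = (Matrix.of (jac Φ p)).transpose * G' (Φ p) * Matrix.of (jac Φ p) := by
  ext i j
  rw [h.pullback p hp]
  simp only [Matrix.mul_apply, Matrix.transpose_apply, Matrix.of_apply, Finset.sum_mul]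
  rw [Finset.sum_comm]
  exact Finset.sum_congr rfl fun l _ => Finset.sum_congr rfl fun k _ => by ring

theorem det_jac_ne (hp : p ∈ U) : (Matrix.of (jac Φ p)).det ≠ 0 := by
  have := h.metric.det_ne p hp
  rw [h.eq_transpose_mul hp, Matrix.det_mul] at this
  exact right_ne_zero_of_mul this

theorem pd_jac_symm (hp : p ∈ U) (k a b : Fin n) :
    pd (stdFrame n) a (fun q => jac Φ q k b) p = pd (stdFrame n) b (fun q => jac Φ q k a) p :=
  pd_comm h.metric.isOpen (h.contDiffOn_apply k) hp a b

/-- The right-hand side, multiplied by the inverse Jacobian, defines symmetric coefficients `C` for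
which the pulled back metric is parallel; uniqueness of the Levi-Civita connection identifies them
with the Christoffel symbols of `G`. -/
theorem christoffel_eq (hp : p ∈ U) (k a b : Fin n) :
    ∑ c, christoffel (stdFrame n) G p c a b * jac Φ p k c
      = pd (stdFrame n) a (fun q => jac Φ q k b) p
        + ∑ l, ∑ m, christoffel (stdFrame n) G' (Φ p) k l m * jac Φ p l a * jac Φ p m b := by
  set e := stdFrame n
  set J := jac Φ p
  have hp' := h.mapsTo hp
  set Q : Fin n → Fin n → Fin n → ℝ := fun k a b => pd e a (fun q => jac Φ q k b) p
        + ∑ l, ∑ m, christoffel e G' (Φ p) k l m * J l a * J m b with hQ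
  have hdet : IsUnit (Matrix.of J).det := (h.det_jac_ne hp).isUnit
  set C : Fin n → Fin n → Fin n → ℝ := fun c a b => ∑ k, (Matrix.of J)⁻¹ c k * Q k a b with hC
  have hJC : ∀ k a b, ∑ c, J k c * C c a b = Q k a b := by
    intro k a b
    simp only [hC, Finset.mul_sum, ← mul_assoc]
    rw [Finset.sum_comm]
    have : ∀ x, ∑ c, J k c * (Matrix.of J)⁻¹ c x = if k = x then 1 else 0 := by
      intro x
      have := congrFun (congrFun (Matrix.mul_nonsing_inv (Matrix.of J) hdet) k) x
      simpa [Matrix.mul_apply, Matrix.one_apply] using this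
    simp_rw [← Finset.sum_mul, this]
    simp
  have hQs : ∀ k a b, Q k a b = Q k b a := by
    intro k a b
    simp only [hQ]
    rw [h.pd_jac_symm hp, Finset.sum_comm]
    congr 1
    exact Finset.sum_congr rfl fun l _ => Finset.sum_congr rfl fun m _ => by
      rw [h.metric'.christoffel_symm hp']; ring
  have key := h.metric.christoffel_unique (e := e) hp (C := C)
    (fun c a b => by simp only [hC]; exact Finset.sum_congr rfl fun k _ => by rw [hQs]) ?_
  · simp_rw [key, mul_comm (C _ a b)]
    exact hJC k a b
  intro a b c
  have hl : pd e a (fun q => G q b c) p = ∑ k, ∑ l,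
      ((pd e a (fun q => jac Φ q k b) p * J l c + J k b * pd e a (fun q => jac Φ q l c) p)
          * G' (Φ p) k l
        + J k b * J l c * ∑ m, J m a * pd e m (fun q => G' q k l) (Φ p)) := by
    rw [pd_congr h.metric.isOpen (fun q hq => h.pullback q hq b c) hp a]
    have hj := h.differentiableAt_jac hp
    have hg : ∀ k l, DifferentiableAt ℝ (fun q => G' (Φ q) k l) p := fun k l =>
      differentiableAt_of_contDiffOn h.metric.isOpen (h.contDiffOn_comp (h.metric'.smooth k l)) hp
    rw [pd_sum fun k _ => DifferentiableAt.fun_sum fun l _ =>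
      ((hj _ _).fun_mul (hj _ _)).fun_mul (hg _ _)]
    refine Finset.sum_congr rfl fun k _ => ?_
    rw [pd_sum fun l _ => ((hj _ _).fun_mul (hj _ _)).fun_mul (hg _ _)]
    refine Finset.sum_congr rfl fun l _ => ?_
    rw [pd_mul ((hj _ _).fun_mul (hj _ _)) (hg _ _), pd_mul (hj _ _) (hj _ _),
      h.pd_comp hp (h.metric'.smooth k l)]
  have hr1 : ∑ d, C d a b * G p d c = ∑ k, ∑ l, Q k a b * J l c * G' (Φ p) k l := by
    simp_rw [h.pullback p hp, ← hJC, Finset.mul_sum, Finset.sum_mul]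
    rw [Finset.sum_comm]
    refine Finset.sum_congr rfl fun k _ => ?_
    rw [Finset.sum_comm]
    exact Finset.sum_congr rfl fun l _ => Finset.sum_congr rfl fun d _ => by simp only [J]; ring
  have hr2 : ∑ d, C d a c * G p b d = ∑ k, ∑ l, J k b * Q l a c * G' (Φ p) k l := by
    simp_rw [h.pullback p hp, ← hJC, Finset.mul_sum, Finset.sum_mul]
    rw [Finset.sum_comm]
    refine Finset.sum_congr rfl fun k _ => ?_
    rw [Finset.sum_comm]
    exact Finset.sum_congr rfl fun l _ => Finset.sum_congr rfl fun d _ => by simp only [J]; ring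
  rw [hl, hr1, hr2]
  simp only [h.metric'.pd_eq_christoffel hp', hQ, mul_add, add_mul,
    Finset.sum_add_distrib, Finset.mul_sum, Finset.sum_mul]
  have s1 : ∀ f : Fin n → Fin n → Fin n → Fin n → ℝ,
      ∑ k, ∑ l, ∑ m, ∑ d, f k l m d = ∑ k, ∑ l, ∑ m, ∑ d, f d l m k := by
    intro f
    calc ∑ k, ∑ l, ∑ m, ∑ d, f k l m d = ∑ l, ∑ m, ∑ k, ∑ d, f k l m d := by
          rw [Finset.sum_comm]; exact Finset.sum_congr rfl fun l _ => Finset.sum_comm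
      _ = ∑ l, ∑ m, ∑ k, ∑ d, f d l m k :=
          Finset.sum_congr rfl fun l _ => Finset.sum_congr rfl fun m _ => Finset.sum_comm
      _ = _ := by
          rw [Finset.sum_comm (s := Finset.univ (α := Fin n)) (f := fun k l => ∑ m, ∑ d, f d l m k)]
          exact Finset.sum_congr rfl fun l _ => Finset.sum_comm
  have s2 : ∀ f : Fin n → Fin n → Fin n → Fin n → ℝ,
      ∑ k, ∑ l, ∑ m, ∑ d, f k l m d = ∑ k, ∑ l, ∑ m, ∑ d, f k d m l := by
    intro f
    refine Finset.sum_congr rfl fun k _ => ?_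
    rw [Finset.sum_comm, Finset.sum_comm (f := fun l m => ∑ d, f k d m l)]
    exact Finset.sum_congr rfl fun m _ => Finset.sum_comm
  have t1 : ∑ k, ∑ l, ∑ m, ∑ d,
        J k b * J l c * (J m a * (christoffel e G' (Φ p) d m k * G' (Φ p) d l))
      = ∑ k, ∑ l, ∑ m, ∑ d, christoffel e G' (Φ p) k m d * J m a * J d b * J l c * G' (Φ p) k l := by
    rw [s1]
    exact Finset.sum_congr rfl fun k _ => Finset.sum_congr rfl fun l _ =>
      Finset.sum_congr rfl fun m _ => Finset.sum_congr rfl fun d _ => by ring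
  have t2 : ∑ k, ∑ l, ∑ m, ∑ d,
        J k b * J l c * (J m a * (christoffel e G' (Φ p) d m l * G' (Φ p) k d))
      = ∑ k, ∑ l, ∑ m, ∑ d,
        J k b * (christoffel e G' (Φ p) l m d * J m a * J d c) * G' (Φ p) k l := by
    rw [s2]
    exact Finset.sum_congr rfl fun k _ => Finset.sum_congr rfl fun l _ =>
      Finset.sum_congr rfl fun m _ => Finset.sum_congr rfl fun d _ => by ring
  rw [t1, t2]
  ring

end IsIsometryOn

/-- `T` is the pull-back of the covariant `k`-tensor `T'` by `Φ`. -/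
def IsPullback (Φ : Model n → Model n) (U : Set (Model n)) {k : ℕ}
    (T T' : Model n → (Fin k → Fin n) → ℝ) : Prop :=
  ∀ p ∈ U, ∀ a, T p a = ∑ b, (∏ s, jac Φ p (b s) (a s)) * T' (Φ p) b

/-- Exchanging the free index with the entry in slot j is an involution of the summation range. This
is the device that moves a Christoffel symbol from one side of a contraction to the other. -/
theorem sum_update_swap {κ ι : Type*} [Fintype κ] [DecidableEq κ] [Fintype ι] [DecidableEq ι]
    (j : κ) (F : (κ → ι) → ι → ℝ) :
    ∑ b, ∑ m, F b m = ∑ b, ∑ c, F (Function.update b j c) (b j) := by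
  rw [← Fintype.sum_prod_type', ← Fintype.sum_prod_type']
  have hinv : Function.Involutive
      (fun x : (κ → ι) × ι => ((Function.update x.1 j x.2, x.1 j) : (κ → ι) × ι)) := by
    rintro ⟨b, m⟩; simp
  exact (Equiv.sum_comp (Function.Involutive.toPerm _ hinv) (fun x => F x.1 x.2)).symm

theorem sum_vec_three (F : (Fin 3 → Fin n) → ℝ) :
    ∑ b, F b = ∑ x, ∑ y, ∑ z, F ![x, y, z] := by
  rw [← (Fin.consEquiv fun _ => Fin n).sum_comp, Fintype.sum_prod_type]
  refine Finset.sum_congr rfl fun x _ => ?_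
  rw [← (Fin.consEquiv fun _ => Fin n).sum_comp, Fintype.sum_prod_type]
  refine Finset.sum_congr rfl fun y _ => ?_
  rw [← (Fin.consEquiv fun _ => Fin n).sum_comp, Fintype.sum_prod_type]
  refine Finset.sum_congr rfl fun z _ => ?_
  rw [Fintype.sum_unique]
  congr 1

namespace IsIsometryOn

variable (h : IsIsometryOn Φ G G' U U')
include h

/-- Differentiating the Jacobian factors of the pullback produces second derivatives of Φ; these are
exactly the inhomogeneous terms in `christoffel_eq`, so they cancel against the connection terms. -/
theorem isPullback_covDeriv {k : ℕ} {T T' : Model n → (Fin k → Fin n) → ℝ}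
    (hT' : ∀ a, ContDiffOn ℝ ∞ (fun p => T' p a) U') (hTT : IsPullback Φ U T T') :
    IsPullback Φ U (covDeriv (stdFrame n) G T) (covDeriv (stdFrame n) G' T') := by
  intro p hp a
  set e := stdFrame n
  set J := jac Φ p
  set i := a 0
  set A := Fin.tail a with hA
  have hj := h.differentiableAt_jac hp
  have ht : ∀ b, DifferentiableAt ℝ (fun q => T' (Φ q) b) p := fun b =>
      differentiableAt_of_contDiffOn h.metric.isOpen (h.contDiffOn_comp (hT' b)) hp
  have hprod : ∀ b : Fin k → Fin n, DifferentiableAt ℝ (fun q => ∏ s, jac Φ q (b s) (A s)) p :=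
    fun b => (HasFDerivAt.finsetProd fun s _ => (hj (b s) (A s)).hasFDerivAt).differentiableAt
  have h1 : pd e i (fun q => T q A) p = ∑ b : Fin k → Fin n,
      ((∑ s, pd e i (fun q => jac Φ q (b s) (A s)) p
          * ∏ t ∈ Finset.univ.erase s, J (b t) (A t)) * T' (Φ p) b
        + (∏ s, J (b s) (A s)) * ∑ l, J l i * pd e l (fun q => T' q b) (Φ p)) := by
    rw [pd_congr h.metric.isOpen (fun q hq => hTT q hq A) hp i,
      pd_sum fun b _ => (hprod b).fun_mul (ht b)]
    refine Finset.sum_congr rfl fun b _ => ?_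
    rw [pd_mul (hprod b) (ht b), pd_prod fun s _ => hj _ _, h.pd_comp hp (hT' b)]
  have h2 : ∑ j, ∑ c, christoffel e G p c i (A j) * T p (Function.update A j c)
      = ∑ b : Fin k → Fin n, ∑ j, (pd e i (fun q => jac Φ q (b j) (A j)) p
        + ∑ l, ∑ m, christoffel e G' (Φ p) (b j) l m * J l i * J m (A j))
          * (∏ t ∈ Finset.univ.erase j, J (b t) (A t)) * T' (Φ p) b := by
    rw [Finset.sum_comm (s := Finset.univ (α := Fin k → Fin n))]
    refine Finset.sum_congr rfl fun j _ => ?_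
    have hu : ∀ (b : Fin k → Fin n) c, ∏ s, J (b s) (Function.update A j c s)
        = J (b j) c * ∏ t ∈ Finset.univ.erase j, J (b t) (A t) := by
      intro b c
      rw [← Finset.mul_prod_erase _ _ (Finset.mem_univ j)]
      congr 1
      · simp
      · exact Finset.prod_congr rfl fun t ht => by
          rw [Function.update_of_ne (Finset.ne_of_mem_erase ht)]
    have hT0 : ∀ a, T p a = ∑ b, (∏ s, J (b s) (a s)) * T' (Φ p) b := hTT p hp
    simp_rw [hT0, hu, Finset.mul_sum]
    rw [Finset.sum_comm]
    refine Finset.sum_congr rfl fun b _ => ?_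
    rw [← h.christoffel_eq hp, Finset.sum_mul, Finset.sum_mul]
    exact Finset.sum_congr rfl fun c _ => by ring
  -- The homogeneous part of the transformation law: for each slot j, `sum_update_swap` turns Γ
  -- acting on a Jacobian into Γ acting on the tensor downstairs.
  have h3 : ∑ b : Fin k → Fin n, ∑ j,
        (∑ l, ∑ m, christoffel e G' (Φ p) (b j) l m * J l i * J m (A j))
          * (∏ t ∈ Finset.univ.erase j, J (b t) (A t)) * T' (Φ p) b
      = ∑ l, ∑ b : Fin k → Fin n, J l i * (∏ s, J (b s) (A s)) *
        ∑ j, ∑ c, christoffel e G' (Φ p) c l (b j) * T' (Φ p) (Function.update b j c) := by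
    have l3 : ∑ b : Fin k → Fin n, ∑ j,
        (∑ l, ∑ m, christoffel e G' (Φ p) (b j) l m * J l i * J m (A j))
          * (∏ t ∈ Finset.univ.erase j, J (b t) (A t)) * T' (Φ p) b
        = ∑ l, ∑ j, ∑ b : Fin k → Fin n, ∑ m, J l i * (christoffel e G' (Φ p) (b j) l m
          * (J m (A j) * ∏ t ∈ Finset.univ.erase j, J (b t) (A t)) * T' (Φ p) b) := by
      simp_rw [Finset.sum_mul]
      rw [Finset.sum_comm, Finset.sum_comm (s := Finset.univ (α := Fin n))
        (t := Finset.univ (α := Fin k))]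
      refine Finset.sum_congr rfl fun j _ => ?_
      rw [Finset.sum_comm]
      exact Finset.sum_congr rfl fun l _ => Finset.sum_congr rfl fun b _ =>
        Finset.sum_congr rfl fun m _ => by ring
    rw [l3]
    refine Finset.sum_congr rfl fun l _ => ?_
    simp_rw [Finset.mul_sum]
    rw [Finset.sum_comm (s := Finset.univ (α := Fin k → Fin n))]
    refine Finset.sum_congr rfl fun j _ => ?_
    rw [sum_update_swap j]
    refine Finset.sum_congr rfl fun b _ => Finset.sum_congr rfl fun c _ => ?_
    rw [← Finset.mul_prod_erase _ _ (Finset.mem_univ j)]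
    have : ∏ t ∈ Finset.univ.erase j, J (Function.update b j c t) (A t)
        = ∏ t ∈ Finset.univ.erase j, J (b t) (A t) :=
      Finset.prod_congr rfl fun t ht => by
        rw [Function.update_of_ne (Finset.ne_of_mem_erase ht)]
    rw [this]
    simp only [Function.update_self]
    ring
  have h4 : ∑ b : Fin (k + 1) → Fin n, (∏ s, J (b s) (a s)) * covDeriv e G' T' (Φ p) b
      = ∑ l, ∑ b : Fin k → Fin n, J l i * (∏ s, J (b s) (A s)) *
        (pd e l (fun q => T' q b) (Φ p)
        - ∑ j, ∑ c, christoffel e G' (Φ p) c l (b j) * T' (Φ p) (Function.update b j c)) := by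
    rw [← (Fin.consEquiv fun _ => Fin n).sum_comp, Fintype.sum_prod_type]
    refine Finset.sum_congr rfl fun l _ => Finset.sum_congr rfl fun b _ => ?_
    rw [Fin.prod_univ_succ]
    simp [covDeriv, Fin.consEquiv, i, hA, Fin.tail]
  have h5 : covDeriv e G T p a = pd e i (fun q => T q A) p
      - ∑ j, ∑ c, christoffel e G p c i (A j) * T p (Function.update A j c) := rfl
  rw [h4, h5, h1, h2]
  simp_rw [mul_sub, add_mul, Finset.sum_sub_distrib, Finset.sum_add_distrib]
  rw [h3]
  have h6 : ∑ b : Fin k → Fin n, (∏ s, J (b s) (A s)) * ∑ l, J l i * pd e l (fun q => T' q b) (Φ p)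
      = ∑ l, ∑ b : Fin k → Fin n, J l i * (∏ s, J (b s) (A s)) * pd e l (fun q => T' q b) (Φ p) := by
    simp_rw [Finset.mul_sum]
    rw [Finset.sum_comm]
    exact Finset.sum_congr rfl fun l _ => Finset.sum_congr rfl fun b _ => by ring
  rw [h6]
  simp_rw [Finset.sum_mul]
  ring

/-- A one-form with constant coefficients τ downstairs is pulled back, differentiated twice, and
antisymmetrized. Both sides are then given by the Ricci identity, and since τ is arbitrary this is
the transformation law of the curvature. -/
theorem riemUp_contract (hp : p ∈ U) (τ : Fin n → ℝ) (a b c : Fin n) :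
    ∑ d, riemUp (stdFrame n) G p a b c d * ∑ k, jac Φ p k d * τ k
      = ∑ x, ∑ y, ∑ z, jac Φ p x a * jac Φ p y b * jac Φ p z c
        * ∑ d, riemUp (stdFrame n) G' (Φ p) x y z d * τ d := by
  set T' : Model n → (Fin 1 → Fin n) → ℝ := fun _ b => τ (b 0)
  set T : Model n → (Fin 1 → Fin n) → ℝ := fun q b => ∑ k, jac Φ q k (b 0) * τ k
  have hT' : ∀ a, ContDiffOn ℝ ∞ (fun p => T' p a) U' := fun a => contDiffOn_const
  have hT : ∀ a, ContDiffOn ℝ ∞ (fun p => T p a) U := fun a =>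
    ContDiffOn.sum fun k _ => (h.contDiffOn_jac k _).mul contDiffOn_const
  have h0 : IsPullback Φ U T T' := by
    intro q _ a
    rw [← (Fin.consEquiv fun _ => Fin n).sum_comp, Fintype.sum_prod_type]
    simp [T, T', Fin.consEquiv]
  have h2 := h.isPullback_covDeriv (h.metric'.contDiffOn_covDeriv (e := stdFrame n) hT')
    (h.isPullback_covDeriv hT' h0) p hp
  have r := h.metric.ricci_identity (e := stdFrame n) hp hT a b c
  have r' := fun x y z => h.metric'.ricci_identity (e := stdFrame n) (h.mapsTo hp) hT' x y z
  have h3 : ∀ a b c, covDeriv (stdFrame n) G (covDeriv (stdFrame n) G T) p ![a, b, c]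
      = ∑ x, ∑ y, ∑ z, jac Φ p x a * jac Φ p y b * jac Φ p z c
        * covDeriv (stdFrame n) G' (covDeriv (stdFrame n) G' T') (Φ p) ![x, y, z] := by
    intro a b c
    refine (h2 _).trans ((sum_vec_three _).trans ?_)
    refine Finset.sum_congr rfl fun x _ => Finset.sum_congr rfl fun y _ =>
      Finset.sum_congr rfl fun z _ => congrArg (· * _) ?_
    exact Fin.prod_univ_three _
  rw [h3, h3] at r
  have e1 : (∑ d, riemUp (stdFrame n) G p a b c d * ∑ k, jac Φ p k d * τ k)
      = ∑ d, riemUp (stdFrame n) G p a b c d * T p ![d] := rfl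
  rw [e1, ← r]
  have e2 : ∀ x y z, (∑ d, riemUp (stdFrame n) G' (Φ p) x y z d * τ d)
      = ∑ d, riemUp (stdFrame n) G' (Φ p) x y z d * T' (Φ p) ![d] := fun _ _ _ => rfl
  simp_rw [e2, ← r', mul_sub, Finset.sum_sub_distrib]
  congr 1
  rw [Finset.sum_comm]
  exact Finset.sum_congr rfl fun x _ => Finset.sum_congr rfl fun y _ =>
    Finset.sum_congr rfl fun z _ => by ring

theorem isPullback_riem : IsPullback Φ U (iterCovRiem (stdFrame n) G 0)
    (iterCovRiem (stdFrame n) G' 0) := by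
  intro p hp a
  have h4 : ∀ F : (Fin 4 → Fin n) → ℝ, ∑ b, F b = ∑ x, ∑ y, ∑ z, ∑ w, F ![x, y, z, w] := by
    intro F
    rw [← (Fin.consEquiv fun _ => Fin n).sum_comp, Fintype.sum_prod_type]
    refine Finset.sum_congr rfl fun x _ => ?_
    rw [sum_vec_three]
    rfl
  refine Eq.trans ?_ (h4 _).symm
  -- This choice of τ makes the contraction lower the fourth index upstairs, since G is the pullback
  -- of G'.
  have := h.riemUp_contract hp (fun k => ∑ l, G' (Φ p) k l * jac Φ p l (a 3)) (a 0) (a 1) (a 2)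
  have e1 : iterCovRiem (stdFrame n) G 0 p a
      = ∑ d, riemUp (stdFrame n) G p (a 0) (a 1) (a 2) d
        * ∑ k, jac Φ p k d * ∑ l, G' (Φ p) k l * jac Φ p l (a 3) := by
    change ∑ d, riemUp (stdFrame n) G p (a 0) (a 1) (a 2) d * G p d (a 3) = _
    refine Finset.sum_congr rfl fun d _ => congrArg _ ?_
    rw [h.pullback p hp]
    refine Finset.sum_congr rfl fun k _ => ?_
    rw [Finset.mul_sum]
    exact Finset.sum_congr rfl fun l _ => by ring
  rw [e1, this]
  refine Finset.sum_congr rfl fun x _ => Finset.sum_congr rfl fun y _ =>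
    Finset.sum_congr rfl fun z _ => ?_
  have e3 : ∀ w, (∏ s : Fin 4, jac Φ p ((![x, y, z, w] : Fin 4 → Fin n) s) (a s))
      * iterCovRiem (stdFrame n) G' 0 (Φ p) ![x, y, z, w]
      = jac Φ p x (a 0) * jac Φ p y (a 1) * jac Φ p z (a 2) * jac Φ p w (a 3)
        * ∑ d, riemUp (stdFrame n) G' (Φ p) x y z d * G' (Φ p) d w := fun w =>
    congrArg (· * _) (Fin.prod_univ_four _)
  refine Eq.trans ?_ (Finset.sum_congr rfl fun w _ => (e3 w).symm)
  simp_rw [Finset.mul_sum]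
  rw [Finset.sum_comm]
  exact Finset.sum_congr rfl fun w _ => Finset.sum_congr rfl fun d _ => by ring

theorem isPullback_iterCovRiem (N : ℕ) : IsPullback Φ U (iterCovRiem (stdFrame n) G N)
    (iterCovRiem (stdFrame n) G' N) := by
  induction N with
  | zero => exact h.isPullback_riem
  | succ N ih => exact h.isPullback_covDeriv (h.metric'.contDiffOn_iterCovRiem N) ih

theorem inv_eq (hp : p ∈ U) (x y : Fin n) :
    inv G' (Φ p) x y = ∑ a, ∑ b, jac Φ p x a * jac Φ p y b * inv G p a b := by
  set J := Matrix.of (jac Φ p)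
  have hJ : IsUnit J.det := (h.det_jac_ne hp).isUnit
  have hJt : IsUnit J.transpose.det := by rwa [Matrix.det_transpose]
  have key : (G' (Φ p))⁻¹ = J * (G p)⁻¹ * J.transpose := by
    rw [h.eq_transpose_mul hp, Matrix.mul_inv_rev, Matrix.mul_inv_rev, ← Matrix.mul_assoc,
      ← Matrix.mul_assoc, Matrix.mul_nonsing_inv _ hJ, Matrix.one_mul, Matrix.mul_assoc,
      Matrix.nonsing_inv_mul _ hJt, Matrix.mul_one]
  unfold inv
  rw [key, Matrix.mul_apply]
  simp_rw [Matrix.mul_apply, Finset.sum_mul]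
  rw [Finset.sum_comm]
  exact Finset.sum_congr rfl fun a _ => Finset.sum_congr rfl fun b _ => by
    simp only [J, Matrix.of_apply, Matrix.transpose_apply]; ring

end IsIsometryOn

end Transition


/-! ### Sums over families of paired indices. -/

section Sums

variable {ι Q : Type} [Fintype ι] [Fintype Q] [DecidableEq Q]

theorem sum_pairs (F : (Q → ι) → (Q → ι) → ℝ) :
    ∑ x : Q × Fin 2 → ι, F (fun q => x (q, 0)) (fun q => x (q, 1)) = ∑ a, ∑ c, F a c := by
  rw [← Fintype.sum_prod_type']
  refine Fintype.sum_equiv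
    { toFun := fun x => ((fun q => x (q, 0)), fun q => x (q, 1))
      invFun := fun y z => if z.2 = 0 then y.1 z.1 else y.2 z.1
      left_inv := fun x => by
        funext ⟨q, i⟩
        fin_cases i <;> simp
      right_inv := fun y => by simp } _ _ fun x => rfl

theorem prod_sum_pairs (F : Q → ι → ι → ℝ) :
    ∏ q, ∑ a, ∑ b, F q a b = ∑ x : Q × Fin 2 → ι, ∏ q, F q (x (q, 0)) (x (q, 1)) := by
  rw [sum_pairs (fun a c : Q → ι => ∏ q, F q (a q) (c q))]
  have h1 : ∀ H : Q → ι → ℝ, ∏ q, ∑ a, H q a = ∑ a : Q → ι, ∏ q, H q (a q) := by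
    intro H
    rw [Finset.prod_univ_sum]
    simp
  rw [h1]
  exact Finset.sum_congr rfl fun a _ => h1 _

end Sums

/-! ### Tensors and scalars built from the curvature and its derivatives. -/

variable {n : ℕ}

/-- A covariant `k`-tensor depending on a metric. -/
abbrev NatTensor (n k : ℕ) : Type :=
  (Model n → Matrix (Fin n) (Fin n) ℝ) → Model n → (Fin k → Fin n) → ℝ

/-- The tensor product. -/
def NatTensor.mul {k l : ℕ} (X : NatTensor n k) (Y : NatTensor n l) : NatTensor n (k + l) :=
  fun G p a => X G p (fun i => a (Fin.castAdd l i)) * Y G p (fun i => a (Fin.natAdd k i))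

/-- Renaming of the slots. -/
def NatTensor.reindex {k l : ℕ} (σ : Fin k → Fin l) (X : NatTensor n k) : NatTensor n l :=
  fun G p a => X G p (fun i => a (σ i))

/-- Tensor products of iterated covariant derivatives of the curvature tensor. -/
inductive CurvMonomial (n : ℕ) : (k : ℕ) → NatTensor n k → Prop
  | one : CurvMonomial n 0 (fun _ _ _ => 1)
  | riem (N : ℕ) : CurvMonomial n (4 + N) (fun G => iterCovRiem (stdFrame n) G N)
  | mul {k l : ℕ} {X : NatTensor n k} {Y : NatTensor n l} :
      CurvMonomial n k X → CurvMonomial n l Y → CurvMonomial n (k + l) (X.mul Y)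
  | reindex {k l : ℕ} {X : NatTensor n k} (σ : Fin k → Fin l) (hσ : Function.Bijective σ) :
      CurvMonomial n k X → CurvMonomial n l (X.reindex σ)

/-- Linear combinations of curvature monomials. -/
def CurvPoly (n k : ℕ) : Submodule ℝ (NatTensor n k) :=
  Submodule.span ℝ {X | CurvMonomial n k X}

section Span

variable {k l : ℕ}

theorem CurvMonomial.mem {X : NatTensor n k} (h : CurvMonomial n k X) : X ∈ CurvPoly n k :=
  Submodule.subset_span h

theorem CurvPoly.mul_mem {X : NatTensor n k} {Y : NatTensor n l} (hX : X ∈ CurvPoly n k)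
    (hY : Y ∈ CurvPoly n l) : X.mul Y ∈ CurvPoly n (k + l) := by
  unfold CurvPoly at hX
  induction hX using Submodule.span_induction with
  | mem X hX =>
    unfold CurvPoly at hY
    induction hY using Submodule.span_induction with
    | mem Y hY => exact (CurvMonomial.mul hX hY).mem
    | zero => convert Submodule.zero_mem _; funext G p a; simp [NatTensor.mul]
    | add Y Z _ _ h1 h2 =>
      convert Submodule.add_mem _ h1 h2 using 1; funext G p a; simp [NatTensor.mul, mul_add]
    | smul c Y _ h1 =>
      convert Submodule.smul_mem _ c h1 using 1; funext G p a; simp [NatTensor.mul]; ring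
  | zero => convert Submodule.zero_mem _; funext G p a; simp [NatTensor.mul]
  | add Y Z _ _ h1 h2 =>
    convert Submodule.add_mem _ h1 h2 using 1; funext G p a; simp [NatTensor.mul, add_mul]
  | smul c Y _ h1 =>
    convert Submodule.smul_mem _ c h1 using 1; funext G p a; simp [NatTensor.mul]; ring

theorem CurvPoly.reindex_mem {X : NatTensor n k} (hX : X ∈ CurvPoly n k) (σ : Fin k → Fin l)
    (hσ : Function.Bijective σ) : X.reindex σ ∈ CurvPoly n l := by
  unfold CurvPoly at hX
  induction hX using Submodule.span_induction with
  | mem X hX => exact (CurvMonomial.reindex σ hσ hX).mem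
  | zero => exact Submodule.zero_mem _
  | add Y Z _ _ h1 h2 => exact Submodule.add_mem _ h1 h2
  | smul c Y _ h1 => exact Submodule.smul_mem _ c h1

theorem CurvMonomial.contDiffOn {X : NatTensor n k} (hX : CurvMonomial n k X)
    {G : Model n → Matrix (Fin n) (Fin n) ℝ} {U : Set (Model n)} (hG : IsMetricOn G U)
    (a : Fin k → Fin n) : ContDiffOn ℝ ∞ (fun p => X G p a) U := by
  induction hX with
  | one => exact contDiffOn_const
  | riem N => exact hG.contDiffOn_iterCovRiem N a
  | mul _ _ h1 h2 => exact (h1 _).mul (h2 _)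
  | reindex σ hσ _ h => exact h _

theorem CurvPoly.contDiffOn {X : NatTensor n k} (hX : X ∈ CurvPoly n k)
    {G : Model n → Matrix (Fin n) (Fin n) ℝ} {U : Set (Model n)} (hG : IsMetricOn G U)
    (a : Fin k → Fin n) : ContDiffOn ℝ ∞ (fun p => X G p a) U := by
  unfold CurvPoly at hX
  induction hX using Submodule.span_induction with
  | mem X hX => exact CurvMonomial.contDiffOn hX hG a
  | zero => exact contDiffOn_const
  | add Y Z _ _ h1 h2 => exact h1.add h2
  | smul c Y _ h1 => exact contDiffOn_const.mul h1

theorem CurvMonomial.isPullback {X : NatTensor n k} (hX : CurvMonomial n k X)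
    {G G' : Model n → Matrix (Fin n) (Fin n) ℝ} {U U' : Set (Model n)} {Φ : Model n → Model n}
    (h : IsIsometryOn Φ G G' U U') : IsPullback Φ U (X G) (X G') := by
  induction hX with
  | one => intro p hp a; simp
  | riem N => exact h.isPullback_iterCovRiem N
  | @mul k l X Y _ _ h1 h2 =>
    intro p hp a
    rw [← (Fin.appendEquiv k l).sum_comp, Fintype.sum_prod_type]
    simp only [NatTensor.mul]
    rw [h1 p hp, h2 p hp, Finset.sum_mul_sum]
    refine Finset.sum_congr rfl fun b _ => Finset.sum_congr rfl fun c _ => ?_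
    rw [Fin.prod_univ_add]
    simp [Fin.appendEquiv]
    ring
  | @reindex k l X σ hσ _ h1 =>
    intro p hp a
    simp only [NatTensor.reindex]
    rw [h1 p hp]
    set s := Equiv.ofBijective σ hσ
    rw [← (s.arrowCongr (Equiv.refl (Fin n))).sum_comp]
    refine Finset.sum_congr rfl fun b _ => ?_
    rw [← s.prod_comp]
    have : ∀ i, σ i = s i := fun i => rfl
    simp [this]

end Span

theorem covDeriv_reindex {G : Model n → Matrix (Fin n) (Fin n) ℝ} {k l : ℕ}
    {T : Model n → (Fin k → Fin n) → ℝ} (σ : Fin k → Fin l) (hσ : Function.Bijective σ)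
    (p : Model n) (a : Fin (l + 1) → Fin n) :
    covDeriv (stdFrame n) G (fun q b => T q (fun i => b (σ i))) p a
      = covDeriv (stdFrame n) G T p
        (fun i => a ((Fin.cons 0 (fun j => (σ j).succ) : Fin (k + 1) → Fin (l + 1)) i)) := by
  unfold covDeriv
  have h1 : (Fin.tail fun i => a ((Fin.cons 0 (fun j => (σ j).succ) : Fin (k + 1) → Fin (l + 1)) i))
      = fun i => Fin.tail a (σ i) := by
    funext i; simp [Fin.tail]
  rw [h1]
  simp only [Fin.cons_zero, Fin.cons_succ]
  congr 1
  refine (Function.Bijective.sum_comp hσ _).symm.trans ?_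
  refine Finset.sum_congr rfl fun j _ => Finset.sum_congr rfl fun c _ => ?_
  congr 2
  funext i
  by_cases h : i = j
  · subst h; simp
  · rw [Function.update_of_ne h, Function.update_of_ne (fun h' => h (hσ.1 h'))]

theorem covDeriv_mul {G : Model n → Matrix (Fin n) (Fin n) ℝ} {k l : ℕ}
    {S : Model n → (Fin k → Fin n) → ℝ} {T : Model n → (Fin l → Fin n) → ℝ} {p : Model n}
    (hS : ∀ a, DifferentiableAt ℝ (fun q => S q a) p)
    (hT : ∀ a, DifferentiableAt ℝ (fun q => T q a) p) (a : Fin (k + l + 1) → Fin n) :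
    covDeriv (stdFrame n) G
        (fun q b => S q (fun i => b (Fin.castAdd l i)) * T q (fun i => b (Fin.natAdd k i))) p a
      = covDeriv (stdFrame n) G S p (Fin.cons (a 0) fun i => Fin.tail a (Fin.castAdd l i))
          * T p (fun i => Fin.tail a (Fin.natAdd k i))
        + S p (fun i => Fin.tail a (Fin.castAdd l i))
          * covDeriv (stdFrame n) G T p (Fin.cons (a 0) fun i => Fin.tail a (Fin.natAdd k i)) := by
  unfold covDeriv
  rw [pd_mul (hS _) (hT _), Fin.sum_univ_add]
  simp only [Fin.cons_zero, Fin.tail_cons, Fin.cons_succ]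
  have h1 : ∀ (j : Fin k) (c : Fin n),
      (fun i => Function.update (Fin.tail a) (Fin.castAdd l j) c (Fin.castAdd l i))
        = Function.update (fun i => Fin.tail a (Fin.castAdd l i)) j c := by
    intro j c; funext i
    by_cases h : i = j
    · subst h; simp
    · rw [Function.update_of_ne h, Function.update_of_ne (by simpa using h)]
  have h2 : ∀ (j : Fin l) (c : Fin n),
      (fun i => Function.update (Fin.tail a) (Fin.natAdd k j) c (Fin.natAdd k i))
        = Function.update (fun i => Fin.tail a (Fin.natAdd k i)) j c := by
    intro j c; funext i
    by_cases h : i = j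
    · subst h; simp
    · rw [Function.update_of_ne h, Function.update_of_ne (by simpa using h)]
  have h3 : ∀ (j : Fin k) (c : Fin n),
      (fun i => Function.update (Fin.tail a) (Fin.castAdd l j) c (Fin.natAdd k i))
        = fun i => Fin.tail a (Fin.natAdd k i) := by
    intro j c; funext i
    rw [Function.update_of_ne]
    intro h; have := congrArg Fin.val h; simp at this; omega
  have h4 : ∀ (j : Fin l) (c : Fin n),
      (fun i => Function.update (Fin.tail a) (Fin.natAdd k j) c (Fin.castAdd l i))
        = fun i => Fin.tail a (Fin.castAdd l i) := by
    intro j c; funext i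
    rw [Function.update_of_ne]
    intro h; have := congrArg Fin.val h; simp at this; omega
  simp_rw [h1, h2, h3, h4]
  have e1 : ∀ j, (Fin.tail a j) = a j.succ := fun _ => rfl
  simp_rw [e1, sub_mul, mul_sub, Finset.sum_mul, Finset.mul_sum]
  simp_rw [mul_assoc, mul_left_comm (S p _)]
  ring

/-- The Leibniz rule. The only subtlety is bookkeeping: the derivative index must come first, so
each Leibniz term needs its slots renamed. This is why `CurvMonomial` is closed under reindexing,
and why the derivative of a monomial lies in the linear span. -/
theorem CurvMonomial.exists_covDeriv {k : ℕ} {X : NatTensor n k} (hX : CurvMonomial n k X) :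
    ∃ Y ∈ CurvPoly n (k + 1), ∀ (G : Model n → Matrix (Fin n) (Fin n) ℝ) (U : Set (Model n)),
      IsMetricOn G U → ∀ p ∈ U, ∀ a, covDeriv (stdFrame n) G (X G) p a = Y G p a := by
  induction hX with
  | one =>
    refine ⟨0, Submodule.zero_mem _, fun G U hG p hp a => ?_⟩
    simp [covDeriv, pd_const]
  | riem N => exact ⟨_, (CurvMonomial.riem (N + 1)).mem, fun G U hG p hp a => rfl⟩
  | @mul k l X Y hX hY h1 h2 =>
    obtain ⟨X', hX', h1⟩ := h1
    obtain ⟨Y', hY', h2⟩ := h2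
    have b1 : Function.Bijective (Fin.cast (by omega) : Fin (k + 1 + l) → Fin (k + l + 1)) :=
      (finCongr (by omega)).bijective
    -- When the second factor is differentiated, the new index stands at position k, behind the
    -- slots of the first factor. It is moved to the front, and the first k slots shift up by one.
    let τ : Fin (k + (l + 1)) → Fin (k + l + 1) := fun i =>
      ⟨if i.val < k then i.val + 1 else if i.val = k then 0 else i.val, by split_ifs <;> omega⟩
    have b2 : Function.Bijective τ := by
      rw [Fintype.bijective_iff_injective_and_card]
      refine ⟨fun i j hij => ?_, by simp; omega⟩
      have := congrArg Fin.val hij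
      simp only [τ] at this
      ext
      split_ifs at this <;> omega
    refine ⟨(X'.mul Y).reindex _ + (X.mul Y').reindex _,
      Submodule.add_mem _ (CurvPoly.reindex_mem (CurvPoly.mul_mem hX' hY.mem) _ b1)
        (CurvPoly.reindex_mem (CurvPoly.mul_mem hX.mem hY') _ b2), fun G U hG p hp a => ?_⟩
    have d1 := fun a => differentiableAt_of_contDiffOn hG.isOpen (hX.contDiffOn hG a) hp
    have d2 := fun a => differentiableAt_of_contDiffOn hG.isOpen (hY.contDiffOn hG a) hp
    refine (covDeriv_mul d1 d2 a).trans ?_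
    rw [h1 G U hG p hp, h2 G U hG p hp]
    simp only [Pi.add_apply, NatTensor.reindex, NatTensor.mul]
    congr 3
    · funext i
      refine Fin.cases ?_ (fun j => ?_) i
      · rfl
      · rfl
    · funext i
      simp only [Fin.tail]
      congr 1
      ext
      simp
      omega
    · funext i
      simp only [Fin.tail]
      congr 1
      ext
      simp [τ]
    · funext i
      refine Fin.cases ?_ (fun j => ?_) i
      · simp [τ]
      · simp only [Fin.tail, Fin.cons_succ]
        congr 1
        ext
        simp [τ]
        omega
  | @reindex k l X σ hσ _ h1 =>
    obtain ⟨X', hX', h1⟩ := h1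
    have b : Function.Bijective (Fin.cons 0 (fun j => (σ j).succ) : Fin (k + 1) → Fin (l + 1)) := by
      rw [Fintype.bijective_iff_injective_and_card]
      refine ⟨?_, by simpa using Fintype.card_of_bijective hσ⟩
      rw [Fin.cons_injective_iff]
      refine ⟨by simp [Fin.succ_ne_zero], fun i j hij => hσ.1 (Fin.succ_injective _ hij)⟩
    refine ⟨X'.reindex _, CurvPoly.reindex_mem hX' _ b, fun G U hG p hp a => ?_⟩
    refine (covDeriv_reindex σ hσ p a).trans ?_
    rw [h1 G U hG p hp]
    rfl

theorem CurvPoly.exists_covDeriv {k : ℕ} {X : NatTensor n k} (hX : X ∈ CurvPoly n k) :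
    ∃ Y ∈ CurvPoly n (k + 1), ∀ (G : Model n → Matrix (Fin n) (Fin n) ℝ) (U : Set (Model n)),
      IsMetricOn G U → ∀ p ∈ U, ∀ a, covDeriv (stdFrame n) G (X G) p a = Y G p a := by
  unfold CurvPoly at hX
  induction hX using Submodule.span_induction with
  | zero =>
    refine ⟨0, Submodule.zero_mem _, fun G U hG p hp a => ?_⟩
    simp [covDeriv, pd_const]
  | add Y Z hY hZ h1 h2 =>
    obtain ⟨Y', hY', h1⟩ := h1
    obtain ⟨Z', hZ', h2⟩ := h2
    refine ⟨Y' + Z', Submodule.add_mem _ hY' hZ', fun G U hG p hp a => ?_⟩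
    have d1 := differentiableAt_of_contDiffOn hG.isOpen (CurvPoly.contDiffOn hY hG (Fin.tail a)) hp
    have d2 := differentiableAt_of_contDiffOn hG.isOpen (CurvPoly.contDiffOn hZ hG (Fin.tail a)) hp
    simp only [Pi.add_apply]
    rw [← h1 G U hG p hp, ← h2 G U hG p hp]
    unfold covDeriv
    simp only [Pi.add_apply, mul_add, Finset.sum_add_distrib]
    rw [pd_add d1 d2]
    ring
  | smul c Y hY h1 =>
    obtain ⟨Y', hY', h1⟩ := h1
    refine ⟨c • Y', Submodule.smul_mem _ c hY', fun G U hG p hp a => ?_⟩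
    have d1 := differentiableAt_of_contDiffOn hG.isOpen (CurvPoly.contDiffOn hY hG (Fin.tail a)) hp
    simp only [Pi.smul_apply, smul_eq_mul]
    rw [← h1 G U hG p hp]
    unfold covDeriv
    simp only [Pi.smul_apply, smul_eq_mul]
    rw [pd_const_mul d1, mul_sub, Finset.mul_sum]
    congr 1
    refine Finset.sum_congr rfl fun j _ => ?_
    rw [Finset.mul_sum]
    exact Finset.sum_congr rfl fun d _ => by ring
  | mem X hX => exact CurvMonomial.exists_covDeriv hX

/-! ### Complete contractions -/

/-- The complete contraction of a tensor with respect to a pairing of its slots. -/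
noncomputable def contract {k m : ℕ} (σ : Fin m × Fin 2 ≃ Fin k) (X : NatTensor n k)
    (G : Model n → Matrix (Fin n) (Fin n) ℝ) (p : Model n) : ℝ :=
  ∑ a : Fin k → Fin n, (∏ q, inv G p (a (σ (q, 0))) (a (σ (q, 1)))) * X G p a

/-- Linear combinations of complete contractions of curvature monomials. -/
def CurvScalar (n : ℕ) : Submodule ℝ ((Model n → Matrix (Fin n) (Fin n) ℝ) → Model n → ℝ) :=
  Submodule.span ℝ {f | ∃ (k m : ℕ) (σ : Fin m × Fin 2 ≃ Fin k) (X : NatTensor n k),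
    CurvMonomial n k X ∧ f = contract σ X}

theorem CurvPoly.contract_mem {k m : ℕ} (σ : Fin m × Fin 2 ≃ Fin k) {X : NatTensor n k}
    (hX : X ∈ CurvPoly n k) : contract σ X ∈ CurvScalar n := by
  unfold CurvPoly at hX
  induction hX using Submodule.span_induction with
  | mem X hX => exact Submodule.subset_span ⟨k, m, σ, X, hX, rfl⟩
  | zero => convert Submodule.zero_mem _; funext G p; simp [contract]
  | add Y Z _ _ h1 h2 =>
    convert Submodule.add_mem _ h1 h2 using 1; funext G p
    simp [contract, mul_add, Finset.sum_add_distrib]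
  | smul c Y _ h1 =>
    convert Submodule.smul_mem _ c h1 using 1; funext G p
    simp only [contract, Pi.smul_apply, smul_eq_mul, Finset.mul_sum]
    exact Finset.sum_congr rfl fun _ _ => by ring

/-- Slots and pairs may be labelled by arbitrary finite types. Products then use sum types, and the
Pfaffian its natural labels, without numbering the slots by hand. -/
theorem CurvMonomial.contract_mem {Q S : Type} [Fintype Q] [Fintype S] [DecidableEq Q]
    [DecidableEq S] {k : ℕ} {X : NatTensor n k} (hX : CurvMonomial n k X) (σ : Q × Fin 2 ≃ S)
    (e : Fin k ≃ S) :
    (fun G p => ∑ x : S → Fin n, (∏ q, inv G p (x (σ (q, 0))) (x (σ (q, 1))))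
      * X G p (fun i => x (e i))) ∈ CurvScalar n := by
  let ε := Fintype.equivFin Q
  have := CurvPoly.contract_mem
    (((ε.symm.prodCongr (Equiv.refl (Fin 2))).trans σ).trans e.symm) hX.mem
  convert this using 1
  funext G p
  unfold contract
  refine Fintype.sum_equiv (e.symm.arrowCongr (Equiv.refl (Fin n))) _ _ fun x => ?_
  congr 1
  rw [← ε.symm.prod_comp]
  simp

theorem CurvScalar.mul_mem {f g : (Model n → Matrix (Fin n) (Fin n) ℝ) → Model n → ℝ}
    (hf : f ∈ CurvScalar n) (hg : g ∈ CurvScalar n) : f * g ∈ CurvScalar n := by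
  unfold CurvScalar at hf
  induction hf using Submodule.span_induction with
  | zero => rw [zero_mul]; exact Submodule.zero_mem _
  | add Y Z _ _ h1 h2 => rw [add_mul]; exact Submodule.add_mem _ h1 h2
  | smul c Y _ h1 => rw [smul_mul_assoc]; exact Submodule.smul_mem _ c h1
  | mem f hf =>
    unfold CurvScalar at hg
    induction hg using Submodule.span_induction with
    | zero => rw [mul_zero]; exact Submodule.zero_mem _
    | add Y Z _ _ h1 h2 => rw [mul_add]; exact Submodule.add_mem _ h1 h2
    | smul c Y _ h1 => rw [mul_smul_comm]; exact Submodule.smul_mem _ c h1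
    | mem g hg =>
      obtain ⟨k, m, σ, X, hX, rfl⟩ := hf
      obtain ⟨l, m', τ, Y, hY, rfl⟩ := hg
      have := (CurvMonomial.mul hX hY).contract_mem
        ((Equiv.sumProdDistrib (Fin m) (Fin m') (Fin 2)).trans (σ.sumCongr τ)) finSumFinEquiv.symm
      convert this using 1
      funext G p
      simp only [Pi.mul_apply, contract]
      rw [Finset.sum_mul_sum, ← Fintype.sum_prod_type']
      refine Fintype.sum_equiv (Equiv.sumArrowEquivProdArrow (Fin k) (Fin l) (Fin n)).symm _ _
        fun x => ?_
      obtain ⟨x, y⟩ := x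
      rw [Fintype.prod_sum_type]
      simp [NatTensor.mul, Equiv.sumArrowEquivProdArrow]
      ring

theorem CurvMonomial.contDiffOn_contract {k m : ℕ} (σ : Fin m × Fin 2 ≃ Fin k) {X : NatTensor n k}
    (hX : CurvMonomial n k X) {G : Model n → Matrix (Fin n) (Fin n) ℝ} {U : Set (Model n)}
    (hG : IsMetricOn G U) : ContDiffOn ℝ ∞ (contract σ X G) U :=
  ContDiffOn.sum fun a _ => (contDiffOn_prod fun _ _ => hG.contDiffOn_inv _ _).mul
    (hX.contDiffOn hG a)

theorem CurvScalar.contDiffOn {f : (Model n → Matrix (Fin n) (Fin n) ℝ) → Model n → ℝ}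
    (hf : f ∈ CurvScalar n) {G : Model n → Matrix (Fin n) (Fin n) ℝ} {U : Set (Model n)}
    (hG : IsMetricOn G U) : ContDiffOn ℝ ∞ (f G) U := by
  unfold CurvScalar at hf
  induction hf using Submodule.span_induction with
  | zero => exact contDiffOn_const
  | add Y Z _ _ h1 h2 => exact h1.add h2
  | smul c Y _ h1 => exact contDiffOn_const.mul h1
  | mem f hf =>
    obtain ⟨k, m, σ, X, hX, rfl⟩ := hf
    exact hX.contDiffOn_contract σ hG

/-- Every slot of the tensor contributes one Jacobian factor, and these are absorbed pairwise by the
inverse metrics through `inv_eq`. This is what makes the value of an invariant independent of the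
chart. -/
theorem CurvScalar.eq_of_isIsometryOn
    {f : (Model n → Matrix (Fin n) (Fin n) ℝ) → Model n → ℝ} (hf : f ∈ CurvScalar n)
    {G G' : Model n → Matrix (Fin n) (Fin n) ℝ} {U U' : Set (Model n)} {Φ : Model n → Model n}
    (h : IsIsometryOn Φ G G' U U') {p : Model n} (hp : p ∈ U) : f G p = f G' (Φ p) := by
  unfold CurvScalar at hf
  induction hf using Submodule.span_induction with
  | zero => rfl
  | add Y Z _ _ h1 h2 => simp [h1, h2]
  | smul c Y _ h1 => simp [h1]
  | mem f hf =>
    obtain ⟨k, m, σ, X, hX, rfl⟩ := hf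
    unfold contract
    simp_rw [hX.isPullback h p hp, Finset.mul_sum]
    rw [Finset.sum_comm]
    refine Finset.sum_congr rfl fun b _ => ?_
    simp_rw [← mul_assoc, ← Finset.sum_mul]
    congr 1
    simp_rw [h.inv_eq hp]
    rw [prod_sum_pairs]
    refine Fintype.sum_equiv (σ.symm.arrowCongr (Equiv.refl (Fin n))) _ _ fun a => ?_
    rw [← σ.prod_comp, Fintype.prod_prod_type, ← Finset.prod_mul_distrib]
    refine Finset.prod_congr rfl fun q _ => ?_
    simp [Fin.prod_univ_two]
    ring


/-! ### The Laplacian of a complete contraction. -/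

section Laplacian

variable {n : ℕ} {G : Model n → Matrix (Fin n) (Fin n) ℝ} {U : Set (Model n)} {p : Model n}
  {k m : ℕ}

/-- Since the pairing is a bijection, every slot lies in exactly one factor g⁻¹, and parallelism of
g⁻¹ becomes a sum over slots. In this shape `sum_update_swap` can transfer the Christoffel symbols
to the contracted tensor. -/
theorem IsMetricOn.pd_prod_inv (hG : IsMetricOn G U) (hp : p ∈ U) (σ : Fin m × Fin 2 ≃ Fin k)
    (b : Fin n) (a : Fin k → Fin n) :
    pd (stdFrame n) b (fun q => ∏ r, inv G q (a (σ (r, 0))) (a (σ (r, 1)))) p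
      = -∑ j, ∑ c, christoffel (stdFrame n) G p (a j) b c
        * ∏ r, inv G p (Function.update a j c (σ (r, 0))) (Function.update a j c (σ (r, 1))) := by
  have hd : ∀ x y, DifferentiableAt ℝ (fun q => inv G q x y) p := fun x y =>
    differentiableAt_of_contDiffOn hG.isOpen (hG.contDiffOn_inv x y) hp
  rw [pd_prod fun r _ => hd _ _, ← σ.sum_comp, Fintype.sum_prod_type, ← Finset.sum_neg_distrib]
  refine Finset.sum_congr rfl fun r _ => ?_
  rw [hG.pd_inv hp, Fin.sum_univ_two]
  have hne : ∀ s ∈ Finset.univ.erase r, ∀ i j : Fin 2, σ (s, i) ≠ σ (r, j) := by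
    intro s hs i j h
    exact Finset.ne_of_mem_erase hs (congrArg Prod.fst (σ.injective h))
  have h01 : σ (r, 1) ≠ σ (r, 0) := fun h => by simpa using congrArg Prod.snd (σ.injective h)
  have e0 : ∀ c, ∏ s, inv G p (Function.update a (σ (r, 0)) c (σ (s, 0)))
      (Function.update a (σ (r, 0)) c (σ (s, 1)))
      = inv G p c (a (σ (r, 1)))
        * ∏ s ∈ Finset.univ.erase r, inv G p (a (σ (s, 0))) (a (σ (s, 1))) := by
    intro c
    rw [← Finset.mul_prod_erase _ _ (Finset.mem_univ r)]
    congr 1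
    · rw [Function.update_self, Function.update_of_ne h01]
    · exact Finset.prod_congr rfl fun s hs => by
        rw [Function.update_of_ne (hne s hs _ _), Function.update_of_ne (hne s hs _ _)]
  have e1 : ∀ c, ∏ s, inv G p (Function.update a (σ (r, 1)) c (σ (s, 0)))
      (Function.update a (σ (r, 1)) c (σ (s, 1)))
      = inv G p (a (σ (r, 0))) c
        * ∏ s ∈ Finset.univ.erase r, inv G p (a (σ (s, 0))) (a (σ (s, 1))) := by
    intro c
    rw [← Finset.mul_prod_erase _ _ (Finset.mem_univ r)]
    congr 1
    · rw [Function.update_self, Function.update_of_ne h01.symm]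
    · exact Finset.prod_congr rfl fun s hs => by
        rw [Function.update_of_ne (hne s hs _ _), Function.update_of_ne (hne s hs _ _)]
  simp_rw [e0, e1, ← mul_assoc, ← Finset.sum_mul]
  ring

/-- Differentiation commutes with contraction. The direction b is a spectator and receives no
correction term here, so the lemma can also be applied to a tensor that already carries one
derivative index. -/
theorem IsMetricOn.pd_contract (hG : IsMetricOn G U) (hp : p ∈ U) (σ : Fin m × Fin 2 ≃ Fin k)
    {T : Model n → (Fin k → Fin n) → ℝ} (hT : ∀ a, ContDiffOn ℝ ∞ (fun p => T p a) U) (b : Fin n) :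
    pd (stdFrame n) b (contract σ (fun _ => T) G) p
      = contract σ (fun G p a => pd (stdFrame n) b (fun q => T q a) p
        - ∑ j, ∑ c, christoffel (stdFrame n) G p c b (a j) * T p (Function.update a j c)) G p := by
  have hd : ∀ a : Fin k → Fin n,
      DifferentiableAt ℝ (fun q => ∏ r, inv G q (a (σ (r, 0))) (a (σ (r, 1)))) p := fun a =>
    differentiableAt_of_contDiffOn hG.isOpen (contDiffOn_prod fun _ _ => hG.contDiffOn_inv _ _) hp
  have ht := fun a => differentiableAt_of_contDiffOn hG.isOpen (hT a) hp
  unfold contract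
  rw [pd_sum fun a _ => (hd a).fun_mul (ht a)]
  simp_rw [pd_mul (hd _) (ht _), mul_sub, Finset.sum_sub_distrib, Finset.sum_add_distrib,
    hG.pd_prod_inv hp]
  have key : ∑ a : Fin k → Fin n, (∑ j, ∑ c, christoffel (stdFrame n) G p (a j) b c
        * ∏ r, inv G p (Function.update a j c (σ (r, 0))) (Function.update a j c (σ (r, 1)))) * T p a
      = ∑ a : Fin k → Fin n, (∏ r, inv G p (a (σ (r, 0))) (a (σ (r, 1))))
        * ∑ j, ∑ c, christoffel (stdFrame n) G p c b (a j) * T p (Function.update a j c) := by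
    simp_rw [Finset.sum_mul, Finset.mul_sum]
    rw [Finset.sum_comm, Finset.sum_comm (s := Finset.univ (α := Fin k → Fin n))]
    refine Finset.sum_congr rfl fun j _ => ?_
    rw [sum_update_swap j]
    refine Finset.sum_congr rfl fun a _ => Finset.sum_congr rfl fun c _ => ?_
    simp
    ring
  simp_rw [neg_mul, Finset.sum_neg_distrib]
  rw [key]
  ring

theorem covDeriv_cons (T : Model n → (Fin k → Fin n) → ℝ) (b : Fin n) (a : Fin k → Fin n) :
    covDeriv (stdFrame n) G T p (Fin.cons b a)
      = pd (stdFrame n) b (fun q => T q a) p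
        - ∑ j, ∑ c, christoffel (stdFrame n) G p c b (a j) * T p (Function.update a j c) := by
  simp [covDeriv]

/-- The pairing of `k + 2` slots that pairs the first two with each other. -/
noncomputable def pairFirst (σ : Fin m × Fin 2 ≃ Fin k) : Fin (m + 1) × Fin 2 ≃ Fin (k + 2) :=
  Equiv.ofBijective
    (fun x => Fin.cases (motive := fun _ => Fin (k + 2)) (Fin.castLE (by omega) x.2)
      (fun q => (σ (q, x.2)).succ.succ) x.1) (by
    have hc : m * 2 = k := by simpa using Fintype.card_congr σ
    rw [Fintype.bijective_iff_injective_and_card]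
    refine ⟨?_, by simp; omega⟩
    rintro ⟨q, i⟩ ⟨r, j⟩ h
    induction q using Fin.cases with
    | zero =>
      induction r using Fin.cases with
      | zero =>
        have h' : i = j := Fin.castLE_injective (by omega : 2 ≤ k + 2) h
        rw [h']
      | succ r =>
        have h' : i.val = (σ (r, j)).val + 1 + 1 := congrArg Fin.val h
        omega
    | succ q =>
      induction r using Fin.cases with
      | zero =>
        have h' : (σ (q, i)).val + 1 + 1 = j.val := congrArg Fin.val h
        omega
      | succ r =>
        have h' : (σ (q, i)).succ.succ = (σ (r, j)).succ.succ := h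
        have := σ.injective (Fin.succ_injective _ (Fin.succ_injective _ h'))
        simp only [Prod.mk.injEq] at this ⊢
        exact ⟨congrArg _ this.1, this.2⟩)

theorem IsMetricOn.laplacian_contract (hG : IsMetricOn G U) (hp : p ∈ U)
    (σ : Fin m × Fin 2 ≃ Fin k) {T : Model n → (Fin k → Fin n) → ℝ}
    (hT : ∀ a, ContDiffOn ℝ ∞ (fun p => T p a) U) :
    laplacian (stdFrame n) G (contract σ (fun _ => T) G) p
      = contract (pairFirst σ) (fun _ => covDeriv (stdFrame n) G (covDeriv (stdFrame n) G T)) G p := by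
  set D := covDeriv (stdFrame n) G T with hD
  have hDs := hG.contDiffOn_covDeriv (e := stdFrame n) hT
  have h1 : ∀ q ∈ U, ∀ b, pd (stdFrame n) b (contract σ (fun _ => T) G) q
      = contract σ (fun _ q a => D q (Fin.cons b a)) G q := by
    intro q hq b
    rw [hG.pd_contract hq σ hT]
    unfold contract
    simp_rw [hD, covDeriv_cons]
  -- The Hessian correction with Γ^c_{ab} is the correction term of the slot holding the first
  -- derivative index b, so both together form the second covariant derivative.
  have h2 : ∀ a b, pd (stdFrame n) a (pd (stdFrame n) b (contract σ (fun _ => T) G)) p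
      - ∑ c, christoffel (stdFrame n) G p c a b * pd (stdFrame n) c (contract σ (fun _ => T) G) p
      = contract σ (fun _ q x => covDeriv (stdFrame n) G D q (Fin.cons a (Fin.cons b x))) G p := by
    intro a b
    rw [pd_congr hG.isOpen (fun q hq => h1 q hq b) hp a,
      hG.pd_contract hp σ (T := fun q a => D q (Fin.cons b a)) (fun a => hDs _)]
    simp_rw [h1 p hp]
    unfold contract
    simp_rw [Finset.mul_sum]
    rw [Finset.sum_comm, ← Finset.sum_sub_distrib]
    refine Finset.sum_congr rfl fun x _ => ?_
    have e1 : ∀ c, Function.update (Fin.cons b x : Fin (k + 1) → Fin n) 0 c = Fin.cons c x :=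
      fun c => Fin.update_cons_zero _ _ _
    have e2 : ∀ (j : Fin k) c, Function.update (Fin.cons b x : Fin (k + 1) → Fin n) j.succ c
        = Fin.cons b (Function.update x j c) := fun j c => (Fin.cons_update _ _ _ _).symm
    rw [covDeriv_cons, Fin.sum_univ_succ]
    simp_rw [e1, e2, Fin.cons_zero, Fin.cons_succ, mul_left_comm (christoffel _ _ _ _ _ _) (Finset.prod _ _),
      ← Finset.mul_sum]
    ring
  unfold laplacian
  simp_rw [h2]
  unfold contract
  rw [← (Fin.consEquiv fun _ => Fin n).sum_comp, Fintype.sum_prod_type]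
  refine Finset.sum_congr rfl fun a _ => ?_
  rw [← (Fin.consEquiv fun _ => Fin n).sum_comp, Fintype.sum_prod_type]
  refine Finset.sum_congr rfl fun b _ => ?_
  rw [Finset.mul_sum]
  refine Finset.sum_congr rfl fun x _ => ?_
  rw [Fin.prod_univ_succ]
  simp only [pairFirst, Equiv.ofBijective_apply, Fin.cases_zero, Fin.cases_succ, Fin.consEquiv,
    Equiv.coe_fn_mk]
  have c0 : (Fin.castLE (by omega) (0 : Fin 2) : Fin (k + 2)) = 0 := rfl
  have c1 : (Fin.castLE (by omega) (1 : Fin 2) : Fin (k + 2)) = Fin.succ 0 := rfl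
  rw [c0, c1]
  simp only [Fin.cons_zero, Fin.cons_succ]
  ring

theorem covDeriv_congr {S T : Model n → (Fin k → Fin n) → ℝ} (hU : IsOpen U)
    (h : ∀ q ∈ U, ∀ a, S q a = T q a) (hp : p ∈ U) (a : Fin (k + 1) → Fin n) :
    covDeriv (stdFrame n) G S p a = covDeriv (stdFrame n) G T p a := by
  unfold covDeriv
  rw [pd_congr hU (fun q hq => h q hq _) hp]
  simp_rw [h p hp]

theorem CurvScalar.exists_laplacian {f : (Model n → Matrix (Fin n) (Fin n) ℝ) → Model n → ℝ}
    (hf : f ∈ CurvScalar n) : ∃ g ∈ CurvScalar n,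
      ∀ (G : Model n → Matrix (Fin n) (Fin n) ℝ) (U : Set (Model n)),
      IsMetricOn G U → ∀ p ∈ U, laplacian (stdFrame n) G (f G) p = g G p := by
  unfold CurvScalar at hf
  induction hf using Submodule.span_induction with
  | zero =>
    refine ⟨0, Submodule.zero_mem _, fun G U hG p hp => ?_⟩
    have := hG.laplacian_const_mul (e := stdFrame n) (f := fun _ => 0) contDiffOn_const 0 hp
    simp only [zero_mul] at this
    exact this
  | add Y Z hY hZ h1 h2 =>
    obtain ⟨Y', hY', h1⟩ := h1
    obtain ⟨Z', hZ', h2⟩ := h2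
    refine ⟨Y' + Z', Submodule.add_mem _ hY' hZ', fun G U hG p hp => ?_⟩
    simp only [Pi.add_apply]
    rw [← h1 G U hG p hp, ← h2 G U hG p hp]
    exact hG.laplacian_add (CurvScalar.contDiffOn hY hG) (CurvScalar.contDiffOn hZ hG) hp
  | smul c Y hY h1 =>
    obtain ⟨Y', hY', h1⟩ := h1
    refine ⟨c • Y', Submodule.smul_mem _ c hY', fun G U hG p hp => ?_⟩
    simp only [Pi.smul_apply, smul_eq_mul]
    rw [← h1 G U hG p hp]
    exact hG.laplacian_const_mul (CurvScalar.contDiffOn hY hG) c hp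
  | mem f hf =>
    obtain ⟨k, m, σ, X, hX, rfl⟩ := hf
    obtain ⟨Y, hY, h1⟩ := hX.exists_covDeriv
    obtain ⟨Z, hZ, h2⟩ := CurvPoly.exists_covDeriv hY
    refine ⟨_, CurvPoly.contract_mem (pairFirst σ) hZ, fun G U hG p hp => ?_⟩
    refine (hG.laplacian_contract hp σ (hX.contDiffOn hG)).trans ?_
    unfold contract
    refine Finset.sum_congr rfl fun a _ => congrArg _ ?_
    rw [← h2 G U hG p hp]
    exact covDeriv_congr hG.isOpen (fun q hq a => h1 G U hG q hq a) hp a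

end Laplacian

/-! ### From curvature scalars to formal scalar invariants, and the basic examples. -/

section Representation

variable {n : ℕ}

theorem CurvMonomial.exists_sigma {k : ℕ} {X : NatTensor n k} (hX : CurvMonomial n k X) :
    ∃ (J : Type) (_ : Fintype J) (N : J → ℕ) (e : ((i : J) × Fin (4 + N i)) ≃ Fin k),
      ∀ G p a, X G p a = ∏ i, iterCovRiem (stdFrame n) G (N i) p (fun s => a (e ⟨i, s⟩)) := by
  induction hX with
  | one =>
    exact ⟨Empty, inferInstance, Empty.elim, Equiv.equivOfIsEmpty _ _, fun G p a => by simp⟩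
  | riem N =>
    refine ⟨Unit, inferInstance, fun _ => N, Equiv.uniqueSigma (fun _ : Unit => Fin (4 + N)),
      fun G p a => by simp; rfl⟩
  | @mul k l X Y _ _ h1 h2 =>
    obtain ⟨J, _, N, e, h1⟩ := h1
    obtain ⟨J', _, N', e', h2⟩ := h2
    refine ⟨J ⊕ J', inferInstance, Sum.elim N N',
      ((Equiv.sumSigmaDistrib _).trans (e.sumCongr e')).trans finSumFinEquiv, fun G p a => ?_⟩
    rw [Fintype.prod_sum_type]
    simp only [NatTensor.mul, h1, h2]
    rfl
  | @reindex k l X σ hσ _ h1 =>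
    obtain ⟨J, _, N, e, h1⟩ := h1
    exact ⟨J, inferInstance, N, e.trans (Equiv.ofBijective σ hσ), fun G p a => by
      simp only [NatTensor.reindex, h1]; rfl⟩

theorem CurvMonomial.exists_completeContraction {k m : ℕ} (σ : Fin m × Fin 2 ≃ Fin k)
    {X : NatTensor n k} (hX : CurvMonomial n k X) :
    ∃ C : CompleteContraction, ∀ G p, C.evalCoord (stdFrame n) G p = contract σ X G p := by
  obtain ⟨J, _, N, e, h⟩ := hX.exists_sigma
  let ε := Fintype.equivFin J
  let e' : ((i : Fin (Fintype.card J)) × Fin (4 + N (ε.symm i))) ≃ Fin k :=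
    (Equiv.sigmaCongrLeft (β := fun i => Fin (4 + N i)) ε.symm).trans e
  let s : (((i : Fin (Fintype.card J)) × Fin (4 + N (ε.symm i))) ⊕ (Fin 0 × Fin 2)) ≃ Fin k :=
    (Equiv.sumEmpty _ _).trans e'
  -- No explicit factor of the metric is needed, hence l = 0.
  refine ⟨⟨Fintype.card J, fun i => N (ε.symm i), 0, m, σ.trans s.symm⟩, fun G p => ?_⟩
  unfold CompleteContraction.evalCoord contract
  refine Fintype.sum_equiv (s.arrowCongr (Equiv.refl (Fin n))) _ _ fun a => ?_
  rw [h, ← ε.symm.prod_comp]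
  simp only [Finset.univ_eq_empty, Finset.prod_empty, mul_one]
  have hs : ∀ i, (s.arrowCongr (Equiv.refl (Fin n))) a i = a (s.symm i) := fun _ => rfl
  simp_rw [hs]
  congr 1
  refine Finset.prod_congr rfl fun i _ => ?_
  congr 1
  funext t
  congr 1
  rw [Equiv.eq_symm_apply]
  rfl

theorem CurvScalar.exists_invariant {f : (Model n → Matrix (Fin n) (Fin n) ℝ) → Model n → ℝ}
    (hf : f ∈ CurvScalar n) : ∃ I : ScalarRiemannianInvariant,
      ∀ G p, I.evalCoord (stdFrame n) G p = f G p := by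
  unfold CurvScalar at hf
  induction hf using Submodule.span_induction with
  | zero => exact ⟨0, fun G p => by simp [ScalarRiemannianInvariant.evalCoord]⟩
  | add Y Z _ _ h1 h2 =>
    obtain ⟨I, h1⟩ := h1
    obtain ⟨J, h2⟩ := h2
    refine ⟨I + J, fun G p => ?_⟩
    rw [Pi.add_apply, Pi.add_apply, ← h1, ← h2]
    exact Finsupp.sum_add_index' (by simp) (by intros; ring)
  | smul c Y _ h1 =>
    obtain ⟨I, h1⟩ := h1
    refine ⟨c • I, fun G p => ?_⟩
    rw [Pi.smul_apply, Pi.smul_apply, ← h1]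
    unfold ScalarRiemannianInvariant.evalCoord
    rw [Finsupp.sum_smul_index' (by simp), Finsupp.smul_sum]
    simp [mul_assoc]
  | mem f hf =>
    obtain ⟨k, m, σ, X, hX, rfl⟩ := hf
    obtain ⟨C, hC⟩ := hX.exists_completeContraction σ
    exact ⟨Finsupp.single C 1, fun G p => by
      simp [ScalarRiemannianInvariant.evalCoord, hC]⟩

/-- The scalar curvature is the invariant through which the Einstein constant becomes a curvature
invariant. -/
theorem exists_mem_scalar (n : ℕ) : ∃ f ∈ CurvScalar n,
    ∀ (G : Model n → Matrix (Fin n) (Fin n) ℝ) (U : Set (Model n)), IsMetricOn G U → ∀ p ∈ U,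
      scalar (stdFrame n) G p = f G p := by
  -- The transposition makes the pairing join slots 0 and 2, and slots 1 and 3, as the convention
  -- R_{ab} = R_{acb}^c demands.
  let σ : Fin 2 × Fin 2 ≃ Fin (4 + 0) := (Equiv.prodComm _ _).trans finProdFinEquiv
  refine ⟨_, CurvPoly.contract_mem σ (CurvMonomial.riem 0).mem, fun G U hG p hp => ?_⟩
  have h4 : ∀ F : (Fin (4 + 0) → Fin n) → ℝ, ∑ b, F b = ∑ x, ∑ y, ∑ z, ∑ w, F ![x, y, z, w] := by
    intro F
    rw [← (Fin.consEquiv fun _ => Fin n).sum_comp, Fintype.sum_prod_type]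
    refine Finset.sum_congr rfl fun x _ => ?_
    rw [sum_vec_three]
    rfl
  unfold contract
  rw [h4]
  have e : ∀ x y z w, (∏ q, inv G p (![x, y, z, w] (σ (q, 0))) (![x, y, z, w] (σ (q, 1))))
      * iterCovRiem (stdFrame n) G 0 p ![x, y, z, w]
      = inv G p x z * inv G p y w * riem (stdFrame n) G p x y z w := by
    intro x y z w
    rw [Fin.prod_univ_two]
    rfl
  refine Eq.trans ?_ (Finset.sum_congr rfl fun x _ => Finset.sum_congr rfl fun y _ =>
    Finset.sum_congr rfl fun z _ => Finset.sum_congr rfl fun w _ => (e x y z w).symm)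
  unfold scalar
  refine Finset.sum_congr rfl fun x _ => ?_
  rw [Finset.sum_comm]
  refine Finset.sum_congr rfl fun z _ => ?_
  unfold ricci
  rw [Finset.mul_sum]
  refine Finset.sum_congr rfl fun y _ => ?_
  rw [← hG.sum_riem_mul_inv hp, Finset.mul_sum]
  exact Finset.sum_congr rfl fun w _ => by ring

theorem curvMonomial_prod_riem (n j : ℕ) : ∃ (k : ℕ) (e : Fin j × Fin 4 ≃ Fin k),
    CurvMonomial n k (fun G p a => ∏ i, riem (stdFrame n) G p
      (a (e (i, 0))) (a (e (i, 1))) (a (e (i, 2))) (a (e (i, 3)))) := by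
  induction j with
  | zero =>
    refine ⟨0, Equiv.equivOfIsEmpty _ _, ?_⟩
    simpa using CurvMonomial.one
  | succ j ih =>
    obtain ⟨k, e, h⟩ := ih
    refine ⟨4 + 0 + k, ((finSumFinEquiv.symm.prodCongr (Equiv.refl (Fin 4))).trans
      ((Equiv.sumProdDistrib (Fin j) (Fin 1) (Fin 4)).trans ((Equiv.sumComm _ _).trans
        ((Equiv.uniqueProd (Fin 4) (Fin 1)).sumCongr e)))).trans finSumFinEquiv, ?_⟩
    convert (CurvMonomial.riem 0).mul h using 1
    funext G p a
    rw [Fin.prod_univ_castSucc, mul_comm]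
    have h1 : ∀ i : Fin j, finSumFinEquiv.symm (Fin.castSucc i) = Sum.inl i := fun i =>
      finSumFinEquiv_symm_apply_castAdd (n := 1) i
    have h2 : finSumFinEquiv.symm (Fin.last j) = Sum.inr (0 : Fin 1) :=
      finSumFinEquiv_symm_apply_natAdd (m := j) (0 : Fin 1)
    simp [h1, h2, NatTensor.mul]
    left
    rfl

/-- The generalized delta is a signed sum over permutations, and each permutation π identifies the
upper indices with the lower ones. What is left for each π is one complete contraction of a tensor
power of the curvature. -/
theorem pf_riem_mem (n j : ℕ) :
    (fun G => pf G j (riem (stdFrame n) G)) ∈ CurvScalar n := by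
  obtain ⟨k, e, hX⟩ := curvMonomial_prod_riem n j
  have key : (fun G => pf G j (riem (stdFrame n) G))
      = ∑ π : Equiv.Perm (Fin j × Fin 2),
        ((1 / 2 : ℝ) ^ j * ((2 * j - 1)‼ : ℝ) * (((Equiv.Perm.sign π : ℤ) : ℝ)
          / ((Fintype.card (Fin j × Fin 2))! : ℝ))) •
        (fun (G : Model n → Matrix (Fin n) (Fin n) ℝ) p =>
          ∑ x : (Fin j × Fin 2) × Fin 2 → Fin n,
          (∏ s, inv G p (x (π.symm s, 0)) (x (s, 1)))
            * ∏ i, riem (stdFrame n) G p (x ((i, 0), 0)) (x ((i, 1), 0)) (x ((i, 0), 1))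
              (x ((i, 1), 1))) := by
    funext G p
    simp only [Finset.sum_apply, Pi.smul_apply, smul_eq_mul, pf, genDelta]
    simp_rw [mul_assoc, ← Finset.mul_sum]
    congr 2
    simp_rw [Finset.sum_div, Finset.sum_mul]
    have s : ∀ (A : (Fin j × Fin 2 → Fin n) → (Fin j × Fin 2 → Fin n)
        → Equiv.Perm (Fin j × Fin 2) → ℝ),
        ∑ a, ∑ b, ∑ π, A a b π = ∑ π, ∑ a, ∑ b, A a b π := by
      intro A
      rw [Finset.sum_comm]
      simp_rw [Finset.sum_comm (t := Finset.univ (α := Equiv.Perm (Fin j × Fin 2)))]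
      exact Finset.sum_congr rfl fun _ _ => Finset.sum_comm
    rw [s]
    refine Finset.sum_congr rfl fun π _ => ?_
    rw [sum_pairs (fun a c : Fin j × Fin 2 → Fin n => (∏ s, inv G p (a (π.symm s)) (c s))
      * ∏ i, riem (stdFrame n) G p (a (i, 0)) (a (i, 1)) (c (i, 0)) (c (i, 1))), Finset.mul_sum]
    refine Finset.sum_congr rfl fun a _ => ?_
    -- For a fixed π the delta leaves only the upper family b = a ∘ π⁻¹.
    rw [Finset.sum_eq_single (fun s => a (π.symm s))]
    · simp only [Equiv.symm_apply_apply, if_true, Finset.prod_const_one, mul_one]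
      congr 1
      unfold raiseLast
      rw [prod_sum_pairs]
      refine Finset.sum_congr rfl fun c _ => ?_
      rw [Fintype.prod_prod_type, ← Finset.prod_mul_distrib]
      refine Finset.prod_congr rfl fun i _ => ?_
      rw [Fin.prod_univ_two]
    · intro b _ hb
      have : ∃ s, a s ≠ b (π s) := by
        by_contra hcon
        push Not at hcon
        exact hb (funext fun s => by rw [hcon, Equiv.apply_symm_apply])
      obtain ⟨s, hs⟩ := this
      rw [Finset.prod_eq_zero (Finset.mem_univ s) (if_neg hs)]
      ring
    · simp
  rw [key]
  refine Submodule.sum_mem _ fun π _ => Submodule.smul_mem _ _ ?_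
  let σ : (Fin j × Fin 2) × Fin 2 ≃ (Fin j × Fin 2) × Fin 2 :=
    { toFun := fun x => if x.2 = 0 then (π.symm x.1, 0) else (x.1, 1)
      invFun := fun x => if x.2 = 0 then (π x.1, 0) else (x.1, 1)
      left_inv := fun ⟨s, i⟩ => by fin_cases i <;> simp
      right_inv := fun ⟨s, i⟩ => by fin_cases i <;> simp }
  -- The four slots of the i-th curvature factor become its lower pair followed by its upper pair:
  -- the last label tells lower (0) from upper (1).
  let ε : Fin j × Fin 4 ≃ (Fin j × Fin 2) × Fin 2 :=
    (((Equiv.refl (Fin j)).prodCongr ((finProdFinEquiv (m := 2) (n := 2)).symm.trans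
      (Equiv.prodComm _ _))).trans (Equiv.prodAssoc _ _ _).symm)
  have := hX.contract_mem (Q := Fin j × Fin 2) σ (e.symm.trans ε)
  convert this using 5 with G p x
  · rfl
  · have hε : ∀ z, (e.symm.trans ε) (e z) = ε z := fun z => by simp
    simp_rw [hε]
    rfl

end Representation


/-! ### Traces of the generalized Kronecker delta. -/

section KroneckerDelta

variable {ι S S' : Type} [Fintype ι] [DecidableEq ι] [Fintype S] [DecidableEq S] [Fintype S']
  [DecidableEq S']

/-- The generalized Kronecker delta, without a normalizing factor. -/
noncomputable def kdelta (a b : S → ι) : ℝ :=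
  ∑ σ : Equiv.Perm S, ((Equiv.Perm.sign σ : ℤ) : ℝ) * ∏ s, if a s = b (σ s) then 1 else 0

omit [Fintype ι] in
theorem genDelta_eq (a b : S → ι) : genDelta a b = kdelta a b / ((Fintype.card S)! : ℝ) := rfl

omit [Fintype ι] in
theorem kdelta_comp_equiv (e : S ≃ S') (a b : S' → ι) :
    kdelta (fun s => a (e s)) (fun s => b (e s)) = kdelta a b := by
  unfold kdelta
  refine Fintype.sum_equiv e.permCongr _ _ fun σ => ?_
  rw [Equiv.Perm.sign_permCongr, ← e.prod_comp]
  simp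

omit [Fintype ι] in
theorem kdelta_comp_perm (π : Equiv.Perm S) (a b : S → ι) :
    kdelta a (fun s => b (π s)) = ((Equiv.Perm.sign π : ℤ) : ℝ) * kdelta a b := by
  unfold kdelta
  rw [Finset.mul_sum]
  refine Fintype.sum_equiv (Equiv.mulLeft π) _ _ fun σ => ?_
  have h : (((Equiv.Perm.sign π : ℤ) : ℝ)) * ((Equiv.Perm.sign π : ℤ) : ℝ) = 1 := by
    norm_cast; simp
  simp only [Equiv.coe_mulLeft, Equiv.Perm.sign_mul, Units.val_mul, Int.cast_mul,
    Equiv.Perm.coe_mul, Function.comp_apply]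
  rw [← mul_assoc, ← mul_assoc, h, one_mul]
  rfl

/-- Extension of an index family by one slot. -/
def extend (x : ι) (a : S → ι) : Option S → ι := fun o => o.elim x a

omit [DecidableEq ι] [DecidableEq S] in
theorem sum_extend [DecidableEq S] (F : (Option S → ι) → ℝ) :
    ∑ a, F a = ∑ x, ∑ a : S → ι, F (extend x a) := by
  rw [← Fintype.sum_prod_type']
  refine Fintype.sum_equiv (Equiv.piOptionEquivProd (β := fun _ => ι)) _ _ fun a => ?_
  congr 1
  funext o
  cases o <;> rfl

/-- Permutations of the enlarged slot set are sorted by the image of the new slot. Those fixing it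
contribute the dimension times the smaller delta; for each old slot i, those sending the new slot to
i contribute minus the smaller delta, because a transposition has been inserted. -/
theorem sum_kdelta_extend (a b : S → ι) :
    ∑ x, kdelta (extend x a) (extend x b)
      = ((Fintype.card ι : ℝ) - Fintype.card S) * kdelta a b := by
  unfold kdelta
  rw [Finset.sum_comm]
  rw [← Equiv.sum_comp Equiv.Perm.decomposeOption.symm, Fintype.sum_prod_type, Fintype.sum_option]
  have h0 : ∑ σ : Equiv.Perm S, ∑ x : ι,
      ((Equiv.Perm.sign (Equiv.Perm.decomposeOption.symm (none, σ)) : ℤ) : ℝ)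
        * ∏ s, (if extend x a s = extend x b (Equiv.Perm.decomposeOption.symm (none, σ) s)
            then (1 : ℝ) else 0)
      = (Fintype.card ι : ℝ) * ∑ σ : Equiv.Perm S, ((Equiv.Perm.sign σ : ℤ) : ℝ)
        * ∏ s, if a s = b (σ s) then 1 else 0 := by
    rw [Finset.mul_sum]
    refine Finset.sum_congr rfl fun σ _ => ?_
    simp only [Fintype.prod_option, extend]
    simp
  have h1 : ∀ i : S, ∑ σ : Equiv.Perm S, ∑ x : ι,
      ((Equiv.Perm.sign (Equiv.Perm.decomposeOption.symm (some i, σ)) : ℤ) : ℝ)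
        * ∏ s, (if extend x a s = extend x b (Equiv.Perm.decomposeOption.symm (some i, σ) s)
            then (1 : ℝ) else 0)
      = -∑ σ : Equiv.Perm S, ((Equiv.Perm.sign σ : ℤ) : ℝ)
        * ∏ s, if a s = b (σ s) then 1 else 0 := by
    intro i
    rw [← Finset.sum_neg_distrib]
    refine Finset.sum_congr rfl fun σ _ => ?_
    have hs : ((Equiv.Perm.sign (Equiv.Perm.decomposeOption.symm (some i, σ)) : ℤ) : ℝ)
        = -((Equiv.Perm.sign σ : ℤ) : ℝ) := by
      simp
    rw [hs, ← Finset.mul_sum, neg_mul]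
    congr 2
    simp only [Fintype.prod_option]
    -- `t` is the slot whose partner is the new slot. Summing over x forces x = b i = b (σ t), which
    -- restores the condition that σ imposes on t.
    set t := σ.symm i with ht
    have hnone : Equiv.Perm.decomposeOption.symm (some i, σ) none = some i := by simp
    have hsome : ∀ s, Equiv.Perm.decomposeOption.symm (some i, σ) (some s)
        = if s = t then none else some (σ s) := by
      intro s
      simp only [Equiv.Perm.decomposeOption_symm_apply, Equiv.Perm.coe_mul, Function.comp_apply,
        Equiv.optionCongr_apply, Option.map_some]
      by_cases h : s = t
      · rw [if_pos h, h, ht, Equiv.apply_symm_apply, Equiv.swap_apply_right]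
      · rw [if_neg h, Equiv.swap_apply_of_ne_of_ne (by simp)]
        intro h'
        exact h (by rw [ht, Equiv.eq_symm_apply]; exact Option.some_injective _ h')
    rw [hnone]
    simp_rw [hsome]
    have hx : ∀ x : ι, ∏ s, (if extend x a (some s)
          = extend x b (if s = t then none else some (σ s)) then (1 : ℝ) else 0)
        = (if a t = x then 1 else 0) * ∏ s ∈ Finset.univ.erase t, if a s = b (σ s) then 1 else 0 := by
      intro x
      rw [← Finset.mul_prod_erase _ _ (Finset.mem_univ t)]
      congr 1
      · simp [extend]
      · exact Finset.prod_congr rfl fun s hs => by simp [extend, Finset.ne_of_mem_erase hs]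
    simp_rw [hx]
    have hy : ∀ x : ι, (if extend x a none = extend x b (some i) then (1 : ℝ) else 0)
        = if x = b i then 1 else 0 := fun x => rfl
    simp_rw [hy]
    rw [Finset.sum_eq_single (b i)]
    · rw [if_pos rfl, one_mul, ← Finset.mul_prod_erase _ _ (Finset.mem_univ t)]
      simp [ht]
    · intro x _ hne; simp [hne]
    · simp
  rw [h0, Finset.sum_congr rfl fun i _ => h1 i]
  simp
  ring

end KroneckerDelta

/-! ### Expanding a full contraction after adding a multiple of the identity on two-forms. -/

section FullContraction

variable {ι I I' : Type} [Fintype ι] [DecidableEq ι] [Fintype I] [DecidableEq I] [Fintype I']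
  [DecidableEq I']

/-- The contraction of a family of tensors `T_{ab}{}^{cd}` with the generalized Kronecker delta. -/
noncomputable def deltaContract (T : I → ι → ι → ι → ι → ℝ) : ℝ :=
  ∑ a : I × Fin 2 → ι, ∑ b : I × Fin 2 → ι,
    kdelta a b * ∏ i, T i (a (i, 0)) (a (i, 1)) (b (i, 0)) (b (i, 1))

theorem deltaContract_comp_equiv (e : I ≃ I') (T : I' → ι → ι → ι → ι → ℝ) :
    deltaContract (fun i => T (e i)) = deltaContract T := by
  unfold deltaContract
  let ε : I × Fin 2 ≃ I' × Fin 2 := e.prodCongr (Equiv.refl _)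
  refine Fintype.sum_equiv (ε.arrowCongr (Equiv.refl ι)) _ _ fun a => ?_
  refine Fintype.sum_equiv (ε.arrowCongr (Equiv.refl ι)) _ _ fun b => ?_
  have hε : ∀ c : I × Fin 2 → ι, (fun s => (ε.arrowCongr (Equiv.refl ι)) c (ε s)) = c := by
    intro c; funext s; simp
  rw [← kdelta_comp_equiv ε, hε, hε, ← e.prod_comp]
  simp [ε]

/-- The tensor `δ_a^c δ_b^d - δ_a^d δ_b^c`. -/
def deltaTensor (a b c d : ι) : ℝ :=
  (if a = c then 1 else 0) * (if b = d then 1 else 0)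
    - (if a = d then 1 else 0) * (if b = c then 1 else 0)

/-- The two terms of the identity tensor contribute equally by antisymmetry of the delta, hence the
factor 2. Then two index pairs are traced in turn, in the presence of 2|I|+1 and of 2|I| other
slots. -/
theorem deltaContract_option (T : I → ι → ι → ι → ι → ℝ) :
    deltaContract (fun o : Option I => o.elim deltaTensor T)
      = 2 * ((Fintype.card ι : ℝ) - 2 * Fintype.card I)
          * ((Fintype.card ι : ℝ) - 2 * Fintype.card I - 1) * deltaContract T := by
  unfold deltaContract
  -- The two slots of the extra factor are placed in the two outer layers, so that
  -- `sum_kdelta_extend` can be applied once for each.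
  let ε : Option (Option (I × Fin 2)) ≃ Option I × Fin 2 :=
    { toFun := fun o => o.elim (none, 0) fun o => o.elim (none, 1) fun x => (some x.1, x.2)
      invFun := fun y => y.1.elim (if y.2 = 0 then none else some none) fun i => some (some (i, y.2))
      left_inv := by rintro (_ | _ | ⟨i, j⟩) <;> simp
      right_inv := by
        rintro ⟨_ | i, j⟩
        · fin_cases j <;> simp
        · simp }
  have hsum : ∀ F : (Option I × Fin 2 → ι) → ℝ, ∑ a, F a
      = ∑ x, ∑ y, ∑ a : I × Fin 2 → ι, F (fun s => extend x (extend y a) (ε.symm s)) := by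
    intro F
    rw [← (ε.arrowCongr (Equiv.refl ι)).sum_comp, sum_extend]
    refine Finset.sum_congr rfl fun x _ => ?_
    rw [sum_extend]
    rfl
  simp_rw [hsum]
  have hk : ∀ (x y z w : ι) (a b : I × Fin 2 → ι),
      kdelta (fun s => extend x (extend y a) (ε.symm s)) (fun s => extend z (extend w b) (ε.symm s))
        = kdelta (extend x (extend y a)) (extend z (extend w b)) := fun x y z w a b =>
    kdelta_comp_equiv ε.symm _ _
  have hp : ∀ (x y z w : ι) (a b : I × Fin 2 → ι),
      ∏ o : Option I, (o.elim deltaTensor T : ι → ι → ι → ι → ℝ)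
        (extend x (extend y a) (ε.symm (o, 0))) (extend x (extend y a) (ε.symm (o, 1)))
        (extend z (extend w b) (ε.symm (o, 0))) (extend z (extend w b) (ε.symm (o, 1)))
      = deltaTensor x y z w * ∏ i, T i (a (i, 0)) (a (i, 1)) (b (i, 0)) (b (i, 1)) := by
    intro x y z w a b
    rw [Fintype.prod_option]
    rfl
  simp_rw [hk, hp]
  have hswap : ∀ (x y z w : ι) (a b : I × Fin 2 → ι),
      kdelta (extend x (extend y a)) (extend w (extend z b))
        = -kdelta (extend x (extend y a)) (extend z (extend w b)) := by
    intro x y z w a b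
    have := kdelta_comp_perm (Equiv.swap (none : Option (Option (I × Fin 2))) (some none))
      (extend x (extend y a)) (extend z (extend w b))
    rw [Equiv.Perm.sign_swap (by simp)] at this
    simp only [Units.val_neg, Units.val_one, Int.cast_neg, Int.cast_one, neg_mul, one_mul] at this
    rw [← this]
    congr 1
    funext o
    rcases o with _ | _ | s
    · simp [extend]
    · simp [extend]
    · rw [Equiv.swap_apply_of_ne_of_ne (by simp) (by simp)]; rfl
  have hc : ∀ a b : I × Fin 2 → ι,
      ∑ x, ∑ y, ∑ z, ∑ w, kdelta (extend x (extend y a)) (extend z (extend w b))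
        * deltaTensor x y z w
      = 2 * ((Fintype.card ι : ℝ) - 2 * Fintype.card I)
          * ((Fintype.card ι : ℝ) - 2 * Fintype.card I - 1) * kdelta a b := by
    intro a b
    have h1 : ∀ x y, ∑ z, ∑ w, kdelta (extend x (extend y a)) (extend z (extend w b))
        * deltaTensor x y z w = 2 * kdelta (extend x (extend y a)) (extend x (extend y b)) := by
      intro x y
      simp only [deltaTensor, mul_sub, Finset.sum_sub_distrib]
      have e1 : ∑ z, ∑ w, kdelta (extend x (extend y a)) (extend z (extend w b))
          * ((if x = z then 1 else 0) * (if y = w then 1 else 0))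
          = kdelta (extend x (extend y a)) (extend x (extend y b)) := by
        simp
      have e2 : ∑ z, ∑ w, kdelta (extend x (extend y a)) (extend z (extend w b))
          * ((if x = w then 1 else 0) * (if y = z then 1 else 0))
          = kdelta (extend x (extend y a)) (extend y (extend x b)) := by
        simp
      rw [e1, e2, hswap]
      ring
    simp_rw [h1, ← Finset.mul_sum]
    rw [Finset.sum_comm]
    simp_rw [sum_kdelta_extend]
    rw [← Finset.mul_sum, sum_kdelta_extend]
    simp
    ring
  calc _ = ∑ a : I × Fin 2 → ι, ∑ b : I × Fin 2 → ι,
        (∑ x, ∑ y, ∑ z, ∑ w, kdelta (extend x (extend y a)) (extend z (extend w b))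
          * deltaTensor x y z w) * ∏ i, T i (a (i, 0)) (a (i, 1)) (b (i, 0)) (b (i, 1)) := by
        simp_rw [Finset.sum_mul]
        have r1 : ∀ F : ι → ι → (I × Fin 2 → ι) → ι → ι → (I × Fin 2 → ι) → ℝ,
            ∑ x, ∑ y, ∑ a, ∑ z, ∑ w, ∑ b, F x y a z w b
              = ∑ a, ∑ b, ∑ x, ∑ y, ∑ z, ∑ w, F x y a z w b := by
          intro F
          have s1 : ∀ H : ι → ι → (I × Fin 2 → ι) → ℝ,
              ∑ x, ∑ y, ∑ a, H x y a = ∑ a, ∑ x, ∑ y, H x y a := by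
            intro H
            rw [Finset.sum_comm' (s := Finset.univ (α := I × Fin 2 → ι)) (t' := Finset.univ)
              (s' := fun _ => Finset.univ) (t := fun _ => Finset.univ) (by simp)]
            exact Finset.sum_congr rfl fun x _ => Finset.sum_comm
          rw [s1]
          refine Finset.sum_congr rfl fun a _ => ?_
          rw [← s1]
          exact Finset.sum_congr rfl fun x _ => Finset.sum_congr rfl fun y _ => s1 _
        rw [r1]
        refine Finset.sum_congr rfl fun a _ => Finset.sum_congr rfl fun b _ =>
          Finset.sum_congr rfl fun x _ => Finset.sum_congr rfl fun y _ =>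
          Finset.sum_congr rfl fun z _ => Finset.sum_congr rfl fun w _ => by ring
    _ = _ := by
        simp_rw [hc, mul_assoc, ← Finset.mul_sum]

/-- The factor produced by contracting `k` factors `deltaTensor` in the presence of `j` others. -/
noncomputable def contractionFactor (N : ℝ) (j k : ℕ) : ℝ :=
  ∏ i ∈ Finset.range k, 2 * (N - 2 * (j + i : ℕ)) * (N - 2 * (j + i : ℕ) - 1)

theorem deltaContract_sum (W : ι → ι → ι → ι → ℝ) (j k : ℕ) :
    deltaContract (Sum.elim (fun _ : Fin j => W) (fun _ : Fin k => deltaTensor))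
      = contractionFactor (Fintype.card ι) j k * deltaContract (fun _ : Fin j => W) := by
  induction k with
  | zero =>
    rw [← deltaContract_comp_equiv (Equiv.sumEmpty (Fin j) (Fin 0)).symm]
    simp [contractionFactor]
  | succ k ih =>
    let e : Option (Fin j ⊕ Fin k) ≃ Fin j ⊕ Fin (k + 1) :=
      (Equiv.optionEquivSumPUnit.{0} (Fin j ⊕ Fin k)).trans ((Equiv.sumAssoc _ _ _).trans
        ((Equiv.refl _).sumCongr
          ((Equiv.optionEquivSumPUnit.{0} (Fin k)).symm.trans (finSuccEquiv k).symm)))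
    have h : (fun o => Sum.elim (fun _ : Fin j => W) (fun _ : Fin (k + 1) => deltaTensor) (e o))
        = fun o : Option (Fin j ⊕ Fin k) => o.elim deltaTensor
          (Sum.elim (fun _ : Fin j => W) (fun _ : Fin k => deltaTensor)) := by
      funext o
      rcases o with _ | _ | _ <;> rfl
    rw [← deltaContract_comp_equiv e, h, deltaContract_option, ih, contractionFactor,
      contractionFactor, Finset.prod_range_succ]
    simp only [Fintype.card_sum, Fintype.card_fin]
    ring

theorem deltaContract_ite (W : ι → ι → ι → ι → ℝ) (s : Finset I) :
    deltaContract (fun i => if i ∈ s then W else deltaTensor)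
      = contractionFactor (Fintype.card ι) s.card (Fintype.card I - s.card)
        * deltaContract (fun _ : Fin s.card => W) := by
  have e1 : {i // i ∈ s} ≃ Fin s.card := s.equivFin
  have e2 : {i // ¬ i ∈ s} ≃ Fin (Fintype.card I - s.card) :=
    Fintype.equivFinOfCardEq (by rw [Fintype.card_subtype_compl]; simp)
  rw [← deltaContract_sum, ← deltaContract_comp_equiv
    ((e1.symm.sumCongr e2.symm).trans (Equiv.sumCompl (· ∈ s)))]
  congr 1
  funext i
  rcases i with i | i
  · simp [(e1.symm i).2]
  · simp [(e2.symm i).2]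

/-- The product is expanded over the subsets of factors that keep W. By symmetry in the factors only
the cardinality of a subset matters, which produces the binomial coefficient. -/
theorem deltaContract_add (W : ι → ι → ι → ι → ℝ) (μ : ℝ) (l : ℕ) :
    deltaContract (fun (_ : Fin l) a b c d => W a b c d + μ * deltaTensor a b c d)
      = ∑ j ∈ Finset.range (l + 1), (l.choose j : ℝ) * (μ ^ (l - j)
        * (contractionFactor (Fintype.card ι) j (l - j) * deltaContract (fun _ : Fin j => W))) := by
  have h1 : deltaContract (fun (_ : Fin l) a b c d => W a b c d + μ * deltaTensor a b c d)
      = ∑ s ∈ (Finset.univ : Finset (Fin l)).powerset, μ ^ (l - s.card)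
        * deltaContract (fun i => if i ∈ s then W else deltaTensor) := by
    unfold deltaContract
    simp_rw [Finset.prod_add, Finset.mul_sum]
    have r : ∀ (F : (Fin l × Fin 2 → ι) → (Fin l × Fin 2 → ι) → Finset (Fin l) → ℝ)
        (P : Finset (Finset (Fin l))),
        ∑ a, ∑ b, ∑ s ∈ P, F a b s = ∑ s ∈ P, ∑ a, ∑ b, F a b s := by
      intro F P
      rw [Finset.sum_comm (s := P)]
      exact Finset.sum_congr rfl fun a _ => Finset.sum_comm
    rw [r]
    refine Finset.sum_congr rfl fun s hs => Finset.sum_congr rfl fun a _ =>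
      Finset.sum_congr rfl fun b _ => ?_
    have hc : ∏ i ∈ Finset.univ \ s, μ * deltaTensor (a (i, 0)) (a (i, 1)) (b (i, 0)) (b (i, 1))
        = μ ^ (l - s.card)
          * ∏ i ∈ Finset.univ \ s, deltaTensor (a (i, 0)) (a (i, 1)) (b (i, 0)) (b (i, 1)) := by
      rw [Finset.prod_mul_distrib, Finset.prod_const, Finset.card_sdiff_of_subset (by simp)]
      simp
    have hi : ∏ i, (if i ∈ s then W else deltaTensor) (a (i, 0)) (a (i, 1)) (b (i, 0)) (b (i, 1))
        = (∏ i ∈ s, W (a (i, 0)) (a (i, 1)) (b (i, 0)) (b (i, 1)))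
          * ∏ i ∈ Finset.univ \ s, deltaTensor (a (i, 0)) (a (i, 1)) (b (i, 0)) (b (i, 1)) := by
      rw [← Finset.prod_sdiff (Finset.subset_univ s), mul_comm]
      congr 1
      · exact Finset.prod_congr rfl fun i hi => by rw [if_pos hi]
      · exact Finset.prod_congr rfl fun i hi => by rw [if_neg (Finset.mem_sdiff.1 hi).2]
    rw [hc, hi]
    ring
  rw [h1]
  simp_rw [deltaContract_ite, Fintype.card_fin]
  rw [Finset.sum_powerset_apply_card (fun j => μ ^ (l - j)
        * (contractionFactor (Fintype.card ι) j (l - j) * deltaContract (fun _ : Fin j => W)))]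
  simp

end FullContraction

/-! ### Normalization of the Pfaffian contractions and the resulting coefficients. -/

section Pfaffian

variable {ι V : Type} [Fintype ι] [DecidableEq ι]

theorem doubleFactorial_mul (l : ℕ) : ((2 * l)! : ℝ) = 2 ^ l * (l ! : ℝ) * ((2 * l - 1)‼ : ℝ) := by
  cases l with
  | zero => simp
  | succ l =>
    rw [show 2 * (l + 1) = (2 * l + 1) + 1 by ring, Nat.factorial_eq_mul_doubleFactorial,
      show 2 * l + 1 + 1 = 2 * (l + 1) by ring, Nat.doubleFactorial_two_mul]
    push_cast
    rfl

/-- The factor 2^{-l}(2l-1)!! and the division by (2l)! inside the delta combine to 1/(4^l l!). With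
this normalization the binomial coefficients of the expansion split into separate factorials. -/
theorem pf_eq_deltaContract (G : V → Matrix ι ι ℝ) (l : ℕ) (T : V → ι → ι → ι → ι → ℝ) (p : V) :
    pf G l T p = deltaContract (fun _ : Fin l => raiseLast G T p) / (4 ^ l * (l ! : ℝ)) := by
  unfold pf deltaContract
  simp_rw [genDelta_eq, div_mul_eq_mul_div, ← Finset.sum_div]
  have hc : Fintype.card (Fin l × Fin 2) = 2 * l := by simp [mul_comm]
  rw [hc, doubleFactorial_mul]
  have h1 : ((2 * l - 1)‼ : ℝ) ≠ 0 := by exact_mod_cast (Nat.doubleFactorial_pos _).ne'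
  have h2 : (l ! : ℝ) ≠ 0 := by exact_mod_cast (Nat.factorial_pos _).ne'
  rw [show (4 : ℝ) = 2 * 2 by norm_num, mul_pow, one_div, inv_pow]
  field_simp

/-- The coefficient of `μ ^ k` in the expansion of `Pf_{j+k}(T + μ δ)`. -/
noncomputable def pfCoeff (N : ℝ) (j k : ℕ) : ℝ := contractionFactor N j k / (4 ^ k * (k ! : ℝ))

theorem pf_add_deltaTensor {G G' : V → Matrix ι ι ℝ} {S T : V → ι → ι → ι → ι → ℝ} {p : V} {μ : ℝ}
    (h : ∀ a b c d, raiseLast G S p a b c d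
      = raiseLast G' T p a b c d + μ * deltaTensor a b c d) (l : ℕ) :
    pf G l S p = ∑ j ∈ Finset.range (l + 1),
      pfCoeff (Fintype.card ι) j (l - j) * μ ^ (l - j) * pf G' j T p := by
  rw [pf_eq_deltaContract]
  have : raiseLast G S p = fun a b c d => raiseLast G' T p a b c d + μ * deltaTensor a b c d := by
    funext a b c d; exact h a b c d
  rw [this, deltaContract_add, Finset.sum_div]
  refine Finset.sum_congr rfl fun j hj => ?_
  rw [pf_eq_deltaContract, pfCoeff]
  have hj' : j ≤ l := Nat.lt_succ_iff.1 (Finset.mem_range.1 hj)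
  rw [Nat.cast_choose ℝ hj']
  have f : ∀ i : ℕ, (i ! : ℝ) ≠ 0 := fun i => by exact_mod_cast (Nat.factorial_pos _).ne'
  have h4 : (4 : ℝ) ^ l = 4 ^ j * 4 ^ (l - j) := by rw [← pow_add]; congr 1; omega
  rw [h4]
  have := f l; have := f j; have := f (l - j)
  field_simp

/-- In dimension 2m, with k = m - j, the successive traces run through all of 2k, 2k-1, ..., 1. The
contraction factor is therefore 2^k (2k)!, and division by 4^k k! leaves an odd double factorial. -/
theorem pfCoeff_middle (m j : ℕ) (hj : j ≤ m) :
    pfCoeff (2 * m : ℕ) j (m - j) = ((2 * (m - j) - 1)‼ : ℝ) := by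
  have key : ∀ k j m : ℕ, m = j + k → contractionFactor (2 * m : ℕ) j k = 2 ^ k * ((2 * k)! : ℝ) := by
    intro k
    induction k with
    | zero => intro j m _; simp [contractionFactor]
    | succ k ih =>
      intro j m hm
      have h1 := ih (j + 1) m (by omega)
      unfold contractionFactor at h1 ⊢
      rw [Finset.prod_range_succ', ← Finset.prod_congr rfl fun i _ => by
        rw [show j + (i + 1) = j + 1 + i by ring], h1, hm,
        show 2 * (k + 1) = (2 * k + 1) + 1 by ring, Nat.factorial_succ, Nat.factorial_succ]
      push_cast
      ring
  unfold pfCoeff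
  rw [key (m - j) j m (by omega), doubleFactorial_mul]
  have h2 : ((m - j)! : ℝ) ≠ 0 := by exact_mod_cast (Nat.factorial_pos _).ne'
  rw [show (4 : ℝ) = 2 * 2 by norm_num, mul_pow]
  field_simp

end Pfaffian


/-! ### Raised tensors and the lowest Pfaffian contractions. -/

section RaiseLast

variable {ι V : Type} [Fintype ι] [DecidableEq ι] [NormedAddCommGroup V] [NormedSpace ℝ V]
  {e : ι → V} {U : Set V} {G : V → Matrix ι ι ℝ} {p : V}

omit [NormedAddCommGroup V] [NormedSpace ℝ V] in
theorem raiseLast_sub_smul (S T R : V → ι → ι → ι → ι → ℝ) (μ : ℝ)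
    (h : ∀ a b c d, S p a b c d = T p a b c d - μ * R p a b c d) (a b c d : ι) :
    raiseLast G S p a b c d = raiseLast G T p a b c d - μ * raiseLast G R p a b c d := by
  unfold raiseLast
  simp_rw [h, mul_sub, Finset.sum_sub_distrib, Finset.mul_sum]
  congr 1
  exact Finset.sum_congr rfl fun _ _ => Finset.sum_congr rfl fun _ _ => by ring

theorem IsMetricOn.raiseLast_deltaTensor (hG : IsMetricOn G U) (hp : p ∈ U) (a b c d : ι) :
    raiseLast G (fun p a b c d => G p a c * G p b d - G p a d * G p b c) p a b c d
      = deltaTensor a b c d := by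
  unfold raiseLast deltaTensor
  have key : ∀ x c, ∑ y, inv G p c y * G p x y = if x = c then 1 else 0 := by
    intro x c
    have := hG.inv_mul hp c x
    simp_rw [eq_comm (a := c)] at this
    rw [← this]
    exact Finset.sum_congr rfl fun y _ => by rw [hG.symm p hp]
  rw [← key a c, ← key b d, ← key a d, ← key b c, Finset.sum_mul_sum, Finset.sum_mul_sum,
    Finset.sum_comm (f := fun i j => inv G p d i * G p a i * (inv G p c j * G p b j)),
    ← Finset.sum_sub_distrib]
  refine Finset.sum_congr rfl fun x _ => ?_
  rw [← Finset.sum_sub_distrib]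
  exact Finset.sum_congr rfl fun y _ => by ring

omit [NormedAddCommGroup V] [NormedSpace ℝ V] in
theorem pf_zero (T : V → ι → ι → ι → ι → ℝ) : pf G 0 T p = 1 := by
  simp [pf, genDelta]

omit [Fintype ι] in
theorem kdelta_eq_det {S : Type} [Fintype S] [DecidableEq S] (a b : S → ι) :
    kdelta a b = (Matrix.of fun x y => if a y = b x then (1 : ℝ) else 0).det := by
  rw [Matrix.det_apply']
  rfl

omit [NormedAddCommGroup V] [NormedSpace ℝ V] in
theorem pf_one (T : V → ι → ι → ι → ι → ℝ) :
    pf G 1 T p = (1 / 4) * ∑ x, ∑ y, (raiseLast G T p x y x y - raiseLast G T p x y y x) := by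
  have hk : ∀ a b : Fin 1 × Fin 2 → ι, kdelta a b
      = (if a (0, 0) = b (0, 0) then 1 else 0) * (if a (0, 1) = b (0, 1) then 1 else 0)
        - (if a (0, 1) = b (0, 0) then 1 else 0) * (if a (0, 0) = b (0, 1) then 1 else 0) := by
    intro a b
    rw [← kdelta_comp_equiv (Equiv.uniqueProd (Fin 2) (Fin 1)).symm, kdelta_eq_det,
      Matrix.det_fin_two]
    rfl
  rw [pf_eq_deltaContract]
  unfold deltaContract
  have hs : ∀ F : (Fin 1 × Fin 2 → ι) → ℝ, ∑ a, F a
      = ∑ x, ∑ y, F (fun s => if s.2 = 0 then x else y) := by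
    intro F
    have := sum_pairs (Q := Fin 1) (fun a c => F (fun s => if s.2 = 0 then a s.1 else c s.1))
    rw [← (Equiv.funUnique (Fin 1) ι).symm.sum_comp] at this
    simp_rw [← (Equiv.funUnique (Fin 1) ι).symm.sum_comp (fun c : Fin 1 → ι => F _)] at this
    refine Eq.trans ?_ this
    refine Finset.sum_congr rfl fun x _ => congrArg F ?_
    funext ⟨i, j⟩
    fin_cases i; fin_cases j <;> rfl
  simp_rw [hs, hk]
  simp [sub_mul, Finset.sum_sub_distrib]
  ring

end RaiseLast

/-! ### The Pfaffian of an Einstein metric in terms of its Weyl tensor. -/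

section Einstein

variable {n : ℕ} {U : Set (Model n)} {G : Model n → Matrix (Fin n) (Fin n) ℝ} {lam : ℝ}
  {p : Model n}

/-- `G` is a metric on `U` with `Ric = 2 λ (n-1) g`. -/
structure IsEinsteinOn (G : Model n → Matrix (Fin n) (Fin n) ℝ) (U : Set (Model n)) (lam : ℝ) :
    Prop extends IsMetricOn G U where
  ricci_eq : ∀ p ∈ U, ∀ a b, ricci (stdFrame n) G p a b = 2 * lam * ((n : ℝ) - 1) * G p a b

namespace IsEinsteinOn

variable (h : IsEinsteinOn G U lam)
include h

theorem scalar_eq (hp : p ∈ U) :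
    scalar (stdFrame n) G p = 2 * lam * n * ((n : ℝ) - 1) := by
  unfold scalar
  simp_rw [h.ricci_eq p hp]
  have : ∀ a, ∑ b, inv G p a b * (2 * lam * ((n : ℝ) - 1) * G p a b)
      = 2 * lam * ((n : ℝ) - 1) := by
    intro a
    have := h.inv_mul hp a a
    rw [if_pos rfl] at this
    calc _ = 2 * lam * ((n : ℝ) - 1) * ∑ b, inv G p a b * G p b a := by
          rw [Finset.mul_sum]
          exact Finset.sum_congr rfl fun b _ => by rw [h.symm p hp a b]; ring
      _ = _ := by rw [this, mul_one]
  simp_rw [this]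
  simp
  ring

theorem schoutenTrace_eq (hn : 3 ≤ n) (hp : p ∈ U) :
    schoutenTrace (stdFrame n) G p = n * lam := by
  unfold schoutenTrace
  rw [h.scalar_eq hp, Fintype.card_fin]
  have : (3 : ℝ) ≤ n := by exact_mod_cast hn
  have : (n : ℝ) - 1 ≠ 0 := by linarith
  field_simp

theorem schouten_eq (hn : 3 ≤ n) (hp : p ∈ U) (a b : Fin n) :
    schouten (stdFrame n) G p a b = lam * G p a b := by
  unfold schouten
  rw [h.schoutenTrace_eq hn hp, h.ricci_eq p hp, Fintype.card_fin]
  have : (3 : ℝ) ≤ n := by exact_mod_cast hn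
  have : (n : ℝ) - 2 ≠ 0 := by linarith
  field_simp
  ring

theorem weyl_eq (hn : 3 ≤ n) (hp : p ∈ U) (a b c d : Fin n) :
    weyl (stdFrame n) G p a b c d = riem (stdFrame n) G p a b c d
      - 2 * lam * (G p a c * G p b d - G p a d * G p b c) := by
  unfold weyl
  simp_rw [h.schouten_eq hn hp]
  rw [h.symm p hp d b, h.symm p hp c b, h.symm p hp d a, h.symm p hp c a]
  ring

theorem raiseLast_weyl (hn : 3 ≤ n) (hp : p ∈ U) (a b c d : Fin n) :
    raiseLast G (weyl (stdFrame n) G) p a b c d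
      = raiseLast G (riem (stdFrame n) G) p a b c d - 2 * lam * deltaTensor a b c d := by
  rw [← h.raiseLast_deltaTensor hp]
  exact raiseLast_sub_smul _ _ _ _ (h.weyl_eq hn hp) a b c d

/-- The expansion in the opposite direction. Only through it are the contractions of the Weyl tensor
seen to be invariants built from the Riemann tensor. -/
theorem pf_weyl_eq (hn : 3 ≤ n) (hp : p ∈ U) (l : ℕ) :
    pf G l (weyl (stdFrame n) G) p = ∑ j ∈ Finset.range (l + 1),
      pfCoeff n j (l - j) * (-2 * lam) ^ (l - j) * pf G j (riem (stdFrame n) G) p := by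
  have := pf_add_deltaTensor (G := G) (G' := G) (S := weyl (stdFrame n) G)
    (T := riem (stdFrame n) G) (p := p) (μ := -2 * lam)
    (fun a b c d => by rw [h.raiseLast_weyl hn hp]; ring) l
  rw [Fintype.card_fin] at this
  exact this

/-- Pf_1 is a multiple of the full trace, and the trace of 2λ times the identity on two-forms is
exactly the scalar curvature. This is why the sum in the theorem starts at 2. -/
theorem pf_one_weyl (hn : 3 ≤ n) (hp : p ∈ U) : pf G 1 (weyl (stdFrame n) G) p = 0 := by
  have hanti : ∀ x y, raiseLast G (weyl (stdFrame n) G) p x y y x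
      = -raiseLast G (weyl (stdFrame n) G) p y x y x := by
    intro x y
    unfold raiseLast
    simp_rw [← Finset.sum_neg_distrib, h.weyl_eq hn hp, riem_antisymm (stdFrame n) G p x y]
    exact Finset.sum_congr rfl fun _ _ => Finset.sum_congr rfl fun _ _ => by ring
  have htr : ∑ x, ∑ y, raiseLast G (weyl (stdFrame n) G) p x y x y = 0 := by
    simp_rw [h.raiseLast_weyl hn hp, Finset.sum_sub_distrib]
    have e1 : ∑ x, ∑ y, raiseLast G (riem (stdFrame n) G) p x y x y
        = scalar (stdFrame n) G p := by
      unfold scalar ricci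
      refine Finset.sum_congr rfl fun x _ => ?_
      simp_rw [h.raiseLast_riem hp, Finset.mul_sum]
      exact Finset.sum_comm
    have e2 : ∑ x : Fin n, ∑ y : Fin n, 2 * lam * deltaTensor x y x y
        = 2 * lam * n * ((n : ℝ) - 1) := by
      simp_rw [← Finset.mul_sum]
      unfold deltaTensor
      simp
      ring
    rw [e1, e2, h.scalar_eq hp, sub_self]
  rw [pf_one]
  simp_rw [hanti, sub_neg_eq_add, Finset.sum_add_distrib]
  rw [Finset.sum_comm (f := fun x y => raiseLast G (weyl (stdFrame n) G) p y x y x), htr]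
  simp

theorem pf_riem_eq (hn : 3 ≤ n) (heven : Even n) (hp : p ∈ U) :
    pf G (n / 2) (riem (stdFrame n) G) p
      = ((n - 1)‼ : ℝ) * (2 * lam) ^ (n / 2)
        + ∑ l ∈ Finset.Icc 2 (n / 2), ((2 * (n / 2 - l) - 1)‼ : ℝ) * (2 * lam) ^ (n / 2 - l)
          * pf G l (weyl (stdFrame n) G) p := by
  obtain ⟨m, hm⟩ := heven
  have hm2 : n / 2 = m := by omega
  have hnm : n = 2 * m := by omega
  -- The summands j = 0 and j = 1 are split off below: the first gives the constant term, the second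
  -- vanishes.
  have key := pf_add_deltaTensor (G := G) (G' := G) (S := riem (stdFrame n) G)
    (T := weyl (stdFrame n) G) (p := p) (μ := 2 * lam)
    (fun a b c d => by rw [h.raiseLast_weyl hn hp]; ring) m
  rw [hm2, key, Fintype.card_fin, Finset.sum_range_succ', Finset.range_eq_Ico,
    Finset.sum_eq_sum_Ico_succ_bot (by omega), pf_zero, h.pf_one_weyl hn hp]
  have e0 : pfCoeff (n : ℝ) 0 (m - 0) = ((n - 1)‼ : ℝ) := by
    rw [show (n : ℝ) = ((2 * m : ℕ) : ℝ) by rw [hnm], pfCoeff_middle m 0 (by omega)]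
    simp [hnm]
  rw [e0, Finset.sum_Ico_add' (fun j => pfCoeff (n : ℝ) j (m - j) * (2 * lam) ^ (m - j)
      * pf G j (weyl (stdFrame n) G) p) (0 + 1) m 1]
  have e2 : Finset.Ico (0 + 1 + 1) (m + 1) = Finset.Icc 2 m := by
    ext; simp
  rw [e2]
  simp only [mul_zero, zero_add, mul_one, Nat.sub_zero]
  rw [add_comm]
  congr 1
  refine Finset.sum_congr rfl fun j hj => ?_
  rw [show (n : ℝ) = ((2 * m : ℕ) : ℝ) by rw [hnm], pfCoeff_middle m j (Finset.mem_Icc.1 hj).2]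

end IsEinsteinOn

end Einstein


/-! ### Scalar invariants of Einstein metrics, with the Einstein constant as a parameter. -/

section EinsteinInvariants

variable {n : ℕ}

/-- `F` is a scalar invariant of Einstein metrics `G` with Einstein constant `2 λ (n-1)`. -/
def IsEinsteinInvariant (F : (Model n → Matrix (Fin n) (Fin n) ℝ) → ℝ → Model n → ℝ) : Prop :=
  ∃ f ∈ CurvScalar n, ∀ G U lam, IsEinsteinOn G U lam → ∀ p ∈ U, F G lam p = f G p

namespace IsEinsteinInvariant

variable {F F' : (Model n → Matrix (Fin n) (Fin n) ℝ) → ℝ → Model n → ℝ}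

theorem contDiffOn (hF : IsEinsteinInvariant F) {G : Model n → Matrix (Fin n) (Fin n) ℝ}
    {U : Set (Model n)} {lam : ℝ} (h : IsEinsteinOn G U lam) : ContDiffOn ℝ ∞ (F G lam) U := by
  obtain ⟨f, hf, hFf⟩ := hF
  exact (CurvScalar.contDiffOn hf h.toIsMetricOn).congr fun p hp => hFf G U lam h p hp

theorem zero : IsEinsteinInvariant (n := n) (fun _ _ _ => 0) :=
  ⟨0, Submodule.zero_mem _, fun _ _ _ _ _ _ => rfl⟩

theorem add (hF : IsEinsteinInvariant F) (hF' : IsEinsteinInvariant F') :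
    IsEinsteinInvariant (fun G lam p => F G lam p + F' G lam p) := by
  obtain ⟨f, hf, h⟩ := hF
  obtain ⟨f', hf', h'⟩ := hF'
  exact ⟨f + f', Submodule.add_mem _ hf hf', fun G U lam hG p hp => by
    simp only [h G U lam hG p hp, h' G U lam hG p hp]; rfl⟩

theorem const_mul (hF : IsEinsteinInvariant F) (c : ℝ) :
    IsEinsteinInvariant (fun G lam p => c * F G lam p) := by
  obtain ⟨f, hf, h⟩ := hF
  exact ⟨c • f, Submodule.smul_mem _ c hf, fun G U lam hG p hp => by
    simp only [h G U lam hG p hp]; rfl⟩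

theorem sum {κ : Type*} (s : Finset κ)
    {H : κ → (Model n → Matrix (Fin n) (Fin n) ℝ) → ℝ → Model n → ℝ}
    (hH : ∀ k, IsEinsteinInvariant (H k)) :
    IsEinsteinInvariant (fun G lam p => ∑ k ∈ s, H k G lam p) := by
  choose f hf h using hH
  exact ⟨∑ k ∈ s, f k, Submodule.sum_mem _ fun k _ => hf k, fun G U lam hG p hp => by
    simp only [Finset.sum_apply]
    exact Finset.sum_congr rfl fun k _ => h k G U lam hG p hp⟩

/-- For an Einstein metric λ = R/(2n(n-1)), so a factor λ can be replaced by a curvature scalar.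
This keeps the final invariant independent of λ. -/
theorem lam_mul (hn : 3 ≤ n) (hF : IsEinsteinInvariant F) :
    IsEinsteinInvariant (fun G lam p => lam * F G lam p) := by
  obtain ⟨f, hf, h⟩ := hF
  obtain ⟨s, hs, h'⟩ := exists_mem_scalar n
  refine ⟨(2 * (n : ℝ) * ((n : ℝ) - 1))⁻¹ • (s * f),
    Submodule.smul_mem _ _ (CurvScalar.mul_mem hs hf), fun G U lam hG p hp => ?_⟩
  simp only [Pi.smul_apply, Pi.mul_apply, smul_eq_mul]
  simp only [h G U lam hG p hp]
  rw [← h' G U hG.toIsMetricOn p hp, hG.scalar_eq hp]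
  have h3 : (3 : ℝ) ≤ n := by exact_mod_cast hn
  have h1 : (n : ℝ) - 1 ≠ 0 := by linarith
  have h0 : (n : ℝ) ≠ 0 := by linarith
  field_simp

theorem lam_pow_mul (hn : 3 ≤ n) (hF : IsEinsteinInvariant F) (k : ℕ) :
    IsEinsteinInvariant (fun G lam p => lam ^ k * F G lam p) := by
  induction k with
  | zero => simpa using hF
  | succ k ih =>
    convert ih.lam_mul hn using 4
    rw [pow_succ]; ring

theorem laplacian (hF : IsEinsteinInvariant F) :
    IsEinsteinInvariant (fun G lam p => Coord.laplacian (stdFrame n) G (F G lam) p) := by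
  obtain ⟨f, hf, h⟩ := hF
  obtain ⟨g, hg, h'⟩ := CurvScalar.exists_laplacian hf
  exact ⟨g, hg, fun G U lam hG p hp =>
    (hG.laplacian_congr (fun q hq => h G U lam hG q hq) hp).trans (h' G U hG.toIsMetricOn p hp)⟩

theorem pf_weyl (hn : 3 ≤ n) (l : ℕ) :
    IsEinsteinInvariant (fun G (_ : ℝ) p => pf G l (weyl (stdFrame n) G) p) := by
  have h1 : ∀ j, IsEinsteinInvariant (n := n) fun G (_ : ℝ) p => pf G j (riem (stdFrame n) G) p :=
    fun j => ⟨_, pf_riem_mem n j, fun _ _ _ _ _ _ => rfl⟩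
  have h2 := sum (Finset.range (l + 1)) fun j =>
    ((h1 j).lam_pow_mul hn (l - j)).const_mul (pfCoeff n j (l - j) * (-2) ^ (l - j))
  obtain ⟨f, hf, h⟩ := h2
  refine ⟨f, hf, fun G U lam hG p hp => ?_⟩
  simp only [← h G U lam hG p hp, hG.pf_weyl_eq hn hp]
  refine Finset.sum_congr rfl fun j _ => ?_
  rw [mul_pow]; ring

end IsEinsteinInvariant

/-- The iterated operator `∏ (Δ + c_j λ)`. -/
noncomputable def shiftedLaplacian (c : ℕ → ℝ) (G : Model n → Matrix (Fin n) (Fin n) ℝ) (lam : ℝ)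
    (f : Model n → ℝ) : ℕ → Model n → ℝ
  | 0 => f
  | k + 1 => fun p => laplacian (stdFrame n) G (shiftedLaplacian c G lam f k) p
      + c k * (lam * shiftedLaplacian c G lam f k p)

theorem IsEinsteinInvariant.shiftedLaplacian (hn : 3 ≤ n) (c : ℕ → ℝ)
    {F : (Model n → Matrix (Fin n) (Fin n) ℝ) → ℝ → Model n → ℝ} (hF : IsEinsteinInvariant F)
    (k : ℕ) : IsEinsteinInvariant fun G lam => Coord.shiftedLaplacian c G lam (F G lam) k := by
  induction k with
  | zero => exact hF
  | succ k ih => exact ih.laplacian.add ((ih.lam_mul hn).const_mul (c k))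

/-- When the product of the operators Δ + c_j λ is multiplied out, every term except the product of
the constants contains Δ, and Δ can be moved to the left because λ is constant. -/
theorem IsEinsteinInvariant.exists_shiftedLaplacian_eq (hn : 3 ≤ n) (c : ℕ → ℝ)
    {F : (Model n → Matrix (Fin n) (Fin n) ℝ) → ℝ → Model n → ℝ} (hF : IsEinsteinInvariant F)
    (k : ℕ) : ∃ H : (Model n → Matrix (Fin n) (Fin n) ℝ) → ℝ → Model n → ℝ,
      IsEinsteinInvariant H ∧ ∀ G U lam, IsEinsteinOn G U lam → ∀ p ∈ U,
        Coord.shiftedLaplacian c G lam (F G lam) k p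
          = (∏ j ∈ Finset.range k, c j) * lam ^ k * F G lam p
            + Coord.laplacian (stdFrame n) G (H G lam) p := by
  induction k with
  | zero =>
    refine ⟨_, IsEinsteinInvariant.zero, fun G U lam hG p hp => ?_⟩
    have := hG.laplacian_const_mul (e := stdFrame n) (f := fun _ => 0) contDiffOn_const 0 hp
    simp only [zero_mul] at this
    simp [Coord.shiftedLaplacian, this]
  | succ k ih =>
    obtain ⟨H, hH, h⟩ := ih
    have hP := hF.shiftedLaplacian hn c k
    -- The new potential: the partial product itself, from the newly applied Δ, plus c_k λ times the
    -- old potential.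
    refine ⟨_, hP.add ((hH.lam_mul hn).const_mul (c k)), fun G U lam hG p hp => ?_⟩
    have s1 := hP.contDiffOn hG
    have s2 := hH.contDiffOn hG
    have e1 : (fun q => c k * (lam * H G lam q)) = fun q => (c k * lam) * H G lam q := by
      funext q; ring
    rw [hG.laplacian_add s1 (contDiffOn_const.mul (contDiffOn_const.mul s2)) hp, e1,
      hG.laplacian_const_mul s2 _ hp, Coord.shiftedLaplacian, Finset.prod_range_succ]
    simp only [h G U lam hG p hp]
    ring

end EinsteinInvariants


/-! ### Orders of vanishing along ρ = 0. -/

section Vanishing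

variable {n : ℕ} {Ω : Set (ℝ × Model n × ℝ)} {f g f' g' : ℝ × Model n × ℝ → ℝ}

/-- The index of the coordinate `ρ`. -/
abbrev idxInf {n : ℕ} : AmbientIndex n := Sum.inr (Sum.inr ())

/-- The index of the coordinate `t`. -/
abbrev idxZero {n : ℕ} : AmbientIndex n := Sum.inl ()

/-- The index of a coordinate of `M`. -/
abbrev idxM {n : ℕ} (i : Fin n) : AmbientIndex n := Sum.inr (Sum.inl i)

/-- `f = O(ρ^k)` along `{ρ = 0}` in `Ω`. -/
def VanishesTo (Ω : Set (ℝ × Model n × ℝ)) : ℕ → (ℝ × Model n × ℝ → ℝ) → Prop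
  | 0, _ => True
  | k + 1, f => (∀ q ∈ Ω, q.2.2 = 0 → f q = 0) ∧ VanishesTo Ω k (pd (ambientFrame n) idxInf f)

theorem VanishesTo.congr (hΩ : IsOpen Ω) {k : ℕ} (h : VanishesTo Ω k f) (hfg : Set.EqOn f g Ω) :
    VanishesTo Ω k g := by
  induction k generalizing f g with
  | zero => trivial
  | succ k ih =>
    exact ⟨fun q hq h0 => by rw [← hfg hq, h.1 q hq h0],
      ih h.2 fun q hq => pd_congr hΩ hfg hq _⟩

theorem VanishesTo.pd_inf {k : ℕ} (h : VanishesTo Ω (k + 1) f) :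
    VanishesTo Ω k (pd (ambientFrame n) idxInf f) := h.2

theorem VanishesTo.of_succ {k : ℕ} (h : VanishesTo Ω (k + 1) f) : VanishesTo Ω k f := by
  induction k generalizing f with
  | zero => trivial
  | succ k ih => exact ⟨h.1, ih h.2⟩

theorem VanishesTo.mono {k l : ℕ} (h : VanishesTo Ω k f) (hl : l ≤ k) : VanishesTo Ω l f := by
  induction k with
  | zero => rwa [Nat.le_zero.1 hl]
  | succ k ih =>
    rcases Nat.le_succ_iff.1 hl with h1 | h1
    · exact ih h.of_succ h1
    · rwa [h1]

theorem vanishesTo_zero (hΩ : IsOpen Ω) (k : ℕ) : VanishesTo Ω k (fun _ => 0) := by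
  induction k with
  | zero => trivial
  | succ k ih => exact ⟨fun _ _ _ => rfl, ih.congr hΩ fun q _ => (pd_const 0 _).symm⟩

theorem VanishesTo.add (hΩ : IsOpen Ω) (hf : ContDiffOn ℝ ∞ f Ω) (hg : ContDiffOn ℝ ∞ g Ω) {k : ℕ}
    (h : VanishesTo Ω k f) (h' : VanishesTo Ω k g) : VanishesTo Ω k (fun q => f q + g q) := by
  induction k generalizing f g with
  | zero => trivial
  | succ k ih =>
    refine ⟨fun q hq h0 => by simp only [h.1 q hq h0, h'.1 q hq h0, add_zero], ?_⟩
    refine (ih (contDiffOn_pd hΩ _ hf) (contDiffOn_pd hΩ _ hg) h.2 h'.2).congr hΩ fun q hq => ?_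
    exact (pd_add (differentiableAt_of_contDiffOn hΩ hf hq)
      (differentiableAt_of_contDiffOn hΩ hg hq) _).symm

theorem VanishesTo.mul (hΩ : IsOpen Ω) (hf : ContDiffOn ℝ ∞ f Ω) (hg : ContDiffOn ℝ ∞ g Ω) {k : ℕ}
    (h : VanishesTo Ω k f) : VanishesTo Ω k (fun q => f q * g q) := by
  induction k generalizing f g with
  | zero => trivial
  | succ k ih =>
    refine ⟨fun q hq h0 => by simp only [h.1 q hq h0, zero_mul], ?_⟩
    have hf' := contDiffOn_pd (e := ambientFrame n) hΩ idxInf hf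
    have hg' := contDiffOn_pd (e := ambientFrame n) hΩ idxInf hg
    refine ((ih hf' hg h.2).add hΩ (hf'.mul hg) (hf.mul hg') (ih hf hg' h.of_succ)).congr hΩ
      fun q hq => ?_
    exact (pd_mul (differentiableAt_of_contDiffOn hΩ hf hq)
      (differentiableAt_of_contDiffOn hΩ hg hq) _).symm

theorem VanishesTo.mul_left (hΩ : IsOpen Ω) (hf : ContDiffOn ℝ ∞ f Ω) (hg : ContDiffOn ℝ ∞ g Ω)
    {k : ℕ} (h : VanishesTo Ω k g) : VanishesTo Ω k (fun q => f q * g q) :=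
  (h.mul hΩ hg hf).congr hΩ fun _ _ => mul_comm _ _

theorem VanishesTo.const_mul (hΩ : IsOpen Ω) (hf : ContDiffOn ℝ ∞ f Ω) (c : ℝ) {k : ℕ}
    (h : VanishesTo Ω k f) : VanishesTo Ω k (fun q => c * f q) :=
  h.mul_left hΩ contDiffOn_const hf

theorem VanishesTo.sub (hΩ : IsOpen Ω) (hf : ContDiffOn ℝ ∞ f Ω) (hg : ContDiffOn ℝ ∞ g Ω) {k : ℕ}
    (h : VanishesTo Ω k f) (h' : VanishesTo Ω k g) : VanishesTo Ω k (fun q => f q - g q) :=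
  (h.add hΩ hf (contDiffOn_const.mul hg) (h'.const_mul hΩ hg (-1))).congr hΩ fun _ _ => by
    simp only; ring

theorem VanishesTo.sum (hΩ : IsOpen Ω) {κ : Type*} (s : Finset κ) {F : κ → ℝ × Model n × ℝ → ℝ}
    (hF : ∀ i, ContDiffOn ℝ ∞ (F i) Ω) {k : ℕ} (h : ∀ i, VanishesTo Ω k (F i)) :
    VanishesTo Ω k (fun q => ∑ i ∈ s, F i q) := by
  classical
  induction s using Finset.induction_on with
  | empty => simpa using vanishesTo_zero hΩ k
  | insert i s hi ih =>
    refine ((h i).add hΩ (hF i) (ContDiffOn.sum fun j _ => hF j) ih).congr hΩ fun q _ => ?_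
    simp only [Finset.sum_insert hi]

theorem contDiff_rho : ContDiff ℝ ∞ (fun q : ℝ × Model n × ℝ => q.2.2) :=
  contDiff_snd.comp contDiff_snd

theorem contDiff_t : ContDiff ℝ ∞ (fun q : ℝ × Model n × ℝ => q.1) := contDiff_fst

theorem pd_rho (A : AmbientIndex n) (q : ℝ × Model n × ℝ) :
    pd (ambientFrame n) A (fun q => q.2.2) q = (ambientFrame n A).2.2 := by
  unfold pd
  have h : HasFDerivAt (fun q : ℝ × Model n × ℝ => q.2.2)
      ((ContinuousLinearMap.snd ℝ (Model n) ℝ).comp (ContinuousLinearMap.snd ℝ ℝ (Model n × ℝ))) q :=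
    ((ContinuousLinearMap.snd ℝ (Model n) ℝ).comp
      (ContinuousLinearMap.snd ℝ ℝ (Model n × ℝ))).hasFDerivAt
  rw [h.fderiv]
  rfl

theorem pd_t (A : AmbientIndex n) (q : ℝ × Model n × ℝ) :
    pd (ambientFrame n) A (fun q => q.1) q = (ambientFrame n A).1 := by
  unfold pd
  have h : HasFDerivAt (fun q : ℝ × Model n × ℝ => q.1)
      (ContinuousLinearMap.fst ℝ ℝ (Model n × ℝ)) q :=
    (ContinuousLinearMap.fst ℝ ℝ (Model n × ℝ)).hasFDerivAt
  rw [h.fderiv]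
  rfl

/-- Multiplication by ρ gains one order. All savings in the order count below come from factors ρ in
the ambient metric and its connection. -/
theorem VanishesTo.rho_mul (hΩ : IsOpen Ω) (hf : ContDiffOn ℝ ∞ f Ω) {k : ℕ}
    (h : VanishesTo Ω k f) : VanishesTo Ω (k + 1) (fun q => q.2.2 * f q) := by
  have key : ∀ f, ContDiffOn ℝ ∞ f Ω → ∀ q ∈ Ω,
      f q + q.2.2 * pd (ambientFrame n) idxInf f q
        = pd (ambientFrame n) idxInf (fun q => q.2.2 * f q) q := by
    intro f hf q hq
    rw [pd_mul (contDiff_rho.differentiable (by simp)).differentiableAt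
      (differentiableAt_of_contDiffOn hΩ hf hq), pd_rho]
    simp [ambientFrame]
  induction k generalizing f with
  | zero => exact ⟨fun q hq h0 => by simp only [h0, zero_mul], trivial⟩
  | succ k ih =>
    refine ⟨fun q hq h0 => by simp only [h0, zero_mul], ?_⟩
    have hf' := contDiffOn_pd (e := ambientFrame n) hΩ idxInf hf
    exact (h.add hΩ hf (contDiff_rho.contDiffOn.mul hf') (ih hf' h.2)).congr hΩ fun q hq =>
      key f hf q hq

/-- Curves in coordinate directions other than ρ stay in the hypersurface ρ = 0, where f is zero;
higher orders follow by commuting with ∂_ρ. Hence tangential derivatives cost nothing. -/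
theorem VanishesTo.pd_tangential (hΩ : IsOpen Ω) (hf : ContDiffOn ℝ ∞ f Ω) {k : ℕ}
    (h : VanishesTo Ω k f) {A : AmbientIndex n} (hA : A ≠ idxInf) :
    VanishesTo Ω k (pd (ambientFrame n) A f) := by
  induction k generalizing f with
  | zero => trivial
  | succ k ih =>
    have hA2 : (ambientFrame n A).2.2 = 0 := by
      rcases A with _ | _ | _
      · rfl
      · rfl
      · exact absurd rfl hA
    refine ⟨fun q hq h0 => ?_, ?_⟩
    · have hd : HasDerivAt (fun s : ℝ => f (q + s • ambientFrame n A))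
          (fderiv ℝ f q (ambientFrame n A)) 0 := by
        have h1 : HasDerivAt (fun s : ℝ => q + s • ambientFrame n A) (ambientFrame n A) 0 := by
          simpa using ((hasDerivAt_id (0 : ℝ)).smul_const (ambientFrame n A)).const_add q
        have h2 : HasFDerivAt f (fderiv ℝ f q) (q + (0 : ℝ) • ambientFrame n A) := by
          simpa using (differentiableAt_of_contDiffOn hΩ hf hq).hasFDerivAt
        exact h2.comp_hasDerivAt (0 : ℝ) h1
      have hz : (fun s : ℝ => f (q + s • ambientFrame n A)) =ᶠ[nhds 0] fun _ => 0 := by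
        have hc : Continuous fun s : ℝ => q + s • ambientFrame n A := by fun_prop
        have : ∀ᶠ s : ℝ in nhds 0, q + s • ambientFrame n A ∈ Ω :=
          hc.continuousAt.eventually_mem (hΩ.mem_nhds (by simpa using hq))
        filter_upwards [this] with s hs
        refine h.1 _ hs ?_
        simp [h0, hA2]
      exact hd.unique ((hasDerivAt_const (0 : ℝ) (0 : ℝ)).congr_of_eventuallyEq hz)
    · exact (ih (contDiffOn_pd hΩ _ hf) h.2).congr hΩ fun q hq => pd_comm hΩ hf hq _ _

/-- `f = g + O(ρ^k)`, with `f` and `g` smooth on `Ω`. -/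
structure CongrTo (Ω : Set (ℝ × Model n × ℝ)) (k : ℕ) (f g : ℝ × Model n × ℝ → ℝ) : Prop where
  left : ContDiffOn ℝ ∞ f Ω
  right : ContDiffOn ℝ ∞ g Ω
  van : VanishesTo Ω k (fun q => f q - g q)

namespace CongrTo

variable {k l : ℕ}

theorem refl (hΩ : IsOpen Ω) (hf : ContDiffOn ℝ ∞ f Ω) : CongrTo Ω k f f :=
  ⟨hf, hf, (vanishesTo_zero hΩ k).congr hΩ fun _ _ => (sub_self _).symm⟩

theorem of_eqOn (hΩ : IsOpen Ω) (hf : ContDiffOn ℝ ∞ f Ω) (h : Set.EqOn f g Ω) :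
    CongrTo Ω k f g :=
  ⟨hf, hf.congr fun _ hq => (h hq).symm, (vanishesTo_zero hΩ k).congr hΩ fun q hq => by
    rw [h hq, sub_self]⟩

theorem symm (hΩ : IsOpen Ω) (h : CongrTo Ω k f g) : CongrTo Ω k g f :=
  ⟨h.right, h.left, (h.van.const_mul hΩ (h.left.sub h.right) (-1)).congr hΩ fun q _ => by
    simp only; ring⟩

theorem trans (hΩ : IsOpen Ω) (h : CongrTo Ω k f g) (h' : CongrTo Ω k g g') : CongrTo Ω k f g' :=
  ⟨h.left, h'.right, (h.van.add hΩ (h.left.sub h.right) (h'.left.sub h'.right) h'.van).congr hΩ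
    fun q _ => by simp only; ring⟩

theorem mono (h : CongrTo Ω k f g) (hl : l ≤ k) : CongrTo Ω l f g :=
  ⟨h.left, h.right, h.van.mono hl⟩

theorem congr (hΩ : IsOpen Ω) (h : CongrTo Ω k f g) (hf : Set.EqOn f f' Ω) (hg : Set.EqOn g g' Ω) :
    CongrTo Ω k f' g' :=
  ⟨h.left.congr fun _ hq => (hf hq).symm, h.right.congr fun _ hq => (hg hq).symm,
    h.van.congr hΩ fun q hq => by simp only [hf hq, hg hq]⟩

theorem add (hΩ : IsOpen Ω) (h : CongrTo Ω k f g) (h' : CongrTo Ω k f' g') :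
    CongrTo Ω k (fun q => f q + f' q) (fun q => g q + g' q) :=
  ⟨h.left.add h'.left, h.right.add h'.right,
    (h.van.add hΩ (h.left.sub h.right) (h'.left.sub h'.right) h'.van).congr hΩ fun q _ => by
      simp only; ring⟩

theorem sub (hΩ : IsOpen Ω) (h : CongrTo Ω k f g) (h' : CongrTo Ω k f' g') :
    CongrTo Ω k (fun q => f q - f' q) (fun q => g q - g' q) :=
  ⟨h.left.sub h'.left, h.right.sub h'.right,
    (h.van.sub hΩ (h.left.sub h.right) (h'.left.sub h'.right) h'.van).congr hΩ fun q _ => by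
      simp only; ring⟩

theorem mul (hΩ : IsOpen Ω) (h : CongrTo Ω k f g) (h' : CongrTo Ω k f' g') :
    CongrTo Ω k (fun q => f q * f' q) (fun q => g q * g' q) :=
  ⟨h.left.mul h'.left, h.right.mul h'.right,
    ((h'.van.mul_left hΩ h.left (h'.left.sub h'.right)).add hΩ
      (h.left.mul (h'.left.sub h'.right)) ((h.left.sub h.right).mul h'.right)
      (h.van.mul hΩ (h.left.sub h.right) h'.right)).congr hΩ fun q _ => by simp only; ring⟩

theorem const_mul (hΩ : IsOpen Ω) (c : ℝ) (h : CongrTo Ω k f g) :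
    CongrTo Ω k (fun q => c * f q) (fun q => c * g q) :=
  (refl hΩ contDiffOn_const).mul hΩ h

theorem sum (hΩ : IsOpen Ω) {κ : Type*} (s : Finset κ) {F F' : κ → ℝ × Model n × ℝ → ℝ}
    (h : ∀ i, CongrTo Ω k (F i) (F' i)) :
    CongrTo Ω k (fun q => ∑ i ∈ s, F i q) (fun q => ∑ i ∈ s, F' i q) :=
  ⟨ContDiffOn.sum fun i _ => (h i).left, ContDiffOn.sum fun i _ => (h i).right,
    (VanishesTo.sum hΩ s (fun i => (h i).left.sub (h i).right) fun i => (h i).van).congr hΩ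
      fun q _ => by simp only [Finset.sum_sub_distrib]⟩

theorem prod (hΩ : IsOpen Ω) {κ : Type*} (s : Finset κ) {F F' : κ → ℝ × Model n × ℝ → ℝ}
    (h : ∀ i, CongrTo Ω k (F i) (F' i)) :
    CongrTo Ω k (fun q => ∏ i ∈ s, F i q) (fun q => ∏ i ∈ s, F' i q) := by
  classical
  induction s using Finset.induction_on with
  | empty => simpa using refl hΩ contDiffOn_const
  | insert i s hi ih =>
    simp only [Finset.prod_insert hi]
    exact (h i).mul hΩ ih

theorem rho_mul (hΩ : IsOpen Ω) (h : CongrTo Ω k f g) :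
    CongrTo Ω (k + 1) (fun q => q.2.2 * f q) (fun q => q.2.2 * g q) :=
  ⟨contDiff_rho.contDiffOn.mul h.left, contDiff_rho.contDiffOn.mul h.right,
    (h.van.rho_mul hΩ (h.left.sub h.right)).congr hΩ fun q _ => by simp only; ring⟩

theorem pd_inf (hΩ : IsOpen Ω) (h : CongrTo Ω (k + 1) f g) :
    CongrTo Ω k (pd (ambientFrame n) idxInf f) (pd (ambientFrame n) idxInf g) :=
  ⟨contDiffOn_pd hΩ _ h.left, contDiffOn_pd hΩ _ h.right, h.van.pd_inf.congr hΩ fun _ hq =>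
    pd_sub (differentiableAt_of_contDiffOn hΩ h.left hq)
      (differentiableAt_of_contDiffOn hΩ h.right hq) _⟩

theorem pd_tangential (hΩ : IsOpen Ω) (h : CongrTo Ω k f g) {A : AmbientIndex n}
    (hA : A ≠ idxInf) : CongrTo Ω k (pd (ambientFrame n) A f) (pd (ambientFrame n) A g) :=
  ⟨contDiffOn_pd hΩ _ h.left, contDiffOn_pd hΩ _ h.right,
    (h.van.pd_tangential hΩ (h.left.sub h.right) hA).congr hΩ fun _ hq =>
    pd_sub (differentiableAt_of_contDiffOn hΩ h.left hq)
      (differentiableAt_of_contDiffOn hΩ h.right hq) _⟩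

theorem pd (hΩ : IsOpen Ω) (h : CongrTo Ω (k + 1) f g) (A : AmbientIndex n) :
    CongrTo Ω k (Coord.pd (ambientFrame n) A f) (Coord.pd (ambientFrame n) A g) := by
  rcases A with _ | _ | _
  · exact (h.mono k.le_succ).pd_tangential hΩ (by simp)
  · exact (h.mono k.le_succ).pd_tangential hΩ (by simp)
  · exact h.pd_inf hΩ

theorem eq_of_rho_eq_zero (h : CongrTo Ω (k + 1) f g) {q : ℝ × Model n × ℝ} (hq : q ∈ Ω)
    (h0 : q.2.2 = 0) : f q = g q := sub_eq_zero.1 (h.van.1 q hq h0)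

end CongrTo

/-- An ordinary differential operator in `ρ` that lowers the order of vanishing by one less. -/
theorem VanishesTo.rho_pd_pd (hΩ : IsOpen Ω) (hf : ContDiffOn ℝ ∞ f Ω) {k : ℕ}
    (h : VanishesTo Ω k f) :
    VanishesTo Ω k (fun q => q.2.2 * pd (ambientFrame n) idxInf (pd (ambientFrame n) idxInf f) q
      - ((k : ℝ) - 1) * pd (ambientFrame n) idxInf f q) := by
  induction k generalizing f with
  | zero => trivial
  | succ k ih =>
    have hf1 := contDiffOn_pd (e := ambientFrame n) hΩ idxInf hf
    have hf2 := contDiffOn_pd (e := ambientFrame n) hΩ idxInf hf1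
    refine ⟨fun q hq h0 => ?_, ?_⟩
    · simp only [h0]
      -- At first order the coefficient of ∂_ρ f is zero; at higher order ∂_ρ f itself vanishes on ρ
      -- = 0.
      cases k with
      | zero => simp
      | succ k => simp [h.2.1 q hq h0]
    · refine (ih hf1 h.2).congr hΩ fun q hq => ?_
      have d1 := differentiableAt_of_contDiffOn hΩ hf1 hq
      have d2 := differentiableAt_of_contDiffOn hΩ hf2 hq
      have dr : DifferentiableAt ℝ (fun q : ℝ × Model n × ℝ => q.2.2) q :=
        (contDiff_rho.differentiable (by simp)).differentiableAt
      rw [pd_sub (dr.fun_mul d2) ((differentiableAt_const _).fun_mul d1), pd_mul dr d2,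
        pd_const_mul d1, pd_rho]
      simp [ambientFrame]
      ring

/-- Vanishing of the iterated derivatives of `ρ ↦ f (t, x, ρ)` at `ρ = 0`. -/
theorem vanishesTo_of_iteratedDeriv (hΩ : IsOpen Ω) (hf : ContDiffOn ℝ ∞ f Ω) {k : ℕ}
    (h : ∀ q ∈ Ω, q.2.2 = 0 → ∀ l < k, iteratedDeriv l (fun ρ => f (q.1, q.2.1, ρ)) 0 = 0) :
    VanishesTo Ω k f := by
  induction k generalizing f with
  | zero => trivial
  | succ k ih =>
    refine ⟨fun q hq h0 => ?_, ih (contDiffOn_pd hΩ _ hf) fun q hq h0 l hl => ?_⟩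
    · have := h q hq h0 0 (Nat.succ_pos k)
      rw [iteratedDeriv_zero] at this
      obtain ⟨t, x, ρ⟩ := q
      simp only at h0
      subst h0
      exact this
    · have := h q hq h0 (l + 1) (by omega)
      rw [iteratedDeriv_succ'] at this
      refine Eq.trans ?_ this
      refine Filter.EventuallyEq.iteratedDeriv_eq l ?_
      have hc : Continuous fun ρ : ℝ => ((q.1, q.2.1, ρ) : ℝ × Model n × ℝ) := by fun_prop
      have : ∀ᶠ ρ : ℝ in nhds 0, ((q.1, q.2.1, ρ) : ℝ × Model n × ℝ) ∈ Ω :=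
        hc.continuousAt.eventually_mem (hΩ.mem_nhds (by rw [← h0]; exact hq))
      filter_upwards [this] with ρ hρ
      have h1 : HasDerivAt (fun ρ : ℝ => ((q.1, q.2.1, ρ) : ℝ × Model n × ℝ)) (0, 0, 1) ρ :=
        (hasDerivAt_const ρ q.1).prodMk ((hasDerivAt_const ρ q.2.1).prodMk (hasDerivAt_id ρ))
      exact ((differentiableAt_of_contDiffOn hΩ hf hρ).hasFDerivAt.comp_hasDerivAt ρ h1).deriv.symm

end Vanishing


/-! ### The inverse and the Christoffel symbols of the ambient metric. -/

section Ambient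

variable {n : ℕ}

theorem pd_eq_of_hasDerivAt {ι V : Type} [NormedAddCommGroup V] [NormedSpace ℝ V] {e : ι → V}
    {f : V → ℝ} {q : V} {a : ι} {v : ℝ} (hf : DifferentiableAt ℝ f q)
    (h : HasDerivAt (fun s : ℝ => f (q + s • e a)) v 0) : pd e a f q = v := by
  have h1 : HasDerivAt (fun s : ℝ => q + s • e a) (e a) 0 := by
    simpa using ((hasDerivAt_id (0 : ℝ)).smul_const (e a)).const_add q
  have h2 : HasFDerivAt f (fderiv ℝ f q) (q + (0 : ℝ) • e a) := by
    simpa using hf.hasFDerivAt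
  exact (h2.comp_hasDerivAt (0 : ℝ) h1).unique h

theorem pd_slice {f : ℝ × Model n × ℝ → ℝ} {q : ℝ × Model n × ℝ} (hf : DifferentiableAt ℝ f q)
    (i : Fin n) : pd (stdFrame n) i (fun p => f (q.1, p, q.2.2)) q.2.1
      = pd (ambientFrame n) (idxM i) f q := by
  unfold pd
  have h1 : HasFDerivAt (fun p : Model n => ((q.1, p, q.2.2) : ℝ × Model n × ℝ))
      ((0 : Model n →L[ℝ] ℝ).prod ((ContinuousLinearMap.id ℝ (Model n)).prod 0)) q.2.1 :=
    (hasFDerivAt_const q.1 _).prodMk ((hasFDerivAt_id _).prodMk (hasFDerivAt_const q.2.2 _))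
  have h2 : HasFDerivAt f (fderiv ℝ f q) (q.1, q.2.1, q.2.2) := hf.hasFDerivAt
  have := (h2.comp q.2.1 h1).fderiv
  change fderiv ℝ (f ∘ fun p : Model n => ((q.1, p, q.2.2) : ℝ × Model n × ℝ)) q.2.1 _ = _
  rw [this]
  rfl

theorem pd_zero_of_snd {F : Model n × ℝ → ℝ} {q : ℝ × Model n × ℝ}
    (hf : DifferentiableAt ℝ (fun q : ℝ × Model n × ℝ => F q.2) q) :
    pd (ambientFrame n) idxZero (fun q => F q.2) q = 0 := by
  refine pd_eq_of_hasDerivAt hf ?_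
  have : (fun s : ℝ => F (q + s • ambientFrame n idxZero).2) = fun _ => F q.2 := by
    funext s
    have : (q + s • ambientFrame n idxZero).2 = q.2 := by simp [ambientFrame, Prod.ext_iff]
    rw [this]
  rw [this]
  exact hasDerivAt_const _ _

theorem sum_ambient (F : AmbientIndex n → ℝ) :
    ∑ A, F A = F idxZero + ((∑ i, F (idxM i)) + F idxInf) := by
  simp [Fintype.sum_sum_type]

/-- `h` is a smooth family, parametrized by `(-ε, ε)`, of component matrices of metrics on `D`. -/
structure IsFamilyOn (h : ℝ → Model n → Matrix (Fin n) (Fin n) ℝ) (D : Set (Model n)) (ε : ℝ) :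
    Prop where
  isOpen : IsOpen D
  smooth : ∀ i j, ContDiffOn ℝ ∞ (fun z : Model n × ℝ => h z.2 z.1 i j) (D ×ˢ Set.Ioo (-ε) ε)
  symm : ∀ ρ ∈ Set.Ioo (-ε) ε, ∀ p ∈ D, ∀ i j, h ρ p i j = h ρ p j i
  det_ne : ∀ ρ ∈ Set.Ioo (-ε) ε, ∀ p ∈ D, (h ρ p).det ≠ 0

/-- The coordinate domain `(0, ∞) × D × (-ε, ε)`. -/
def ambientDomain (D : Set (Model n)) (ε : ℝ) : Set (ℝ × Model n × ℝ) :=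
  Set.Ioi 0 ×ˢ D ×ˢ Set.Ioo (-ε) ε

variable (h : ℝ → Model n → Matrix (Fin n) (Fin n) ℝ)

/-- The components of `g_ρ` as functions on the ambient space. -/
def famComp (i j : Fin n) (q : ℝ × Model n × ℝ) : ℝ := h q.2.2 q.2.1 i j

/-- The components of `∂_ρ g_ρ` as functions on the ambient space. -/
noncomputable def famDeriv (i j : Fin n) : ℝ × Model n × ℝ → ℝ :=
  pd (ambientFrame n) idxInf (famComp h i j)

/-- The components of the inverse of `g_ρ` as functions on the ambient space. -/
noncomputable def famInv (i j : Fin n) (q : ℝ × Model n × ℝ) : ℝ := inv (h q.2.2) q.2.1 i j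

/-- The Christoffel symbols of `g_ρ` as functions on the ambient space. -/
noncomputable def famChr (k i j : Fin n) (q : ℝ × Model n × ℝ) : ℝ :=
  (1 / 2) * ∑ l, famInv h k l q * (pd (ambientFrame n) (idxM i) (famComp h l j) q
    + pd (ambientFrame n) (idxM j) (famComp h l i) q
    - pd (ambientFrame n) (idxM l) (famComp h i j) q)

/-- The endomorphism `g_ρ^{-1} ∂_ρ g_ρ`. -/
noncomputable def famShape (k j : Fin n) (q : ℝ × Model n × ℝ) : ℝ :=
  ∑ l, famInv h k l q * famDeriv h l j q

/-- The components of the inverse of the ambient metric. -/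
noncomputable def ambInv (q : ℝ × Model n × ℝ) : AmbientIndex n → AmbientIndex n → ℝ
  | .inl _, .inr (.inr _) => q.1⁻¹
  | .inr (.inr _), .inl _ => q.1⁻¹
  | .inr (.inr _), .inr (.inr _) => q.2.2 * (-2 * (q.1⁻¹ * q.1⁻¹))
  | .inr (.inl i), .inr (.inl j) => q.1⁻¹ * q.1⁻¹ * famInv h i j q
  | _, _ => 0

/-- The Christoffel symbols of the ambient metric; the upper index comes first. -/
noncomputable def ambChr : AmbientIndex n → AmbientIndex n → AmbientIndex n → ℝ × Model n × ℝ → ℝ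
  | .inl _, .inr (.inl i), .inr (.inl j) => fun q => -(1 / 2) * q.1 * famDeriv h i j q
  | .inr (.inl k), .inl _, .inr (.inl j) => fun q => if k = j then q.1⁻¹ else 0
  | .inr (.inl k), .inr (.inl j), .inl _ => fun q => if k = j then q.1⁻¹ else 0
  | .inr (.inl k), .inr (.inl i), .inr (.inl j) => famChr h k i j
  | .inr (.inl k), .inr (.inl j), .inr (.inr _) => fun q => (1 / 2) * famShape h k j q
  | .inr (.inl k), .inr (.inr _), .inr (.inl j) => fun q => (1 / 2) * famShape h k j q
  | .inr (.inr _), .inr (.inl i), .inr (.inl j) => fun q =>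
      q.2.2 * famDeriv h i j q - famComp h i j q
  | .inr (.inr _), .inl _, .inr (.inr _) => fun q => q.1⁻¹
  | .inr (.inr _), .inr (.inr _), .inl _ => fun q => q.1⁻¹
  | _, _, _ => fun _ => 0

variable {h} {D : Set (Model n)} {ε : ℝ}

namespace IsFamilyOn

variable (hh : IsFamilyOn h D ε)
include hh

theorem isOpen_ambientDomain : IsOpen (ambientDomain D ε) :=
  isOpen_Ioi.prod (hh.isOpen.prod isOpen_Ioo)

theorem contDiffOn_famComp (i j : Fin n) : ContDiffOn ℝ ∞ (famComp h i j) (ambientDomain D ε) :=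
  (hh.smooth i j).comp contDiff_snd.contDiffOn fun _ hq => hq.2

theorem contDiffOn_famDeriv (i j : Fin n) : ContDiffOn ℝ ∞ (famDeriv h i j) (ambientDomain D ε) :=
  contDiffOn_pd hh.isOpen_ambientDomain _ (hh.contDiffOn_famComp i j)

theorem contDiffOn_famInv (i j : Fin n) : ContDiffOn ℝ ∞ (famInv h i j) (ambientDomain D ε) :=
  contDiffOn_matrix_inv (A := fun q : ℝ × Model n × ℝ => h q.2.2 q.2.1) hh.contDiffOn_famComp
    (fun _ hq => hh.det_ne _ hq.2.2 _ hq.2.1) i j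

theorem contDiffOn_famShape (i j : Fin n) :
    ContDiffOn ℝ ∞ (famShape h i j) (ambientDomain D ε) :=
  ContDiffOn.sum fun l _ => (hh.contDiffOn_famInv i l).mul (hh.contDiffOn_famDeriv l j)

theorem contDiffOn_famChr (k i j : Fin n) :
    ContDiffOn ℝ ∞ (famChr h k i j) (ambientDomain D ε) := by
  have hp := fun a i j => contDiffOn_pd (e := ambientFrame n) hh.isOpen_ambientDomain a
    (hh.contDiffOn_famComp i j)
  exact contDiffOn_const.mul (ContDiffOn.sum fun l _ => (hh.contDiffOn_famInv k l).mul
    (((hp _ _ _).add (hp _ _ _)).sub (hp _ _ _)))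

theorem slice {ρ : ℝ} (hρ : ρ ∈ Set.Ioo (-ε) ε) : IsMetricOn (h ρ) D where
  isOpen := hh.isOpen
  smooth i j := (hh.smooth i j).comp (contDiff_prodMk_left ρ).contDiffOn fun _ hp => ⟨hp, hρ⟩
  symm := hh.symm ρ hρ
  det_ne := hh.det_ne ρ hρ

variable {q : ℝ × Model n × ℝ} (hq : q ∈ ambientDomain D ε)
include hq

theorem famChr_eq (k i j : Fin n) :
    famChr h k i j q = christoffel (stdFrame n) (h q.2.2) q.2.1 k i j := by
  have hs : ∀ a b c, pd (ambientFrame n) (idxM a) (famComp h b c) q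
      = pd (stdFrame n) a (fun p => h q.2.2 p b c) q.2.1 := fun a b c =>
    (pd_slice (differentiableAt_of_contDiffOn hh.isOpen_ambientDomain
      (hh.contDiffOn_famComp b c) hq) a).symm
  simp only [famChr, christoffel, hs, famInv]

theorem famInv_mul (a c : Fin n) :
    ∑ b, famInv h a b q * famComp h b c q = if a = c then 1 else 0 :=
  (hh.slice hq.2.2).inv_mul hq.2.1 a c

theorem mul_famInv (a c : Fin n) :
    ∑ b, famComp h a b q * famInv h b c q = if a = c then 1 else 0 :=
  (hh.slice hq.2.2).mul_inv hq.2.1 a c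

theorem famInv_symm (a b : Fin n) : famInv h a b q = famInv h b a q :=
  (hh.slice hq.2.2).inv_symm hq.2.1 a b

theorem famComp_symm (a b : Fin n) : famComp h a b q = famComp h b a q :=
  hh.symm _ hq.2.2 _ hq.2.1 a b

theorem famDeriv_symm (a b : Fin n) : famDeriv h a b q = famDeriv h b a q :=
  pd_congr hh.isOpen_ambientDomain (fun _ hq => hh.famComp_symm hq a b) hq _

theorem famChr_symm (k a b : Fin n) : famChr h k a b q = famChr h k b a q := by
  rw [hh.famChr_eq hq, hh.famChr_eq hq, (hh.slice hq.2.2).christoffel_symm hq.2.1]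

theorem pd_famComp (a b c : Fin n) : pd (ambientFrame n) (idxM a) (famComp h b c) q
    = ∑ d, famChr h d a b q * famComp h d c q + ∑ d, famChr h d a c q * famComp h b d q := by
  have := (hh.slice hq.2.2).pd_eq_christoffel (e := stdFrame n) hq.2.1 a b c
  simp only [hh.famChr_eq hq]
  exact (pd_slice (differentiableAt_of_contDiffOn hh.isOpen_ambientDomain
      (hh.contDiffOn_famComp b c) hq) a).symm.trans this

theorem pd_zero_famComp (b c : Fin n) : pd (ambientFrame n) idxZero (famComp h b c) q = 0 :=
  pd_zero_of_snd (F := fun z => h z.2 z.1 b c)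
    (differentiableAt_of_contDiffOn hh.isOpen_ambientDomain (hh.contDiffOn_famComp b c) hq)

theorem sum_famComp_mul_famShape (i j : Fin n) :
    ∑ k, famShape h k j q * famComp h k i q = famDeriv h i j q := by
  simp only [famShape, Finset.sum_mul]
  rw [Finset.sum_comm]
  have : ∀ l, ∑ k, famInv h k l q * famDeriv h l j q * famComp h k i q
      = famDeriv h l j q * if l = i then 1 else 0 := fun l => by
    rw [← hh.famInv_mul hq l i, Finset.mul_sum]
    exact Finset.sum_congr rfl fun k _ => by rw [hh.famInv_symm hq k l]; ring
  simp [this]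

theorem ambientComponents_mul_ambInv :
    ambientComponents h q * Matrix.of (ambInv h q) = 1 := by
  have ht : q.1 ≠ 0 := (ne_of_gt hq.1 : _)
  ext A B
  rw [Matrix.mul_apply, sum_ambient]
  have key := hh.mul_famInv hq
  rcases A with _ | i | _ <;> rcases B with _ | j | _ <;>
    simp [ambientComponents, ambInv, Matrix.one_apply, ht]
  case inr.inl.inr.inl =>
    refine Eq.trans (Finset.sum_congr rfl fun k _ => ?_) (key i j)
    simp only [famComp]
    field_simp
  all_goals field_simp
  all_goals try ring

omit hq in
theorem isMetricOn : IsMetricOn (ambientComponents h) (ambientDomain D ε) where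
  isOpen := hh.isOpen_ambientDomain
  smooth A B := by
    have h1 := contDiff_t (n := n).contDiffOn (s := ambientDomain D ε)
    have h2 := contDiff_rho (n := n).contDiffOn (s := ambientDomain D ε)
    rcases A with _ | i | _ <;> rcases B with _ | j | _
    · exact contDiffOn_const.mul h2
    · exact contDiffOn_const
    · exact h1
    · exact contDiffOn_const
    · exact (h1.pow 2).mul (hh.contDiffOn_famComp i j)
    · exact contDiffOn_const
    · exact h1
    · exact contDiffOn_const
    · exact contDiffOn_const
  symm q hq A B := by
    rcases A with _ | i | _ <;> rcases B with _ | j | _ <;> try rfl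
    exact congrArg (q.1 ^ 2 * ·) (hh.famComp_symm hq i j)
  det_ne q hq := Matrix.det_ne_zero_of_right_inverse (hh.ambientComponents_mul_ambInv hq)

theorem inv_ambientComponents (A B : AmbientIndex n) :
    inv (ambientComponents h) q A B = ambInv h q A B :=
  congrFun (congrFun (Matrix.inv_eq_right_inv (hh.ambientComponents_mul_ambInv hq)) A) B

theorem pd_ambientComponents (A : AmbientIndex n) (i j : Fin n) :
    pd (ambientFrame n) A (fun q => q.1 ^ 2 * famComp h i j q) q
      = 2 * q.1 * (ambientFrame n A).1 * famComp h i j q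
        + q.1 ^ 2 * pd (ambientFrame n) A (famComp h i j) q := by
  have d1 : DifferentiableAt ℝ (fun q : ℝ × Model n × ℝ => q.1) q := differentiableAt_fst
  have d2 := differentiableAt_of_contDiffOn hh.isOpen_ambientDomain
    (hh.contDiffOn_famComp i j) hq
  rw [pd_mul (d1.fun_pow 2) d2]
  simp only [pow_two]
  rw [pd_mul d1 d1, pd_t]
  ring

/-- The table `ambChr` is verified rather than derived: it is symmetric and makes the ambient metric
parallel, so it is the Levi-Civita connection by uniqueness. -/
theorem christoffel_ambientComponents (C A B : AmbientIndex n) :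
    christoffel (ambientFrame n) (ambientComponents h) q C A B = ambChr h C A B q := by
  have ht : q.1 ≠ 0 := (ne_of_gt hq.1 : _)
  refine hh.isMetricOn.christoffel_unique hq (C := fun C A B => ambChr h C A B q) ?_ ?_ C A B
  · intro C A B
    rcases C with _ | k | _ <;> rcases A with _ | i | _ <;> rcases B with _ | j | _ <;> try rfl
    · simp only [ambChr, hh.famDeriv_symm hq i j]
    · simp only [ambChr, hh.famChr_symm hq k i j]
    · simp only [ambChr, hh.famDeriv_symm hq i j, hh.famComp_symm hq i j]
  · intro A B C
    have hd2 : pd (ambientFrame n) A (fun q => 2 * q.2.2) q = 2 * (ambientFrame n A).2.2 := by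
      rw [pd_const_mul (by fun_prop), pd_rho]
    have hS : ∀ i j, ∑ x, 2⁻¹ * famShape h x j q * (q.1 ^ 2 * famComp h x i q)
        = 2⁻¹ * q.1 ^ 2 * famDeriv h i j q := fun i j => by
      rw [← hh.sum_famComp_mul_famShape hq, Finset.mul_sum]
      exact Finset.sum_congr rfl fun _ _ => by ring
    have hS' : ∀ i j, ∑ x, 2⁻¹ * famShape h x j q * (q.1 ^ 2 * famComp h i x q)
        = 2⁻¹ * q.1 ^ 2 * famDeriv h i j q := fun i j => by
      rw [← hS]
      exact Finset.sum_congr rfl fun _ _ => by rw [hh.famComp_symm hq]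
    have hs := fun i j => show h q.2.2 q.2.1 i j = h q.2.2 q.2.1 j i from hh.famComp_symm hq i j
    simp only [sum_ambient]
    rcases B with _ | j | _ <;> rcases C with _ | k | _
    · simp only [ambientComponents, Matrix.of_apply, hd2]
      rcases A with _ | i | _ <;> simp [ambChr, ambientFrame]; field_simp; ring
    · simp only [ambientComponents, Matrix.of_apply, pd_const]
      rcases A with _ | i | _ <;> simp [ambChr]
      field_simp
      simp only [famComp]
      ring
    · simp only [ambientComponents, Matrix.of_apply, pd_t]
      rcases A with _ | i | _ <;> simp [ambChr, ambientFrame, ht]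
    · simp only [ambientComponents, Matrix.of_apply, pd_const]
      rcases A with _ | i | _ <;> simp [ambChr]
      rw [hs j i]
      simp only [famComp]
      field_simp
      ring
    · refine (hh.pd_ambientComponents hq A j k).trans ?_
      rcases A with _ | i | _
      · rw [hh.pd_zero_famComp hq]
        simp [ambientComponents, ambChr, ambientFrame, famComp]
        field_simp
        ring
      · simp [hh.pd_famComp hq, ambientComponents, ambChr, ambientFrame]
        rw [mul_add, Finset.mul_sum, Finset.mul_sum]
        congr 1 <;> refine Finset.sum_congr rfl fun _ _ => ?_ <;> simp only [famComp] <;> ring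
      · simp [ambientComponents, ambChr, ambientFrame]
        have hs1 := hS k j
        have hs2 := hS' j k
        simp only [famComp] at hs1 hs2
        rw [hs1, hs2, hh.famDeriv_symm hq k j]
        simp only [famDeriv]
        ring
    · simp only [ambientComponents, Matrix.of_apply, pd_const]
      rcases A with _ | i | _ <;> simp [ambChr]
      have hs2 := hS' j i
      simp only [famComp] at hs2
      rw [hs2, hh.famDeriv_symm hq i j]
      ring
    · simp only [ambientComponents, Matrix.of_apply, pd_t]
      rcases A with _ | i | _ <;> simp [ambChr, ambientFrame, ht]
    · simp only [ambientComponents, Matrix.of_apply, pd_const]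
      rcases A with _ | i | _ <;> simp [ambChr]
      have hs1 := hS k i
      simp only [famComp] at hs1
      rw [hs1, hh.famDeriv_symm hq i k]
      ring
    · simp only [ambientComponents, Matrix.of_apply, pd_const]
      rcases A with _ | i | _ <;> simp [ambChr]

end IsFamilyOn

end Ambient


/-! ### The curvature of a straight ambient metric. -/

section AmbientCurvature

variable {n : ℕ}

open Classical in
/-- The indicator of the index of `t`. -/
noncomputable def zeroInd (A : AmbientIndex n) : ℝ := if A = idxZero then 1 else 0

variable {h : ℝ → Model n → Matrix (Fin n) (Fin n) ℝ} {D : Set (Model n)} {ε : ℝ}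

/-- The curvature of `g_ρ`, as a function on the ambient space. -/
noncomputable def famRiem (h : ℝ → Model n → Matrix (Fin n) (Fin n) ℝ) (a b c d : Fin n)
    (q : ℝ × Model n × ℝ) : ℝ :=
  pd (ambientFrame n) (idxM b) (famChr h d a c) q - pd (ambientFrame n) (idxM a) (famChr h d b c) q
    + ∑ f, (famChr h f a c q * famChr h d b f q - famChr h f b c q * famChr h d a f q)

/-- This says that the covariant derivative of t∂_t is the identity; the correction term accounts
for the derivative of t itself. The vanishing of the curvature in the direction of t∂_t rests on it.
-/
theorem ambChr_zero_right (C A : AmbientIndex n) (q : ℝ × Model n × ℝ) :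
    ambChr h C A idxZero q = q.1⁻¹ * ((if A = C then 1 else 0) - zeroInd A * zeroInd C) := by
  rcases C with _ | k | _ <;> rcases A with _ | i | _ <;> simp [ambChr, zeroInd, eq_comm]

theorem pd_inv_t {q : ℝ × Model n × ℝ} (ht : q.1 ≠ 0) (A : AmbientIndex n) :
    pd (ambientFrame n) A (fun q => q.1⁻¹) q = -((ambientFrame n A).1 * (q.1⁻¹ * q.1⁻¹)) := by
  have h1 : DifferentiableAt ℝ (fun q : ℝ × Model n × ℝ => q.1) q := differentiableAt_fst
  have h2 : DifferentiableAt ℝ (fun q : ℝ × Model n × ℝ => q.1⁻¹) q := h1.fun_inv ht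
  refine pd_eq_of_hasDerivAt h2 ?_
  have h3 : HasDerivAt (fun s : ℝ => (q + s • ambientFrame n A).1) ((ambientFrame n A).1) 0 := by
    simpa using ((hasDerivAt_id (0 : ℝ)).smul_const (ambientFrame n A).1).const_add q.1
  refine (h3.fun_inv (by simpa using ht)).congr_deriv ?_
  simp only [zero_smul, add_zero]
  field_simp

theorem fst_ambientFrame (A : AmbientIndex n) : (ambientFrame n A).1 = zeroInd A := by
  rcases A with _ | k | _ <;> simp [ambientFrame, zeroInd]

theorem zeroInd_mul (f : AmbientIndex n → ℝ) (A : AmbientIndex n) :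
    zeroInd A * f A = zeroInd A * f idxZero := by
  unfold zeroInd
  split_ifs with hA <;> simp [hA]

theorem sum_ambChr_zero_mul (A : AmbientIndex n) (X : AmbientIndex n → ℝ) (q : ℝ × Model n × ℝ) :
    ∑ f, ambChr h f A idxZero q * X f = q.1⁻¹ * (X A - zeroInd A * X idxZero) := by
  have h1 : ∀ f, ambChr h f A idxZero q * X f
      = q.1⁻¹ * ((if A = f then X f else 0) - zeroInd A * (if f = idxZero then X f else 0)) := by
    intro f
    rw [ambChr_zero_right]
    by_cases hf : f = idxZero <;> by_cases hA : A = f <;> simp [zeroInd, hf, hA]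
  simp only [h1, ← Finset.mul_sum, Finset.sum_sub_distrib]
  simp

namespace IsFamilyOn

variable (hh : IsFamilyOn h D ε)
include hh

theorem contDiffOn_ambChr (C A B : AmbientIndex n) :
    ContDiffOn ℝ ∞ (ambChr h C A B) (ambientDomain D ε) :=
  (hh.isMetricOn.contDiffOn_christoffel (e := ambientFrame n) C A B).congr fun _ hq =>
    (hh.christoffel_ambientComponents hq C A B).symm

theorem contDiffOn_ambInv (A B : AmbientIndex n) :
    ContDiffOn ℝ ∞ (fun q => ambInv h q A B) (ambientDomain D ε) :=
  (hh.isMetricOn.contDiffOn_inv A B).congr fun _ hq =>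
    (hh.inv_ambientComponents hq A B).symm

variable {q : ℝ × Model n × ℝ} (hq : q ∈ ambientDomain D ε)
include hq

theorem riemUp_ambientComponents (a b c d : AmbientIndex n) :
    riemUp (ambientFrame n) (ambientComponents h) q a b c d
      = pd (ambientFrame n) b (ambChr h d a c) q - pd (ambientFrame n) a (ambChr h d b c) q
        + ∑ f, (ambChr h f a c q * ambChr h d b f q - ambChr h f b c q * ambChr h d a f q) := by
  unfold riemUp
  simp only [hh.christoffel_ambientComponents hq,
    fun e c a b => pd_congr (e := ambientFrame n) hh.isOpen_ambientDomain
      (fun q hq => hh.christoffel_ambientComponents hq c a b) hq e]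

theorem ambChr_symm (c a b : AmbientIndex n) : ambChr h c a b q = ambChr h c b a q := by
  simp only [← hh.christoffel_ambientComponents hq, hh.isMetricOn.christoffel_symm hq c a b]

theorem ambChr_zero_left (C A : AmbientIndex n) :
    ambChr h C idxZero A q = q.1⁻¹ * ((if A = C then 1 else 0) - zeroInd A * zeroInd C) := by
  rw [hh.ambChr_symm hq, ambChr_zero_right]

omit hh in
theorem pd_ambChr_zero_right (E C A : AmbientIndex n) :
    pd (ambientFrame n) E (ambChr h C A idxZero) q
      = -(zeroInd E * (q.1⁻¹ * ambChr h C A idxZero q)) := by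
  have ht : q.1 ≠ 0 := (ne_of_gt hq.1 : _)
  have : ambChr h C A idxZero = fun q => ((if A = C then 1 else 0) - zeroInd A * zeroInd C) * q.1⁻¹ :=
    funext fun q => by rw [ambChr_zero_right, mul_comm]
  rw [this, pd_const_mul (DifferentiableAt.fun_inv differentiableAt_fst ht), pd_inv_t ht,
    fst_ambientFrame]
  ring

theorem pd_ambChr_zero_left (E C A : AmbientIndex n) :
    pd (ambientFrame n) E (ambChr h C idxZero A) q
      = -(zeroInd E * (q.1⁻¹ * ambChr h C idxZero A q)) := by
  rw [hh.ambChr_symm hq, ← pd_ambChr_zero_right hq]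
  exact pd_congr hh.isOpen_ambientDomain (fun q hq => hh.ambChr_symm hq _ _ _) hq _

theorem pd_zero_famDeriv (b c : Fin n) : pd (ambientFrame n) idxZero (famDeriv h b c) q = 0 := by
  unfold famDeriv
  rw [pd_comm hh.isOpen_ambientDomain (hh.contDiffOn_famComp b c) hq]
  rw [pd_congr hh.isOpen_ambientDomain (g := fun _ => 0)
    (fun q hq => hh.pd_zero_famComp hq b c) hq, pd_const]

theorem pd_zero_famInv (b c : Fin n) : pd (ambientFrame n) idxZero (famInv h b c) q = 0 :=
  pd_zero_of_snd (F := fun z => inv (h z.2) z.1 b c)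
    (differentiableAt_of_contDiffOn hh.isOpen_ambientDomain (hh.contDiffOn_famInv b c) hq)

theorem pd_zero_famShape (b c : Fin n) : pd (ambientFrame n) idxZero (famShape h b c) q = 0 := by
  have hU := hh.isOpen_ambientDomain
  have d1 := fun i j => differentiableAt_of_contDiffOn hU (hh.contDiffOn_famInv i j) hq
  have d2 := fun i j => differentiableAt_of_contDiffOn hU (hh.contDiffOn_famDeriv i j) hq
  unfold famShape
  rw [pd_sum fun l _ => (d1 b l).fun_mul (d2 l c)]
  refine Finset.sum_eq_zero fun l _ => ?_
  rw [pd_mul (d1 b l) (d2 l c), hh.pd_zero_famInv hq, hh.pd_zero_famDeriv hq]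
  ring

theorem pd_zero_famChr (k b c : Fin n) : pd (ambientFrame n) idxZero (famChr h k b c) q = 0 := by
  have hU := hh.isOpen_ambientDomain
  have : Set.EqOn (famChr h k b c) (fun q => (fun z : Model n × ℝ =>
      christoffel (stdFrame n) (h z.2) z.1 k b c) q.2) (ambientDomain D ε) := fun q hq =>
    hh.famChr_eq hq k b c
  rw [pd_congr hU this hq]
  exact pd_zero_of_snd (differentiableAt_of_contDiffOn hU
    ((hh.contDiffOn_famChr k b c).congr fun q hq => (this hq).symm) hq)

/-- Homogeneity: the metric scales with weight two under dilations of t, so each Christoffel symbol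
is a power of t whose exponent counts the indices t, upper ones positively and lower ones
negatively. -/
theorem pd_zero_ambChr (C A B : AmbientIndex n) :
    pd (ambientFrame n) idxZero (ambChr h C A B) q
      = (zeroInd C - zeroInd A - zeroInd B) * (q.1⁻¹ * ambChr h C A B q) := by
  have ht : q.1 ≠ 0 := (ne_of_gt hq.1 : _)
  have hU := hh.isOpen_ambientDomain
  have dS := fun i j => differentiableAt_of_contDiffOn hU (hh.contDiffOn_famShape i j) hq
  have dD := fun i j => differentiableAt_of_contDiffOn hU (hh.contDiffOn_famDeriv i j) hq
  have dC := fun i j => differentiableAt_of_contDiffOn hU (hh.contDiffOn_famComp i j) hq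
  have dt : DifferentiableAt ℝ (fun q : ℝ × Model n × ℝ => q.1) q := differentiableAt_fst
  have dr : DifferentiableAt ℝ (fun q : ℝ × Model n × ℝ => q.2.2) q :=
    (contDiff_rho.differentiable (by simp)).differentiableAt
  have hz : (ambientFrame n idxZero).2.2 = 0 := rfl
  have hz' : (ambientFrame n idxZero).1 = 1 := rfl
  have hsh : ∀ i j, pd (ambientFrame n) idxZero (fun q => 1 / 2 * famShape h i j q) q = 0 :=
    fun i j => by rw [pd_const_mul (dS i j), hh.pd_zero_famShape hq, mul_zero]
  rcases C with _ | k | _ <;> rcases A with _ | i | _ <;> rcases B with _ | j | _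
  case inl.inr.inl.inr.inl =>
    simp only [ambChr]
    rw [pd_mul (dt.const_mul _) (dD i j), pd_const_mul dt, pd_t, hh.pd_zero_famDeriv hq, hz']
    simp [zeroInd]
    field_simp
  case inr.inl.inr.inl.inr.inl =>
    simp only [ambChr]
    rw [hh.pd_zero_famChr hq]
    simp [zeroInd]
  case inr.inr.inr.inl.inr.inl =>
    simp only [ambChr]
    rw [pd_sub (dr.fun_mul (dD i j)) (dC i j), pd_mul dr (dD i j), pd_rho, hz,
      hh.pd_zero_famDeriv hq, hh.pd_zero_famComp hq]
    simp [zeroInd]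
  all_goals first
    | (simp only [ambChr]; rw [pd_const]; simp [zeroInd])
    | (simp only [ambChr]; rw [hsh]; simp [zeroInd])
    | (rw [hh.pd_ambChr_zero_left hq]; simp [zeroInd])
    | (rw [pd_ambChr_zero_right hq]; simp [zeroInd])

/-- The homothety `t ∂_t` is in the kernel of the curvature, third index. -/
theorem riemUp_third_zero (a b d : AmbientIndex n) :
    riemUp (ambientFrame n) (ambientComponents h) q a b idxZero d = 0 := by
  rw [hh.riemUp_ambientComponents hq, pd_ambChr_zero_right hq, pd_ambChr_zero_right hq,
    Finset.sum_sub_distrib, sum_ambChr_zero_mul, sum_ambChr_zero_mul, hh.ambChr_symm hq d a b]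
  ring

/-- The homothety `t ∂_t` is in the kernel of the curvature, first index. -/
theorem riemUp_first_zero (b c d : AmbientIndex n) :
    riemUp (ambientFrame n) (ambientComponents h) q idxZero b c d = 0 := by
  rw [hh.riemUp_ambientComponents hq, hh.pd_ambChr_zero_left hq, hh.pd_zero_ambChr hq,
    Finset.sum_sub_distrib]
  have h1 : ∑ f, ambChr h f idxZero c q * ambChr h d b f q
      = q.1⁻¹ * (ambChr h d b c q - zeroInd c * ambChr h d b idxZero q) := by
    rw [← sum_ambChr_zero_mul c (fun f => ambChr h d b f q)]
    exact Finset.sum_congr rfl fun f _ => by rw [hh.ambChr_symm hq f]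
  have h2 : ∑ f, ambChr h f b c q * ambChr h d idxZero f q
      = q.1⁻¹ * (ambChr h d b c q - zeroInd d * ambChr h idxZero b c q) := by
    have h3 : ∀ f, ambChr h f b c q * ambChr h d idxZero f q
        = q.1⁻¹ * ((if f = d then ambChr h f b c q else 0)
          - zeroInd d * (if f = idxZero then ambChr h f b c q else 0)) := by
      intro f
      rw [hh.ambChr_zero_left hq]
      unfold zeroInd
      split_ifs <;> ring
    simp only [h3, ← Finset.mul_sum, Finset.sum_sub_distrib]
    simp
  rw [h1, h2]
  linear_combination -q.1⁻¹ * (zeroInd_mul (fun x => ambChr h d x c q) b).symm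
    - q.1⁻¹ * (zeroInd_mul (fun x => ambChr h d b x q) c).symm
    + q.1⁻¹ * (zeroInd_mul (fun x => ambChr h x b c q) d).symm

theorem riemUp_second_zero (a c d : AmbientIndex n) :
    riemUp (ambientFrame n) (ambientComponents h) q a idxZero c d = 0 := by
  rw [riemUp_antisymm, hh.riemUp_first_zero hq, neg_zero]

theorem riemUp_tangential (a b c d : Fin n) :
    riemUp (ambientFrame n) (ambientComponents h) q (idxM a) (idxM b) (idxM c) (idxM d)
      = famRiem h a b c d q
        + (ambChr h idxZero (idxM a) (idxM c) q * ambChr h (idxM d) (idxM b) idxZero q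
          + ambChr h idxInf (idxM a) (idxM c) q * ambChr h (idxM d) (idxM b) idxInf q
          - ambChr h idxZero (idxM b) (idxM c) q * ambChr h (idxM d) (idxM a) idxZero q
          - ambChr h idxInf (idxM b) (idxM c) q * ambChr h (idxM d) (idxM a) idxInf q) := by
  rw [hh.riemUp_ambientComponents hq, sum_ambient]
  simp only [famRiem, ambChr]
  ring

/-- In the tangential Ricci tensor this is the only component that contains a second ρ-derivative of
g_ρ. The factor ρ in front of it makes the Ricci equation singular at ρ = 0. -/
theorem riemUp_inf_inf (i j : Fin n) :
    riemUp (ambientFrame n) (ambientComponents h) q (idxM i) idxInf (idxM j) idxInf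
      = q.2.2 * (pd (ambientFrame n) idxInf (famDeriv h i j) q
        - (1 / 2) * ∑ k, famShape h k j q * famDeriv h k i q) := by
  have hU := hh.isOpen_ambientDomain
  have dD := fun i j => differentiableAt_of_contDiffOn hU (hh.contDiffOn_famDeriv i j) hq
  have dC := fun i j => differentiableAt_of_contDiffOn hU (hh.contDiffOn_famComp i j) hq
  have dr : DifferentiableAt ℝ (fun q : ℝ × Model n × ℝ => q.2.2) q :=
    (contDiff_rho.differentiable (by simp)).differentiableAt
  rw [hh.riemUp_ambientComponents hq, sum_ambient]
  simp only [ambChr]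
  rw [pd_sub (dr.fun_mul (dD i j)) (dC i j), pd_mul dr (dD i j), pd_rho, pd_const]
  have hz : (ambientFrame n idxInf).2.2 = 1 := rfl
  have h1 : ∑ k, 1 / 2 * famShape h k j q * (q.2.2 * famDeriv h i k q - famComp h i k q)
      = (1 / 2) * (q.2.2 * ∑ k, famShape h k j q * famDeriv h k i q) - (1 / 2) * famDeriv h i j q := by
    rw [← hh.sum_famComp_mul_famShape hq i j, Finset.mul_sum, Finset.mul_sum, Finset.mul_sum,
      ← Finset.sum_sub_distrib]
    refine Finset.sum_congr rfl fun k _ => ?_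
    rw [hh.famDeriv_symm hq k i, hh.famComp_symm hq k i]
    ring
  rw [Finset.sum_sub_distrib, h1]
  simp only [hz, famDeriv, mul_zero, Finset.sum_const_zero]
  have ht : q.1 ≠ 0 := (ne_of_gt hq.1 : _)
  field_simp
  ring

/-- The tangential part of the Ricci tensor of the ambient metric. -/
theorem ricci_tangential (i j : Fin n) :
    ricci (ambientFrame n) (ambientComponents h) q (idxM i) (idxM j)
      = q.2.2 * pd (ambientFrame n) idxInf (famDeriv h i j) q
        - ((n : ℝ) / 2 - 1) * famDeriv h i j q
        - (1 / 2) * (∑ k, famShape h k k q) * famComp h i j q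
        + ∑ k, famRiem h i k j k q
        + q.2.2 * ((1 / 2) * (∑ k, famShape h k k q) * famDeriv h i j q
          - (1 / 2) * ∑ k, famShape h k j q * famDeriv h k i q
          - (1 / 2) * ∑ k, famShape h k i q * famDeriv h k j q) := by
  have ht : q.1 ≠ 0 := (ne_of_gt hq.1 : _)
  unfold ricci
  rw [sum_ambient, hh.riemUp_second_zero hq, hh.riemUp_inf_inf hq]
  simp only [hh.riemUp_tangential hq, ambChr]
  have h1 : ∀ k, famRiem h i k j k q + (-(1 / 2) * q.1 * famDeriv h i j q
        * (if True then q.1⁻¹ else 0)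
        + (q.2.2 * famDeriv h i j q - famComp h i j q) * (1 / 2 * famShape h k k q)
        - -(1 / 2) * q.1 * famDeriv h k j q * (if k = i then q.1⁻¹ else 0)
        - (q.2.2 * famDeriv h k j q - famComp h k j q) * (1 / 2 * famShape h k i q))
      = famRiem h i k j k q - (1 / 2) * famDeriv h i j q
        + (1 / 2) * (q.2.2 * famDeriv h i j q - famComp h i j q) * famShape h k k q
        + (if k = i then (1 / 2) * famDeriv h k j q else 0)
        - (1 / 2) * q.2.2 * (famShape h k i q * famDeriv h k j q)
        + (1 / 2) * (famShape h k i q * famComp h k j q) := by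
    intro k
    by_cases hk : k = i
    · simp only [hk, if_true]
      field_simp
      ring
    · simp only [hk, if_true, if_false]
      field_simp
      ring
  simp only [h1]
  simp only [Finset.sum_sub_distrib, Finset.sum_add_distrib, ← Finset.mul_sum,
    hh.sum_famComp_mul_famShape hq, Finset.sum_ite_eq', Finset.mem_univ, if_true,
    Finset.sum_const, Finset.card_univ, Fintype.card_fin, nsmul_eq_mul, hh.famDeriv_symm hq j i]
  ring

end IsFamilyOn

end AmbientCurvature


theorem CongrTo.of_vanishesTo {n : ℕ} {Ω : Set (ℝ × Model n × ℝ)} (hΩ : IsOpen Ω) {k : ℕ}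
    {f : ℝ × Model n × ℝ → ℝ} (hf : ContDiffOn ℝ ∞ f Ω) (h : VanishesTo Ω k f) :
    CongrTo Ω k f (fun _ => 0) :=
  ⟨hf, contDiffOn_const, h.congr hΩ fun _ _ => (sub_zero _).symm⟩

/-! ### Order-by-order uniqueness of the family g_ρ. -/

section FamilyCongruence

variable {n : ℕ} {h h0 : ℝ → Model n → Matrix (Fin n) (Fin n) ℝ} {D : Set (Model n)} {ε : ℝ}
  {k : ℕ}

namespace IsFamilyOn

variable (hh : IsFamilyOn h D ε) (hh0 : IsFamilyOn h0 D ε)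
include hh hh0

/-- The product h⁻¹ h h0⁻¹ equals h0⁻¹, while h⁻¹ h0 h0⁻¹ equals h⁻¹, and the two products differ
only in the middle factor. -/
theorem congrTo_famInv
    (hk : ∀ i j, CongrTo (ambientDomain D ε) k (famComp h i j) (famComp h0 i j)) (i j : Fin n) :
    CongrTo (ambientDomain D ε) k (famInv h i j) (famInv h0 i j) := by
  have hΩ := hh.isOpen_ambientDomain
  have h1 : CongrTo (ambientDomain D ε) k
      (fun q => ∑ a, ∑ b, famInv h i a q * (famInv h0 b j q * famComp h a b q))
      (fun q => ∑ a, ∑ b, famInv h i a q * (famInv h0 b j q * famComp h0 a b q)) :=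
    .sum hΩ _ fun a => .sum hΩ _ fun b => (CongrTo.refl hΩ (hh.contDiffOn_famInv i a)).mul hΩ
      ((CongrTo.refl hΩ (hh0.contDiffOn_famInv b j)).mul hΩ (hk a b))
  refine (h1.congr hΩ (fun q hq => ?_) (fun q hq => ?_)).symm hΩ
  · rw [Finset.sum_comm]
    have : ∀ b, ∑ a, famInv h i a q * (famInv h0 b j q * famComp h a b q)
        = famInv h0 b j q * if i = b then 1 else 0 := fun b => by
      rw [← hh.famInv_mul hq, Finset.mul_sum]
      exact Finset.sum_congr rfl fun _ _ => by ring
    simp [this]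
  · have : ∀ a, ∑ b, famInv h i a q * (famInv h0 b j q * famComp h0 a b q)
        = famInv h i a q * if a = j then 1 else 0 := fun a => by
      rw [← hh0.mul_famInv hq, Finset.mul_sum]
      exact Finset.sum_congr rfl fun _ _ => by ring
    simp [this]

/-- Only derivatives along M occur, so no order is lost; the same holds for the slice curvature in
`congrTo_famRiem`. -/
theorem congrTo_famChr
    (hk : ∀ i j, CongrTo (ambientDomain D ε) k (famComp h i j) (famComp h0 i j)) (c i j : Fin n) :
    CongrTo (ambientDomain D ε) k (famChr h c i j) (famChr h0 c i j) := by
  have hΩ := hh.isOpen_ambientDomain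
  have hp := fun a i j => (hk i j).pd_tangential hΩ (A := idxM a) (by simp)
  exact .const_mul hΩ _ (.sum hΩ _ fun l => (hh.congrTo_famInv hh0 hk c l).mul hΩ
    (((hp _ _ _).add hΩ (hp _ _ _)).sub hΩ (hp _ _ _)))

omit hh0 in
theorem congrTo_famDeriv
    (hk : ∀ i j, CongrTo (ambientDomain D ε) (k + 1) (famComp h i j) (famComp h0 i j))
    (i j : Fin n) :
    CongrTo (ambientDomain D ε) k (famDeriv h i j) (famDeriv h0 i j) :=
  (hk i j).pd_inf hh.isOpen_ambientDomain

theorem congrTo_famShape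
    (hk : ∀ i j, CongrTo (ambientDomain D ε) (k + 1) (famComp h i j) (famComp h0 i j))
    (i j : Fin n) :
    CongrTo (ambientDomain D ε) k (famShape h i j) (famShape h0 i j) :=
  have hΩ := hh.isOpen_ambientDomain
  .sum hΩ _ fun _ => ((hh.congrTo_famInv hh0 hk _ _).mono k.le_succ).mul hΩ
    (hh.congrTo_famDeriv hk _ _)

theorem congrTo_famRiem
    (hk : ∀ i j, CongrTo (ambientDomain D ε) k (famComp h i j) (famComp h0 i j))
    (a b c d : Fin n) :
    CongrTo (ambientDomain D ε) k (famRiem h a b c d) (famRiem h0 a b c d) := by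
  have hΩ := hh.isOpen_ambientDomain
  have hC := hh.congrTo_famChr hh0 hk
  exact (((hC _ _ _).pd_tangential hΩ (by simp)).sub hΩ
    ((hC _ _ _).pd_tangential hΩ (by simp))).add hΩ
    (.sum hΩ _ fun f => ((hC _ _ _).mul hΩ (hC _ _ _)).sub hΩ ((hC _ _ _).mul hΩ (hC _ _ _)))

/-- The improvement of the order of agreement of two families whose ambient metrics have tangential
Ricci tensors agreeing to the corresponding order. -/
theorem congrTo_succ
    (hk : ∀ i j, CongrTo (ambientDomain D ε) (k + 1) (famComp h i j) (famComp h0 i j))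
    (hR : ∀ i j : Fin n, CongrTo (ambientDomain D ε) (k + 1)
      (fun q => ricci (ambientFrame n) (ambientComponents h) q (idxM i) (idxM j))
      (fun q => ricci (ambientFrame n) (ambientComponents h0) q (idxM i) (idxM j)))
    (hn : (k : ℝ) + 1 < n / 2) (i j : Fin n) :
    CongrTo (ambientDomain D ε) (k + 2) (famComp h i j) (famComp h0 i j) := by
  have hΩ := hh.isOpen_ambientDomain
  have hInv := hh.congrTo_famInv hh0 hk
  have hD := hh.congrTo_famDeriv hk
  have hS := hh.congrTo_famShape hh0 hk
  have rD := fun i j => CongrTo.refl (k := k + 1) hΩ (hh.contDiffOn_famDeriv i j)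
  have rD0 := fun i j => CongrTo.refl (k := k + 1) hΩ (hh0.contDiffOn_famDeriv i j)
  have rI0 := fun i j => CongrTo.refl (k := k + 1) hΩ (hh0.contDiffOn_famInv i j)
  have rC0 := fun i j => CongrTo.refl (k := k + 1) hΩ (hh0.contDiffOn_famComp i j)
  -- the remainder in the formula for the Ricci tensor
  have hrest : ∀ i j, CongrTo (ambientDomain D ε) (k + 1)
      (fun q => ∑ k, famRiem h i k j k q
        + q.2.2 * ((1 / 2) * (∑ k, famShape h k k q) * famDeriv h i j q
          - (1 / 2) * ∑ k, famShape h k j q * famDeriv h k i q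
          - (1 / 2) * ∑ k, famShape h k i q * famDeriv h k j q))
      (fun q => ∑ k, famRiem h0 i k j k q
        + q.2.2 * ((1 / 2) * (∑ k, famShape h0 k k q) * famDeriv h0 i j q
          - (1 / 2) * ∑ k, famShape h0 k j q * famDeriv h0 k i q
          - (1 / 2) * ∑ k, famShape h0 k i q * famDeriv h0 k j q)) := fun i j =>
    (CongrTo.sum hΩ _ fun _ => hh.congrTo_famRiem hh0 hk _ _ _ _).add hΩ
      (.rho_mul hΩ ((((CongrTo.const_mul hΩ _ (.sum hΩ _ fun _ => hS _ _)).mul hΩ (hD _ _)).sub hΩ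
        (.const_mul hΩ _ (.sum hΩ _ fun _ => (hS _ _).mul hΩ (hD _ _)))).sub hΩ
        (.const_mul hΩ _ (.sum hΩ _ fun _ => (hS _ _).mul hΩ (hD _ _)))))
  -- the trace terms
  have htr : ∀ i j, CongrTo (ambientDomain D ε) (k + 1)
      (fun q => (∑ k, famShape h k k q) * famComp h i j q)
      (fun q => (∑ k, ∑ l, famInv h0 k l q * famDeriv h l k q) * famComp h0 i j q) := fun i j =>
    (CongrTo.sum hΩ _ fun _ => .sum hΩ _ fun _ => (hInv _ _).mul hΩ (rD _ _)).mul hΩ (hk i j)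
  -- The leading part of the Ricci formula. In the trace term the undifferentiated factors of h have
  -- been replaced by those of h0, so this part is linear in the ρ-derivatives of h.
  have hA : ∀ i j, CongrTo (ambientDomain D ε) (k + 1)
      (fun q => q.2.2 * pd (ambientFrame n) idxInf (famDeriv h i j) q
        - ((n : ℝ) / 2 - 1) * famDeriv h i j q
        - (1 / 2) * ((∑ k, ∑ l, famInv h0 k l q * famDeriv h l k q) * famComp h0 i j q))
      (fun q => q.2.2 * pd (ambientFrame n) idxInf (famDeriv h0 i j) q
        - ((n : ℝ) / 2 - 1) * famDeriv h0 i j q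
        - (1 / 2) * ((∑ k, ∑ l, famInv h0 k l q * famDeriv h0 l k q) * famComp h0 i j q)) := by
    intro i j
    have h1 := (((hR i j).sub hΩ (hrest i j)).add hΩ ((htr i j).const_mul hΩ (1 / 2))).sub hΩ
      ((CongrTo.refl hΩ (htr i j).right).const_mul hΩ (1 / 2))
    refine h1.congr hΩ (fun q hq => ?_) (fun q hq => ?_)
    · simp only [hh.ricci_tangential hq]; ring
    · simp only [hh0.ricci_tangential hq, famShape]; ring
  -- On a function of order ρ^{k+1} the operator ρ∂_ρ² - k∂_ρ annihilates the leading term. It is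
  -- used to trade the second derivative for k times the first.
  have hB : ∀ i j, CongrTo (ambientDomain D ε) (k + 1)
      (fun q => q.2.2 * pd (ambientFrame n) idxInf (famDeriv h i j) q - (k : ℝ) * famDeriv h i j q)
      (fun q => q.2.2 * pd (ambientFrame n) idxInf (famDeriv h0 i j) q
        - (k : ℝ) * famDeriv h0 i j q) := by
    intro i j
    have hd1 := contDiffOn_pd (e := ambientFrame n) hΩ idxInf (hh.contDiffOn_famDeriv i j)
    have hd2 := contDiffOn_pd (e := ambientFrame n) hΩ idxInf (hh0.contDiffOn_famDeriv i j)
    refine ⟨(contDiff_rho.contDiffOn.mul hd1).sub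
        (contDiffOn_const.mul (hh.contDiffOn_famDeriv i j)),
      (contDiff_rho.contDiffOn.mul hd2).sub
        (contDiffOn_const.mul (hh0.contDiffOn_famDeriv i j)),
      ((hk i j).van.rho_pd_pd hΩ ((hk i j).left.sub (hk i j).right)).congr hΩ fun q hq => ?_⟩
    have e1 : Set.EqOn (pd (ambientFrame n) idxInf fun q => famComp h i j q - famComp h0 i j q)
        (fun q => famDeriv h i j q - famDeriv h0 i j q) (ambientDomain D ε) := fun q hq =>
      pd_sub (differentiableAt_of_contDiffOn hΩ (hh.contDiffOn_famComp i j) hq)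
        (differentiableAt_of_contDiffOn hΩ (hh0.contDiffOn_famComp i j) hq) _
    have e2 := pd_congr (e := ambientFrame n) hΩ e1 hq idxInf
    rw [pd_sub (differentiableAt_of_contDiffOn hΩ (hh.contDiffOn_famDeriv i j) hq)
        (differentiableAt_of_contDiffOn hΩ (hh0.contDiffOn_famDeriv i j) hq)] at e2
    simp only [e2, e1 hq]
    push_cast
    ring
  -- The difference of the two: an algebraic equation for ∂_ρ h, with indicial coefficient k + 1 -
  -- n/2 and a trace part.
  have hE : ∀ i j, CongrTo (ambientDomain D ε) (k + 1)
      (fun q => ((k : ℝ) + 1 - n / 2) * famDeriv h i j q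
        - (1 / 2) * ((∑ k, ∑ l, famInv h0 k l q * famDeriv h l k q) * famComp h0 i j q))
      (fun q => ((k : ℝ) + 1 - n / 2) * famDeriv h0 i j q
        - (1 / 2) * ((∑ k, ∑ l, famInv h0 k l q * famDeriv h0 l k q) * famComp h0 i j q)) :=
    fun i j => ((hA i j).sub hΩ (hB i j)).congr hΩ (fun q _ => by ring)
      (fun q _ => by ring)
  -- First the trace. Tracing the algebraic equation with h0 subtracts another n/2, so its
  -- coefficient is k + 1 - n, which is nonzero since k + 1 < n/2.
  have htau : CongrTo (ambientDomain D ε) (k + 1)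
      (fun q => ∑ k, ∑ l, famInv h0 k l q * famDeriv h l k q)
      (fun q => ∑ k, ∑ l, famInv h0 k l q * famDeriv h0 l k q) := by
    have h1 := CongrTo.const_mul hΩ ((k : ℝ) + 1 - n)⁻¹ (CongrTo.sum hΩ Finset.univ fun i =>
      CongrTo.sum hΩ Finset.univ fun j => (rI0 i j).mul hΩ (hE j i))
    have hne : (k : ℝ) + 1 - n ≠ 0 := by
      have : (0 : ℝ) ≤ n := n.cast_nonneg
      linarith
    have key : ∀ (T : Fin n → Fin n → ℝ) (q), q ∈ ambientDomain D ε →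
        ((k : ℝ) + 1 - n)⁻¹ * ∑ i, ∑ j, famInv h0 i j q * (((k : ℝ) + 1 - n / 2) * T j i
          - 1 / 2 * ((∑ k, ∑ l, famInv h0 k l q * T l k) * famComp h0 j i q))
        = ∑ k, ∑ l, famInv h0 k l q * T l k := by
      intro T q hq
      have h2 : ∀ i, ∑ j, famInv h0 i j q * (((k : ℝ) + 1 - n / 2) * T j i
          - 1 / 2 * ((∑ k, ∑ l, famInv h0 k l q * T l k) * famComp h0 j i q))
          = ((k : ℝ) + 1 - n / 2) * ∑ j, famInv h0 i j q * T j i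
            - 1 / 2 * (∑ k, ∑ l, famInv h0 k l q * T l k) * 1 := by
        intro i
        have h3 := hh0.famInv_mul hq i i
        rw [if_pos rfl] at h3
        rw [← h3, Finset.mul_sum, Finset.mul_sum, ← Finset.sum_sub_distrib]
        exact Finset.sum_congr rfl fun j _ => by ring
      simp only [h2, Finset.sum_sub_distrib, ← Finset.mul_sum, Finset.sum_const, Finset.card_univ,
        Fintype.card_fin, nsmul_eq_mul]
      field_simp
      ring
    exact h1.congr hΩ (fun q hq => key (fun i j => famDeriv h i j q) q hq)
      (fun q hq => key (fun i j => famDeriv h0 i j q) q hq)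
  -- With the trace known, the full derivative follows on dividing by k + 1 - n/2. This is where the
  -- bound on k enters; the procedure would break down at k + 1 = n/2.
  have hD' : CongrTo (ambientDomain D ε) (k + 1) (famDeriv h i j) (famDeriv h0 i j) := by
    have hne : (k : ℝ) + 1 - n / 2 ≠ 0 := by linarith
    have h1 := CongrTo.const_mul hΩ ((k : ℝ) + 1 - n / 2)⁻¹
      ((hE i j).add hΩ ((htau.mul hΩ (rC0 i j)).const_mul hΩ (1 / 2)))
    refine h1.congr hΩ (fun q _ => ?_) (fun q _ => ?_)
    · simp only [sub_add_cancel]; exact inv_mul_cancel_left₀ hne _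
    · simp only [sub_add_cancel]; exact inv_mul_cancel_left₀ hne _
  exact ⟨(hk i j).left, (hk i j).right, (hk i j).van.1, hD'.van.congr hΩ fun q hq =>
    (pd_sub (differentiableAt_of_contDiffOn hΩ (hh.contDiffOn_famComp i j) hq)
        (differentiableAt_of_contDiffOn hΩ (hh0.contDiffOn_famComp i j) hq) _).symm⟩

end IsFamilyOn

end FamilyCongruence


/-! ### Functions on M extended constantly in t and ρ. -/

section Horizontal

variable {n : ℕ} {D : Set (Model n)} {ε : ℝ} {F : Model n → ℝ} {q : ℝ × Model n × ℝ}

theorem isOpen_ambientDomain (hD : IsOpen D) : IsOpen (ambientDomain D ε) :=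
  isOpen_Ioi.prod (hD.prod isOpen_Ioo)

theorem contDiffOn_horizontal (hF : ContDiffOn ℝ ∞ F D) :
    ContDiffOn ℝ ∞ (fun q : ℝ × Model n × ℝ => F q.2.1) (ambientDomain D ε) :=
  hF.comp (contDiff_fst.comp contDiff_snd).contDiffOn fun _ hq => hq.2.1

variable (hD : IsOpen D) (hF : ContDiffOn ℝ ∞ F D) (hq : q ∈ ambientDomain D ε)
include hD hF hq

theorem pd_horizontal_idxM (i : Fin n) :
    pd (ambientFrame n) (idxM i) (fun q => F q.2.1) q = pd (stdFrame n) i F q.2.1 :=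
  (pd_slice (differentiableAt_of_contDiffOn (isOpen_ambientDomain hD)
    (contDiffOn_horizontal hF) hq) i).symm

theorem pd_horizontal_idxZero :
    pd (ambientFrame n) idxZero (fun q => F q.2.1) q = 0 :=
  pd_zero_of_snd (F := fun z => F z.1) (differentiableAt_of_contDiffOn (isOpen_ambientDomain hD)
    (contDiffOn_horizontal hF) hq)

theorem pd_horizontal_idxInf :
    pd (ambientFrame n) idxInf (fun q => F q.2.1) q = 0 := by
  refine pd_eq_of_hasDerivAt (differentiableAt_of_contDiffOn (isOpen_ambientDomain hD)
    (contDiffOn_horizontal hF) hq) ?_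
  have : (fun s : ℝ => F (q + s • ambientFrame n idxInf).2.1) = fun _ => F q.2.1 := by
    funext s
    have : (q + s • ambientFrame n idxInf).2.1 = q.2.1 := by simp [ambientFrame]
    rw [this]
  rw [this]
  exact hasDerivAt_const _ _

end Horizontal

/-! ### The explicit ambient model of an Einstein metric. -/

section EinsteinModel

variable {n : ℕ}

/-- The family `(1 + λ ρ)² g`. -/
def einsteinFamily (G : Model n → Matrix (Fin n) (Fin n) ℝ) (lam : ℝ) (ρ : ℝ) (p : Model n) :
    Matrix (Fin n) (Fin n) ℝ := (1 + lam * ρ) ^ 2 • G p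

variable {G : Model n → Matrix (Fin n) (Fin n) ℝ} {D : Set (Model n)} {lam ε : ℝ}

theorem IsMetricOn.isFamilyOn_einsteinFamily (hG : IsMetricOn G D)
    (hs : ∀ ρ ∈ Set.Ioo (-ε) ε, 0 < 1 + lam * ρ) : IsFamilyOn (einsteinFamily G lam) D ε where
  isOpen := hG.isOpen
  smooth i j := by
    have h1 : ContDiffOn ℝ ∞ (fun z : Model n × ℝ => (1 + lam * z.2) ^ 2)
        (D ×ˢ Set.Ioo (-ε) ε) := by fun_prop
    exact h1.mul ((hG.smooth i j).comp contDiff_fst.contDiffOn fun _ hz => hz.1)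
  symm ρ _ p hp i j := congrArg ((1 + lam * ρ) ^ 2 * ·) (hG.symm p hp i j)
  det_ne ρ hρ p hp := by
    simp only [einsteinFamily, Matrix.det_smul]
    exact mul_ne_zero (pow_ne_zero _ (pow_ne_zero _ (hs ρ hρ).ne')) (hG.det_ne p hp)

theorem matrix_inv_smul {A : Matrix (Fin n) (Fin n) ℝ} (hA : IsUnit A.det) {c : ℝ} (hc : c ≠ 0) :
    (c • A)⁻¹ = c⁻¹ • A⁻¹ := by
  refine Matrix.inv_eq_right_inv ?_
  rw [Matrix.smul_mul, Matrix.mul_smul, smul_smul, mul_inv_cancel₀ hc, one_smul,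
    Matrix.mul_nonsing_inv _ hA]

theorem christoffel_smul (hG : IsMetricOn G D) {c : ℝ} (hc : c ≠ 0) {p : Model n} (hp : p ∈ D)
    (k i j : Fin n) :
    christoffel (stdFrame n) (fun p => c • G p) p k i j = christoffel (stdFrame n) G p k i j := by
  have h1 : ∀ a b, inv (fun p => c • G p) p a b = c⁻¹ * inv G p a b := by
    intro a b
    exact congrFun (congrFun (matrix_inv_smul (hG.isUnit_det hp) hc) a) b
  have h2 : ∀ a b d, pd (stdFrame n) a (fun q => (c • G q) b d) p
      = c * pd (stdFrame n) a (fun q => G q b d) p := fun a b d =>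
    pd_const_mul (differentiableAt_of_contDiffOn hG.isOpen (hG.smooth b d) hp) c a
  simp only [christoffel, h1, h2]
  congr 1
  refine Finset.sum_congr rfl fun d _ => ?_
  field_simp

section Rho

variable {q : ℝ × Model n × ℝ}

theorem pd_one_add_rho (lam : ℝ) (q : ℝ × Model n × ℝ)
    (A : AmbientIndex n) : pd (ambientFrame n) A (fun q => 1 + lam * q.2.2) q = lam * (ambientFrame n A).2.2 := by
  rw [pd_add (by fun_prop) (by fun_prop), pd_const_mul (by fun_prop), pd_rho, pd_const, zero_add]

theorem contDiffOn_one_add_rho_inv (hs : ∀ ρ ∈ Set.Ioo (-ε) ε, 0 < 1 + lam * ρ) :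
    ContDiffOn ℝ ∞ (fun q : ℝ × Model n × ℝ => (1 + lam * q.2.2)⁻¹) (ambientDomain D ε) :=
  ContDiffOn.inv (contDiffOn_const.add (contDiffOn_const.mul contDiff_rho.contDiffOn))
    fun _ hq => (hs _ hq.2.2).ne'

theorem pd_one_add_rho_inv (hs : ∀ ρ ∈ Set.Ioo (-ε) ε, 0 < 1 + lam * ρ)
    (hq : q ∈ ambientDomain D ε) (A : AmbientIndex n) :
    pd (ambientFrame n) A (fun q => (1 + lam * q.2.2)⁻¹) q
      = -(lam * (ambientFrame n A).2.2 * ((1 + lam * q.2.2)⁻¹ * (1 + lam * q.2.2)⁻¹)) := by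
  have hne := (hs _ hq.2.2).ne'
  have h1 : DifferentiableAt ℝ (fun q : ℝ × Model n × ℝ => 1 + lam * q.2.2) q := by fun_prop
  have h2 : DifferentiableAt ℝ (fun q : ℝ × Model n × ℝ => (1 + lam * q.2.2)⁻¹) q :=
    h1.fun_inv hne
  have h3 : pd (ambientFrame n) A (fun q => (1 + lam * q.2.2) * (1 + lam * q.2.2)⁻¹) q = 0 := by
    have : (fun q : ℝ × Model n × ℝ => (1 + lam * q.2.2) * (1 + lam * q.2.2)⁻¹)
        =ᶠ[nhds q] fun _ => 1 := by
      filter_upwards [h1.continuousAt.eventually_ne hne] with q' hq'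
      exact mul_inv_cancel₀ hq'
    unfold pd
    rw [this.fderiv_eq]
    simp
  rw [pd_mul h1 h2, pd_one_add_rho] at h3
  field_simp at h3 ⊢
  linear_combination h3

end Rho

namespace IsMetricOn

variable (hG : IsMetricOn G D) (hs : ∀ ρ ∈ Set.Ioo (-ε) ε, 0 < 1 + lam * ρ)
  {q : ℝ × Model n × ℝ} (hq : q ∈ ambientDomain D ε)

omit hG hs hq in
theorem famComp_einsteinFamily (i j : Fin n) (q : ℝ × Model n × ℝ) :
    famComp (einsteinFamily G lam) i j q = (1 + lam * q.2.2) ^ 2 * G q.2.1 i j := rfl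

include hG hq

theorem famDeriv_einsteinFamily (i j : Fin n) :
    famDeriv (einsteinFamily G lam) i j q = 2 * lam * (1 + lam * q.2.2) * G q.2.1 i j := by
  have h1 : DifferentiableAt ℝ (fun q : ℝ × Model n × ℝ => 1 + lam * q.2.2) q := by fun_prop
  have h2 := differentiableAt_of_contDiffOn (isOpen_ambientDomain hG.isOpen)
    (contDiffOn_horizontal (hG.smooth i j)) hq
  change pd (ambientFrame n) idxInf (fun q => (1 + lam * q.2.2) ^ 2 * G q.2.1 i j) q = _
  rw [pd_mul (h1.fun_pow 2) h2, pd_horizontal_idxInf hG.isOpen (hG.smooth i j) hq]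
  simp only [pow_two]
  rw [pd_mul h1 h1, pd_one_add_rho]
  have hz : (ambientFrame n idxInf).2.2 = 1 := rfl
  rw [hz]
  ring

theorem pd_famDeriv_einsteinFamily (i j : Fin n) :
    pd (ambientFrame n) idxInf (famDeriv (einsteinFamily G lam) i j) q
      = 2 * lam ^ 2 * G q.2.1 i j := by
  have h1 : DifferentiableAt ℝ (fun q : ℝ × Model n × ℝ => 1 + lam * q.2.2) q := by fun_prop
  have h2 := differentiableAt_of_contDiffOn (isOpen_ambientDomain hG.isOpen)
    (contDiffOn_horizontal (hG.smooth i j)) hq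
  rw [pd_congr (isOpen_ambientDomain hG.isOpen)
    (fun q hq => famDeriv_einsteinFamily hG hq i j) hq, pd_mul (h1.const_mul _) h2,
    pd_horizontal_idxInf hG.isOpen (hG.smooth i j) hq, pd_const_mul h1, pd_one_add_rho]
  have hz : (ambientFrame n idxInf).2.2 = 1 := rfl
  rw [hz]
  ring

include hs

theorem famInv_einsteinFamily (i j : Fin n) :
    famInv (einsteinFamily G lam) i j q
      = (1 + lam * q.2.2)⁻¹ * (1 + lam * q.2.2)⁻¹ * inv G q.2.1 i j := by
  have hne := (hs _ hq.2.2).ne'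
  refine (congrFun (congrFun (matrix_inv_smul (hG.isUnit_det hq.2.1) (pow_ne_zero 2 hne)) i) j).trans ?_
  simp only [inv, Matrix.smul_apply, smul_eq_mul]
  field_simp

theorem famShape_einsteinFamily (i j : Fin n) :
    famShape (einsteinFamily G lam) i j q
      = if i = j then 2 * (lam * (1 + lam * q.2.2)⁻¹) else 0 := by
  have hne := (hs _ hq.2.2).ne'
  have h1 := hG.inv_mul hq.2.1 i j
  simp only [famShape, famInv_einsteinFamily hG hs hq, famDeriv_einsteinFamily hG hq]
  have : ∀ l, (1 + lam * q.2.2)⁻¹ * (1 + lam * q.2.2)⁻¹ * inv G q.2.1 i l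
      * (2 * lam * (1 + lam * q.2.2) * G q.2.1 l j)
      = 2 * (lam * (1 + lam * q.2.2)⁻¹) * (inv G q.2.1 i l * G q.2.1 l j) := fun l => by
    field_simp
  simp only [this, ← Finset.mul_sum, h1]
  split_ifs <;> ring

theorem famChr_einsteinFamily (k i j : Fin n) :
    famChr (einsteinFamily G lam) k i j q = christoffel (stdFrame n) G q.2.1 k i j := by
  rw [(hG.isFamilyOn_einsteinFamily hs).famChr_eq hq]
  exact christoffel_smul hG (pow_ne_zero 2 (hs _ hq.2.2).ne') hq.2.1 k i j

/-- On each slice the metric is a constant multiple of g, so the Christoffel symbols, and with them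
the curvature with one upper index, do not depend on ρ. -/
theorem famRiem_einsteinFamily (a b c d : Fin n) :
    famRiem (einsteinFamily G lam) a b c d q = riemUp (stdFrame n) G q.2.1 a b c d := by
  have h1 : ∀ x k i j, pd (ambientFrame n) (idxM x) (famChr (einsteinFamily G lam) k i j) q
      = pd (stdFrame n) x (fun p => christoffel (stdFrame n) G p k i j) q.2.1 := by
    intro x k i j
    rw [pd_congr (isOpen_ambientDomain hG.isOpen)
      (fun q hq => famChr_einsteinFamily hG hs hq k i j) hq,
      pd_horizontal_idxM hG.isOpen (hG.contDiffOn_christoffel k i j) hq]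
  simp only [famRiem, riemUp, h1, famChr_einsteinFamily hG hs hq]

/-- The tangential components of the curvature of the model. -/
theorem riemUp_einsteinFamily (a b c d : Fin n) :
    riemUp (ambientFrame n) (ambientComponents (einsteinFamily G lam)) q
        (idxM a) (idxM b) (idxM c) (idxM d)
      = riemUp (stdFrame n) G q.2.1 a b c d
        - 2 * lam * (G q.2.1 a c * (if b = d then 1 else 0) - G q.2.1 b c
          * (if a = d then 1 else 0)) := by
  have hne := (hs _ hq.2.2).ne'
  have ht : q.1 ≠ 0 := (ne_of_gt hq.1 : _)
  rw [(hG.isFamilyOn_einsteinFamily hs).riemUp_tangential hq, famRiem_einsteinFamily hG hs hq]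
  simp only [ambChr, famDeriv_einsteinFamily hG hq, famShape_einsteinFamily hG hs hq,
    famComp_einsteinFamily]
  simp only [eq_comm (a := d)]
  split_ifs <;> field_simp <;> ring

/-- The Einstein condition enters here: the powers of ρ in `ricci_tangential` cancel identically, so
the model solves the tangential equation exactly and not only to finite order. -/
theorem ricci_einsteinFamily (hE : ∀ i j, ricci (stdFrame n) G q.2.1 i j
      = 2 * lam * ((n : ℝ) - 1) * G q.2.1 i j) (i j : Fin n) :
    ricci (ambientFrame n) (ambientComponents (einsteinFamily G lam)) q (idxM i) (idxM j) = 0 := by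
  have hne := (hs _ hq.2.2).ne'
  rw [(hG.isFamilyOn_einsteinFamily hs).ricci_tangential hq]
  simp only [famRiem_einsteinFamily hG hs hq, pd_famDeriv_einsteinFamily hG hq,
    famDeriv_einsteinFamily hG hq, famShape_einsteinFamily hG hs hq, famComp_einsteinFamily]
  have h1 : ∑ k, riemUp (stdFrame n) G q.2.1 i k j k = 2 * lam * ((n : ℝ) - 1) * G q.2.1 i j :=
    hE i j
  rw [h1]
  simp [hG.symm _ hq.2.1 j i]
  field_simp
  linear_combination (lam ^ 2 * G q.2.1 i j * q.2.2 * (2 * n - 4)) * mul_inv_cancel₀ hne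

end IsMetricOn

end EinsteinModel


/-! ### The model has no curvature in the ρ direction. -/

section EinsteinModelCurvature

variable {n : ℕ} {G : Model n → Matrix (Fin n) (Fin n) ℝ} {D : Set (Model n)} {lam ε : ℝ}

namespace IsMetricOn

variable (hG : IsMetricOn G D) (hs : ∀ ρ ∈ Set.Ioo (-ε) ε, 0 < 1 + lam * ρ)
  {q : ℝ × Model n × ℝ} (hq : q ∈ ambientDomain D ε)
include hG hq

theorem ambChr_zero_einsteinFamily (i j : Fin n) :
    ambChr (einsteinFamily G lam) idxZero (idxM i) (idxM j) q
      = -(lam * q.1 * (1 + lam * q.2.2)) * G q.2.1 i j := by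
  simp only [ambChr, famDeriv_einsteinFamily hG hq]
  ring

theorem ambChr_inf_einsteinFamily (i j : Fin n) :
    ambChr (einsteinFamily G lam) idxInf (idxM i) (idxM j) q
      = ((1 + lam * q.2.2) * (lam * q.2.2 - 1)) * G q.2.1 i j := by
  simp only [ambChr, famDeriv_einsteinFamily hG hq, famComp_einsteinFamily]
  ring

include hs

theorem ambChr_idxM_idxInf_einsteinFamily (i j : Fin n) :
    ambChr (einsteinFamily G lam) (idxM i) (idxM j) idxInf q
      = (if i = j then lam else 0) * (1 + lam * q.2.2)⁻¹ := by
  simp only [ambChr, famShape_einsteinFamily hG hs hq]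
  split_ifs <;> ring

theorem ambChr_idxInf_idxM_einsteinFamily (i j : Fin n) :
    ambChr (einsteinFamily G lam) (idxM i) idxInf (idxM j) q
      = (if i = j then lam else 0) * (1 + lam * q.2.2)⁻¹ := by
  simp only [ambChr, famShape_einsteinFamily hG hs hq]
  split_ifs <;> ring

omit hs in
-- The antisymmetrization of ∇g = 0. The symbols Γ^ρ_{ij} of the model are a function of ρ times
-- g_{ij}, so the curvature components with upper index ρ reduce to this identity.
theorem codazzi (i j k : Fin n) :
    pd (stdFrame n) j (fun p => G p i k) q.2.1 - pd (stdFrame n) i (fun p => G p j k) q.2.1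
      + ∑ f, (christoffel (stdFrame n) G q.2.1 f i k * G q.2.1 j f
        - christoffel (stdFrame n) G q.2.1 f j k * G q.2.1 i f) = 0 := by
  rw [hG.pd_eq_christoffel hq.2.1, hG.pd_eq_christoffel hq.2.1, Finset.sum_sub_distrib]
  have h1 : ∀ d, christoffel (stdFrame n) G q.2.1 d j i = christoffel (stdFrame n) G q.2.1 d i j :=
    fun d => hG.christoffel_symm hq.2.1 d j i
  simp only [h1]
  ring

/-- The curvature of the model has no component along `∂_ρ`. -/
theorem riemUp_fourth_inf_einsteinFamily (a b c : AmbientIndex n) :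
    riemUp (ambientFrame n) (ambientComponents (einsteinFamily G lam)) q a b c idxInf = 0 := by
  have hh := hG.isFamilyOn_einsteinFamily hs
  have hΩ := hh.isOpen_ambientDomain
  have hne := (hs _ hq.2.2).ne'
  have key : ∀ (i : Fin n) (b : AmbientIndex n), riemUp (ambientFrame n)
      (ambientComponents (einsteinFamily G lam)) q (idxM i) b c idxInf = 0 := by
    intro i b
    rcases b with _ | j | _
    · exact hh.riemUp_second_zero hq _ _ _
    · rcases c with _ | k | _
      · exact hh.riemUp_third_zero hq _ _ _
      · have hd : ∀ a i k, pd (ambientFrame n) (idxM a)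
            (ambChr (einsteinFamily G lam) idxInf (idxM i) (idxM k)) q
            = ((1 + lam * q.2.2) * (lam * q.2.2 - 1)) * pd (stdFrame n) a (fun p => G p i k) q.2.1 := by
          intro a i k
          have d1 : DifferentiableAt ℝ (fun q : ℝ × Model n × ℝ => 1 + lam * q.2.2) q := by fun_prop
          have d2 : DifferentiableAt ℝ (fun q : ℝ × Model n × ℝ => lam * q.2.2 - 1) q := by fun_prop
          have d3 := differentiableAt_of_contDiffOn hΩ (contDiffOn_horizontal (hG.smooth i k)) hq
          have d4 : pd (ambientFrame n) (idxM a) (fun q => lam * q.2.2 - 1) q = 0 := by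
            rw [pd_sub (by fun_prop) (by fun_prop), pd_const_mul (by fun_prop), pd_rho, pd_const]
            simp [ambientFrame]
          rw [pd_congr hΩ (fun q hq => ambChr_inf_einsteinFamily hG hq i k) hq,
            pd_mul (d1.fun_mul d2) d3, pd_mul d1 d2, d4, pd_one_add_rho,
            pd_horizontal_idxM hG.isOpen (hG.smooth i k) hq]
          simp [ambientFrame]
        rw [hh.riemUp_ambientComponents hq, hd, hd, sum_ambient]
        have h2 := hG.codazzi hq i j k
        have h3 : ∀ f : Fin n, ambChr (einsteinFamily G lam) (idxM f) (idxM i) (idxM k) q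
              * ambChr (einsteinFamily G lam) idxInf (idxM j) (idxM f) q
            - ambChr (einsteinFamily G lam) (idxM f) (idxM j) (idxM k) q
              * ambChr (einsteinFamily G lam) idxInf (idxM i) (idxM f) q
            = ((1 + lam * q.2.2) * (lam * q.2.2 - 1))
              * (christoffel (stdFrame n) G q.2.1 f i k * G q.2.1 j f
                - christoffel (stdFrame n) G q.2.1 f j k * G q.2.1 i f) := by
          intro f
          rw [ambChr_inf_einsteinFamily hG hq, ambChr_inf_einsteinFamily hG hq]
          simp only [ambChr, famChr_einsteinFamily hG hs hq]
          ring
        simp only [h3, ← Finset.mul_sum]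
        simp only [ambChr]
        linear_combination ((1 + lam * q.2.2) * (lam * q.2.2 - 1)) * h2
      · rw [hh.riemUp_ambientComponents hq, sum_ambient]
        have h3 : ∀ f : Fin n, ambChr (einsteinFamily G lam) (idxM f) (idxM i) idxInf q
              * ambChr (einsteinFamily G lam) idxInf (idxM j) (idxM f) q
            = if f = i then lam * ((lam * q.2.2 - 1) * G q.2.1 j i) else 0 := by
          intro f
          rw [ambChr_inf_einsteinFamily hG hq, ambChr_idxM_idxInf_einsteinFamily hG hs hq]
          split_ifs with hf
          · subst hf; field_simp
          · ring
        have h4 : ∀ f : Fin n, ambChr (einsteinFamily G lam) (idxM f) (idxM j) idxInf q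
              * ambChr (einsteinFamily G lam) idxInf (idxM i) (idxM f) q
            = if f = j then lam * ((lam * q.2.2 - 1) * G q.2.1 j i) else 0 := by
          intro f
          rw [ambChr_inf_einsteinFamily hG hq, ambChr_idxM_idxInf_einsteinFamily hG hs hq]
          split_ifs with hf
          · subst hf; rw [hG.symm _ hq.2.1 i f]; field_simp
          · ring
        simp only [Finset.sum_sub_distrib, h3, h4]
        simp [ambChr, pd_const]
    · rcases c with _ | k | _
      · exact hh.riemUp_third_zero hq _ _ _
      · rw [hh.riemUp_inf_inf hq, pd_famDeriv_einsteinFamily hG hq]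
        simp only [famShape_einsteinFamily hG hs hq, famDeriv_einsteinFamily hG hq]
        simp [hG.symm _ hq.2.1 k i]
        right
        field_simp
        ring
      · rw [hh.riemUp_ambientComponents hq, sum_ambient]
        simp [ambChr, pd_const]
  rcases a with _ | i | _
  · exact hh.riemUp_first_zero hq _ _ _
  · exact key i b
  · rcases b with _ | j | _
    · exact hh.riemUp_second_zero hq _ _ _
    · rw [riemUp_antisymm, key, neg_zero]
    · have := riemUp_antisymm (ambientFrame n) (ambientComponents (einsteinFamily G lam)) q
        idxInf idxInf c idxInf
      change riemUp _ _ _ idxInf idxInf _ _ = 0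
      linarith

/-- In the model, `∂_ρ` is in the kernel of the curvature, third index. -/
theorem riemUp_third_inf_einsteinFamily (a b d : AmbientIndex n) :
    riemUp (ambientFrame n) (ambientComponents (einsteinFamily G lam)) q a b idxInf d = 0 := by
  have hh := hG.isFamilyOn_einsteinFamily hs
  have hΩ := hh.isOpen_ambientDomain
  have hne := (hs _ hq.2.2).ne'
  have hd : ∀ (A : AmbientIndex n) (l i : Fin n), pd (ambientFrame n) A
      (ambChr (einsteinFamily G lam) (idxM l) (idxM i) idxInf) q
      = (if l = i then lam else 0) * -(lam * (ambientFrame n A).2.2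
        * ((1 + lam * q.2.2)⁻¹ * (1 + lam * q.2.2)⁻¹)) := by
    intro A l i
    rw [pd_congr hΩ (fun q hq => ambChr_idxM_idxInf_einsteinFamily hG hs hq l i) hq,
      pd_const_mul (differentiableAt_of_contDiffOn hΩ (contDiffOn_one_add_rho_inv hs) hq),
      pd_one_add_rho_inv hs hq]
  have key : ∀ (i : Fin n) (b : AmbientIndex n), riemUp (ambientFrame n)
      (ambientComponents (einsteinFamily G lam)) q (idxM i) b idxInf d = 0 := by
    intro i b
    rcases b with _ | j | _
    · exact hh.riemUp_second_zero hq _ _ _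
    · rcases d with _ | l | _
      · rw [hh.riemUp_ambientComponents hq, sum_ambient]
        have h3 : ∀ i j f : Fin n, ambChr (einsteinFamily G lam) (idxM f) (idxM i) idxInf q
              * ambChr (einsteinFamily G lam) idxZero (idxM j) (idxM f) q
            = if f = i then -(lam * (lam * q.1 * G q.2.1 j i)) else 0 := by
          intro i j f
          rw [ambChr_zero_einsteinFamily hG hq, ambChr_idxM_idxInf_einsteinFamily hG hs hq]
          split_ifs with hf
          · subst hf; field_simp
          · ring
        simp only [Finset.sum_sub_distrib, h3]
        simp [ambChr, pd_const, hG.symm _ hq.2.1 i j]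
      · rw [hh.riemUp_ambientComponents hq, sum_ambient, hd, hd]
        have h3 : ∀ i j f : Fin n, ambChr (einsteinFamily G lam) (idxM f) (idxM i) idxInf q
              * ambChr (einsteinFamily G lam) (idxM l) (idxM j) (idxM f) q
            = if f = i then lam * (1 + lam * q.2.2)⁻¹
              * christoffel (stdFrame n) G q.2.1 l j i else 0 := by
          intro i j f
          rw [ambChr_idxM_idxInf_einsteinFamily hG hs hq]
          simp only [ambChr, famChr_einsteinFamily hG hs hq]
          split_ifs with hf
          · subst hf; ring
          · ring
        simp only [Finset.sum_sub_distrib, h3]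
        simp [ambChr, ambientFrame, hG.christoffel_symm hq.2.1 l i j]
      · exact riemUp_fourth_inf_einsteinFamily hG hs hq _ _ _
    · rcases d with _ | l | _
      · rw [hh.riemUp_ambientComponents hq, sum_ambient]
        simp [ambChr, pd_const]
      · rw [hh.riemUp_ambientComponents hq, sum_ambient, hd]
        have h3 : ∀ f : Fin n, ambChr (einsteinFamily G lam) (idxM f) (idxM i) idxInf q
              * ambChr (einsteinFamily G lam) (idxM l) idxInf (idxM f) q
            = if f = i then (if l = i then lam ^ 2 * ((1 + lam * q.2.2)⁻¹ * (1 + lam * q.2.2)⁻¹)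
              else 0) else 0 := by
          intro f
          rw [ambChr_idxM_idxInf_einsteinFamily hG hs hq, ambChr_idxInf_idxM_einsteinFamily hG hs hq]
          by_cases hf : f = i
          · subst hf; split_ifs <;> ring
          · simp [hf]
        simp only [Finset.sum_sub_distrib, h3]
        simp [ambChr, ambientFrame, pd_const]
        split_ifs <;> ring
      · exact riemUp_fourth_inf_einsteinFamily hG hs hq _ _ _
  rcases a with _ | i | _
  · exact hh.riemUp_first_zero hq _ _ _
  · exact key i b
  · rcases b with _ | j | _
    · exact hh.riemUp_second_zero hq _ _ _
    · rw [riemUp_antisymm, key, neg_zero]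
    · have := riemUp_antisymm (ambientFrame n) (ambientComponents (einsteinFamily G lam)) q
        idxInf idxInf idxInf d
      change riemUp _ _ _ idxInf idxInf _ _ = 0
      linarith

end IsMetricOn

end EinsteinModelCurvature


/-! ### How agreement of families passes to ambient connection and curvature. -/

section AmbientCongruence

variable {n : ℕ} {h h0 : ℝ → Model n → Matrix (Fin n) (Fin n) ℝ} {D : Set (Model n)} {ε : ℝ}
  {k : ℕ}

theorem CongrTo.prod_zero {Ω : Set (ℝ × Model n × ℝ)} (hΩ : IsOpen Ω) {κ : Type*} {s : Finset κ}
    {F : κ → ℝ × Model n × ℝ → ℝ} (hF : ∀ i, ContDiffOn ℝ ∞ (F i) Ω) {i : κ} (hi : i ∈ s)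
    (h : CongrTo Ω k (F i) (fun _ => 0)) : CongrTo Ω k (fun q => ∏ i ∈ s, F i q) (fun _ => 0) := by
  classical
  refine (h.mul hΩ (CongrTo.prod hΩ (s.erase i) fun i => CongrTo.refl hΩ (hF i))).congr hΩ
    (fun q _ => ?_) (fun q _ => ?_)
  · exact Finset.mul_prod_erase s (fun i => F i q) hi
  · exact zero_mul _

theorem contDiffOn_inv_t : ContDiffOn ℝ ∞ (fun q : ℝ × Model n × ℝ => q.1⁻¹) (ambientDomain D ε) :=
  contDiff_t.contDiffOn.inv fun _ hq => (ne_of_gt hq.1 : _)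

namespace IsFamilyOn

variable (hh : IsFamilyOn h D ε) (hh0 : IsFamilyOn h0 D ε)
  (hk : ∀ i j, CongrTo (ambientDomain D ε) (k + 2) (famComp h i j) (famComp h0 i j))
include hh hh0 hk

theorem congrTo_ambInv (A B : AmbientIndex n) :
    CongrTo (ambientDomain D ε) (k + 2) (fun q => ambInv h q A B) (fun q => ambInv h0 q A B) := by
  have hΩ := hh.isOpen_ambientDomain
  rcases A with _ | i | _ <;> rcases B with _ | j | _
  case inr.inl.inr.inl =>
    exact (CongrTo.refl hΩ (contDiffOn_inv_t.mul contDiffOn_inv_t)).mul hΩ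
      (hh.congrTo_famInv hh0 hk i j)
  all_goals exact CongrTo.refl hΩ (hh.contDiffOn_ambInv _ _)

/-- One order is lost through ∂_ρ g_ρ. -/
theorem congrTo_ambChr (C A B : AmbientIndex n) :
    CongrTo (ambientDomain D ε) (k + 1) (ambChr h C A B) (ambChr h0 C A B) := by
  have hΩ := hh.isOpen_ambientDomain
  have hS := hh.congrTo_famShape hh0 hk
  have hD := hh.congrTo_famDeriv hk
  rcases C with _ | l | _ <;> rcases A with _ | i | _ <;> rcases B with _ | j | _
  case inl.inr.inl.inr.inl =>
    exact (CongrTo.refl hΩ (contDiffOn_const.mul contDiff_t.contDiffOn)).mul hΩ (hD i j)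
  case inr.inl.inr.inl.inr.inl =>
    exact hh.congrTo_famChr hh0 (fun i j => (hk i j).mono (Nat.le_succ _)) l i j
  case inr.inr.inr.inl.inr.inl =>
    exact (((hD i j).rho_mul hΩ).mono (Nat.le_succ _)).sub hΩ ((hk i j).mono (Nat.le_succ _))
  case inr.inl.inr.inl.inr.inr => exact (hS l i).const_mul hΩ _
  case inr.inl.inr.inr.inr.inl => exact (hS l j).const_mul hΩ _
  all_goals exact CongrTo.refl hΩ (hh.contDiffOn_ambChr _ _ _)

omit hh0 in
-- Here ∂_ρ g_ρ occurs only in the combination ρ∂_ρ g_ρ, so the lost order is regained.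
theorem congrTo_ambChr_inf (A B : AmbientIndex n) :
    CongrTo (ambientDomain D ε) (k + 2) (ambChr h idxInf A B) (ambChr h0 idxInf A B) := by
  have hΩ := hh.isOpen_ambientDomain
  rcases A with _ | i | _ <;> rcases B with _ | j | _
  case inr.inl.inr.inl => exact ((hh.congrTo_famDeriv hk i j).rho_mul hΩ).sub hΩ (hk i j)
  all_goals exact CongrTo.refl hΩ (hh.contDiffOn_ambChr _ _ _)

theorem congrTo_riemUp_of {r : ℕ} (hr : r ≤ k + 1) {a b c d : AmbientIndex n}
    (hb : CongrTo (ambientDomain D ε) r (pd (ambientFrame n) b (ambChr h d a c))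
      (pd (ambientFrame n) b (ambChr h0 d a c)))
    (ha : CongrTo (ambientDomain D ε) r (pd (ambientFrame n) a (ambChr h d b c))
      (pd (ambientFrame n) a (ambChr h0 d b c))) :
    CongrTo (ambientDomain D ε) r
      (fun q => riemUp (ambientFrame n) (ambientComponents h) q a b c d)
      (fun q => riemUp (ambientFrame n) (ambientComponents h0) q a b c d) := by
  have hΩ := hh.isOpen_ambientDomain
  have hC := fun c a b => (hh.congrTo_ambChr hh0 hk c a b).mono hr
  refine ((hb.sub hΩ ha).add hΩ (.sum hΩ Finset.univ fun f => ((hC f a c).mul hΩ (hC d b f)).sub hΩ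
    ((hC f b c).mul hΩ (hC d a f)))).congr hΩ (fun q hq => ?_) (fun q hq => ?_)
  · exact (hh.riemUp_ambientComponents hq a b c d).symm
  · exact (hh0.riemUp_ambientComponents hq a b c d).symm

theorem congrTo_riemUp (a b c d : AmbientIndex n) :
    CongrTo (ambientDomain D ε) k
      (fun q => riemUp (ambientFrame n) (ambientComponents h) q a b c d)
      (fun q => riemUp (ambientFrame n) (ambientComponents h0) q a b c d) :=
  have hΩ := hh.isOpen_ambientDomain
  hh.congrTo_riemUp_of hh0 hk (Nat.le_succ _) ((hh.congrTo_ambChr hh0 hk _ _ _).pd hΩ _)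
    ((hh.congrTo_ambChr hh0 hk _ _ _).pd hΩ _)

/-- Neither differentiating index is ρ, so the Christoffel symbols are only differentiated
tangentially and their order is kept. -/
theorem congrTo_riemUp_tangential {a b : AmbientIndex n} (ha : a ≠ idxInf) (hb : b ≠ idxInf)
    (c d : AmbientIndex n) :
    CongrTo (ambientDomain D ε) (k + 1)
      (fun q => riemUp (ambientFrame n) (ambientComponents h) q a b c d)
      (fun q => riemUp (ambientFrame n) (ambientComponents h0) q a b c d) :=
  have hΩ := hh.isOpen_ambientDomain
  hh.congrTo_riemUp_of hh0 hk le_rfl ((hh.congrTo_ambChr hh0 hk _ _ _).pd_tangential hΩ hb)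
    ((hh.congrTo_ambChr hh0 hk _ _ _).pd_tangential hΩ ha)

/-- The differentiated symbols have upper index ρ and hence one order to spare, which pays for a
possible ∂_ρ. -/
theorem congrTo_riemUp_inf (a b c : AmbientIndex n) :
    CongrTo (ambientDomain D ε) (k + 1)
      (fun q => riemUp (ambientFrame n) (ambientComponents h) q a b c idxInf)
      (fun q => riemUp (ambientFrame n) (ambientComponents h0) q a b c idxInf) :=
  have hΩ := hh.isOpen_ambientDomain
  hh.congrTo_riemUp_of hh0 hk le_rfl ((hh.congrTo_ambChr_inf hk _ _).pd hΩ _)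
    ((hh.congrTo_ambChr_inf hk _ _).pd hΩ _)

omit hh0 hk in
theorem raiseLast_riem_ambientComponents {q : ℝ × Model n × ℝ} (hq : q ∈ ambientDomain D ε)
    (a b c d : AmbientIndex n) :
    raiseLast (ambientComponents h) (riem (ambientFrame n) (ambientComponents h)) q a b c d
      = ∑ c', ambInv h q c c' * riemUp (ambientFrame n) (ambientComponents h) q a b c' d := by
  rw [hh.isMetricOn.raiseLast_riem hq]
  simp only [hh.inv_ambientComponents hq]

theorem congrTo_raiseLast_of {a b c d : AmbientIndex n}
    (hR : ∀ c', CongrTo (ambientDomain D ε) (k + 1)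
      (fun q => riemUp (ambientFrame n) (ambientComponents h) q a b c' d)
      (fun q => riemUp (ambientFrame n) (ambientComponents h0) q a b c' d)) :
    CongrTo (ambientDomain D ε) (k + 1)
      (fun q => raiseLast (ambientComponents h)
        (riem (ambientFrame n) (ambientComponents h)) q a b c d)
      (fun q => raiseLast (ambientComponents h0)
        (riem (ambientFrame n) (ambientComponents h0)) q a b c d) := by
  have hΩ := hh.isOpen_ambientDomain
  refine (CongrTo.sum hΩ Finset.univ fun c' =>
    ((hh.congrTo_ambInv hh0 hk c c').mono (Nat.le_succ _)).mul hΩ (hR c')).congr hΩ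
    (fun q hq => ?_) (fun q hq => ?_)
  · exact (hh.raiseLast_riem_ambientComponents hq a b c d).symm
  · exact (hh0.raiseLast_riem_ambientComponents hq a b c d).symm

/-- The ρ row of the inverse metric has two nonzero entries. The entry in the column t meets a
vanishing curvature component, and the entry in the column ρ carries a factor ρ that makes up for
the second lost order. -/
theorem congrTo_raiseLast_inf (a b d : AmbientIndex n) :
    CongrTo (ambientDomain D ε) (k + 1)
      (fun q => raiseLast (ambientComponents h)
        (riem (ambientFrame n) (ambientComponents h)) q a b idxInf d)
      (fun q => raiseLast (ambientComponents h0)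
        (riem (ambientFrame n) (ambientComponents h0)) q a b idxInf d) := by
  have hΩ := hh.isOpen_ambientDomain
  have key : ∀ {h : ℝ → Model n → Matrix (Fin n) (Fin n) ℝ}, IsFamilyOn h D ε →
      Set.EqOn (fun q => q.2.2 * ((-2 * (q.1⁻¹ * q.1⁻¹))
        * riemUp (ambientFrame n) (ambientComponents h) q a b idxInf d))
      (fun q => raiseLast (ambientComponents h)
        (riem (ambientFrame n) (ambientComponents h)) q a b idxInf d) (ambientDomain D ε) := by
    intro h hh q hq
    simp only
    rw [hh.raiseLast_riem_ambientComponents hq, sum_ambient, hh.riemUp_third_zero hq]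
    simp only [ambInv]
    simp
    ring
  exact (((CongrTo.refl hΩ (contDiffOn_const.mul (contDiffOn_inv_t.mul contDiffOn_inv_t))).mul hΩ
    (hh.congrTo_riemUp hh0 hk a b idxInf d)).rho_mul hΩ).congr hΩ (key hh) (key hh0)

end IsFamilyOn

end AmbientCongruence

/-! ### Ambient curvature compared with the Weyl tensor of the Einstein metric. -/

section EinsteinCongruence

variable {n : ℕ} {h : ℝ → Model n → Matrix (Fin n) (Fin n) ℝ} {D : Set (Model n)} {ε lam : ℝ}
  {k : ℕ} {G : Model n → Matrix (Fin n) (Fin n) ℝ}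

/-- Extension by zero of a tensor on `M` to the ambient indices. -/
def embedTensor (T : Fin n → Fin n → Fin n → Fin n → ℝ) :
    AmbientIndex n → AmbientIndex n → AmbientIndex n → AmbientIndex n → ℝ
  | .inr (.inl a), .inr (.inl b), .inr (.inl c), .inr (.inl d) => T a b c d
  | _, _, _, _ => 0

/-- The quadratic terms in the ambient connection subtract 2λ times the identity on two-forms, which
turns the Riemann tensor of g into its Weyl tensor; raising one index supplies the factor
(t(1+λρ))^{-2}. -/
theorem IsEinsteinOn.raiseLast_riem_einsteinFamily (hG : IsEinsteinOn G D lam) (hn : 3 ≤ n)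
    (hs : ∀ ρ ∈ Set.Ioo (-ε) ε, 0 < 1 + lam * ρ) {q : ℝ × Model n × ℝ}
    (hq : q ∈ ambientDomain D ε) (a b c d : Fin n) :
    raiseLast (ambientComponents (einsteinFamily G lam))
        (riem (ambientFrame n) (ambientComponents (einsteinFamily G lam))) q
        (idxM a) (idxM b) (idxM c) (idxM d)
      = (q.1 * (1 + lam * q.2.2))⁻¹ ^ 2
        * raiseLast G (weyl (stdFrame n) G) q.2.1 a b c d := by
  have hh := hG.isFamilyOn_einsteinFamily hs
  have hne := (hs _ hq.2.2).ne'
  have ht : q.1 ≠ 0 := (ne_of_gt hq.1 : _)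
  rw [hh.raiseLast_riem_ambientComponents hq, sum_ambient, hG.raiseLast_weyl hn hq.2.1,
    hG.raiseLast_riem hq.2.1]
  simp only [hG.riemUp_einsteinFamily hs hq, ambInv, hG.famInv_einsteinFamily hs hq]
  have h1 := hG.inv_mul hq.2.1 c
  have h2 : ∀ x, q.1⁻¹ * q.1⁻¹ * ((1 + lam * q.2.2)⁻¹ * (1 + lam * q.2.2)⁻¹ * inv G q.2.1 c x)
      * (riemUp (stdFrame n) G q.2.1 a b x d - 2 * lam * (G q.2.1 a x * (if b = d then 1 else 0)
        - G q.2.1 b x * (if a = d then 1 else 0)))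
      = (q.1 * (1 + lam * q.2.2))⁻¹ ^ 2 * (inv G q.2.1 c x * riemUp (stdFrame n) G q.2.1 a b x d)
        - (q.1 * (1 + lam * q.2.2))⁻¹ ^ 2 * (2 * lam)
          * ((if b = d then 1 else 0) * (inv G q.2.1 c x * G q.2.1 x a)
            - (if a = d then 1 else 0) * (inv G q.2.1 c x * G q.2.1 x b)) := by
    intro x
    rw [hG.symm _ hq.2.1 a x, hG.symm _ hq.2.1 b x, mul_inv]
    ring
  simp only [h2, Finset.sum_sub_distrib, ← Finset.mul_sum, h1, deltaTensor]
  simp only [eq_comm (a := c)]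
  ring

namespace IsFamilyOn

variable (hh : IsFamilyOn h D ε) (hG : IsEinsteinOn G D lam)
  (hs : ∀ ρ ∈ Set.Ioo (-ε) ε, 0 < 1 + lam * ρ)
  (hk : ∀ i j, CongrTo (ambientDomain D ε) (k + 2) (famComp h i j)
    (famComp (einsteinFamily G lam) i j))
include hh hG hs hk

theorem congrTo_raiseLast_tangential (hn : 3 ≤ n) (a b c d : Fin n) :
    CongrTo (ambientDomain D ε) (k + 1)
      (fun q => raiseLast (ambientComponents h) (riem (ambientFrame n) (ambientComponents h)) q
        (idxM a) (idxM b) (idxM c) (idxM d))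
      (fun q => (q.1 * (1 + lam * q.2.2))⁻¹ ^ 2
        * raiseLast G (weyl (stdFrame n) G) q.2.1 a b c d) :=
  have hΩ := hh.isOpen_ambientDomain
  have hh0 := hG.isFamilyOn_einsteinFamily hs
  (hh.congrTo_raiseLast_of hh0 hk (fun _ => hh.congrTo_riemUp_tangential hh0 hk (by simp) (by simp)
    _ _)).congr hΩ (fun _ _ => rfl)
    fun _ hq => hG.raiseLast_riem_einsteinFamily hn hs hq a b c d

omit hG hs hk in
theorem congrTo_raiseLast_zero {a b : AmbientIndex n} (hab : a = idxZero ∨ b = idxZero)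
    (c d : AmbientIndex n) :
    CongrTo (ambientDomain D ε) (k + 1)
      (fun q => raiseLast (ambientComponents h) (riem (ambientFrame n) (ambientComponents h)) q
        a b c d) (fun _ => 0) := by
  have hΩ := hh.isOpen_ambientDomain
  refine (CongrTo.of_eqOn hΩ contDiffOn_const fun q hq => ?_).symm hΩ
  rw [hh.raiseLast_riem_ambientComponents hq]
  refine (Finset.sum_eq_zero fun c' _ => ?_).symm
  rcases hab with rfl | rfl
  · rw [hh.riemUp_first_zero hq, mul_zero]
  · rw [hh.riemUp_second_zero hq, mul_zero]

/-- In the model these components vanish because ∂_ρ lies in the kernel of the curvature. The gain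
of one order comes from the factor ρ in the inverse metric if c is ρ, and from the better connection
coefficients if d is ρ. -/
theorem congrTo_raiseLast_infinity (a b : AmbientIndex n) {c d : AmbientIndex n}
    (hcd : c = idxInf ∨ d = idxInf) :
    CongrTo (ambientDomain D ε) (k + 1)
      (fun q => raiseLast (ambientComponents h) (riem (ambientFrame n) (ambientComponents h)) q
        a b c d) (fun _ => 0) := by
  have hΩ := hh.isOpen_ambientDomain
  have hh0 := hG.isFamilyOn_einsteinFamily hs
  rcases hcd with rfl | rfl
  · refine (hh.congrTo_raiseLast_inf hh0 hk a b d).congr hΩ (fun _ _ => rfl) fun q hq => ?_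
    rw [hh0.raiseLast_riem_ambientComponents hq, sum_ambient, hh0.riemUp_third_zero hq,
      hG.riemUp_third_inf_einsteinFamily hs hq]
    simp [ambInv]
  · refine (hh.congrTo_raiseLast_of hh0 hk fun _ => hh.congrTo_riemUp_inf hh0 hk a b _).congr hΩ
      (fun _ _ => rfl) fun q hq => ?_
    rw [hh0.raiseLast_riem_ambientComponents hq]
    exact Finset.sum_eq_zero fun c' _ => by
      rw [hG.riemUp_fourth_inf_einsteinFamily hs hq, mul_zero]

omit hG hs hk in
/-- The Weyl and Riemann tensors of the ambient metric agree to the order of Ricci flatness. -/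
theorem congrTo_weyl (hR : ∀ A B, VanishesTo (ambientDomain D ε) (k + 1)
      (fun q => ricci (ambientFrame n) (ambientComponents h) q A B)) (a b c d : AmbientIndex n) :
    CongrTo (ambientDomain D ε) (k + 1)
      (fun q => weyl (ambientFrame n) (ambientComponents h) q a b c d)
      (fun q => riem (ambientFrame n) (ambientComponents h) q a b c d) := by
  have hΩ := hh.isOpen_ambientDomain
  have hM := hh.isMetricOn
  have rG := fun A B => CongrTo.refl (k := k + 1) hΩ (hM.smooth A B)
  have hRic : ∀ A B, CongrTo (ambientDomain D ε) (k + 1)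
      (fun q => ricci (ambientFrame n) (ambientComponents h) q A B) (fun _ => 0) := fun A B =>
    .of_vanishesTo hΩ (hM.contDiffOn_ricci A B) (hR A B)
  have hJ : CongrTo (ambientDomain D ε) (k + 1)
      (fun q => schoutenTrace (ambientFrame n) (ambientComponents h) q) (fun _ => 0) :=
    (CongrTo.const_mul hΩ (2 * ((Fintype.card (AmbientIndex n) : ℝ) - 1))⁻¹ (.sum hΩ Finset.univ
      fun A => .sum hΩ Finset.univ fun B => (CongrTo.refl hΩ (hM.contDiffOn_inv A B)).mul hΩ
        (hRic A B))).congr hΩ (fun q _ => by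
          simp only [schoutenTrace, scalar]; rw [div_eq_inv_mul]) (fun q _ => by simp)
  have hP : ∀ A B, CongrTo (ambientDomain D ε) (k + 1)
      (fun q => schouten (ambientFrame n) (ambientComponents h) q A B) (fun _ => 0) := fun A B =>
    (CongrTo.const_mul hΩ ((Fintype.card (AmbientIndex n) : ℝ) - 2)⁻¹
      ((hRic A B).sub hΩ (hJ.mul hΩ (rG A B)))).congr hΩ (fun q _ => by
          simp only [schouten]; rw [div_eq_inv_mul]) (fun q _ => by simp)
  have hPG := fun A B C E => (hP A B).mul hΩ (rG C E)
  refine (((CongrTo.refl hΩ (hM.contDiffOn_riem a b c d)).sub hΩ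
    ((hPG a c d b).sub hΩ (hPG a d c b))).add hΩ ((hPG b c d a).sub hΩ (hPG b d c a))).congr hΩ
    (fun q _ => rfl) (fun q _ => by simp)

omit hG hs hk in
theorem congrTo_raiseLast_weyl (hR : ∀ A B, VanishesTo (ambientDomain D ε) (k + 1)
      (fun q => ricci (ambientFrame n) (ambientComponents h) q A B)) (a b c d : AmbientIndex n) :
    CongrTo (ambientDomain D ε) (k + 1)
      (fun q => raiseLast (ambientComponents h)
        (weyl (ambientFrame n) (ambientComponents h)) q a b c d)
      (fun q => raiseLast (ambientComponents h)
        (riem (ambientFrame n) (ambientComponents h)) q a b c d) :=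
  have hΩ := hh.isOpen_ambientDomain
  have rI := fun A B => CongrTo.refl (k := k + 1) hΩ (hh.isMetricOn.contDiffOn_inv A B)
  .sum hΩ _ fun _ => .sum hΩ _ fun _ => ((rI _ _).mul hΩ (rI _ _)).mul hΩ
    (hh.congrTo_weyl hR _ _ _ _)

end IsFamilyOn

end EinsteinCongruence


/-! ### Reduction of the ambient Pfaffian contraction to the tangential one. -/

section PfCongruence

variable {n : ℕ} {D : Set (Model n)} {ε lam : ℝ}

theorem genDelta_idxM {S : Type} [Fintype S] [DecidableEq S] (a b : S → Fin n) :
    genDelta (fun s => (idxM (a s) : AmbientIndex n)) (fun s => idxM (b s)) = genDelta a b := by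
  simp [genDelta]

theorem exists_perm_of_genDelta_ne_zero {ι S : Type} [DecidableEq ι] [Fintype S] [DecidableEq S]
    {a b : S → ι} (h : genDelta a b ≠ 0) : ∃ σ : Equiv.Perm S, ∀ s, a s = b (σ s) := by
  by_contra! hc
  refine h ?_
  unfold genDelta
  rw [Finset.sum_eq_zero, zero_div]
  intro σ _
  obtain ⟨s, hs⟩ := hc σ
  rw [Finset.prod_eq_zero (Finset.mem_univ s) (if_neg hs), mul_zero]

theorem embedTensor_eq_zero (T : Fin n → Fin n → Fin n → Fin n → ℝ) {a b : AmbientIndex n}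
    (hab : (∀ i, a ≠ idxM i) ∨ ∀ i, b ≠ idxM i) (c d : AmbientIndex n) :
    embedTensor T a b c d = 0 := by
  rcases a with _ | i | _ <;> rcases b with _ | j | _ <;> try rfl
  rcases hab with h | h
  · exact absurd rfl (h i)
  · exact absurd rfl (h j)

/-- The contraction of the extension by zero of a tensor is the contraction of the tensor. -/
theorem sum_genDelta_embedTensor (l : ℕ) (T : Fin n → Fin n → Fin n → Fin n → ℝ) :
    ∑ a : Fin l × Fin 2 → AmbientIndex n, ∑ b : Fin l × Fin 2 → AmbientIndex n,
      genDelta a b * ∏ i, embedTensor T (a (i, 0)) (a (i, 1)) (b (i, 0)) (b (i, 1))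
    = ∑ a : Fin l × Fin 2 → Fin n, ∑ b : Fin l × Fin 2 → Fin n,
      genDelta a b * ∏ i, T (a (i, 0)) (a (i, 1)) (b (i, 0)) (b (i, 1)) := by
  have hinj : Function.Injective fun (a : Fin l × Fin 2 → Fin n) s => (idxM (a s) : AmbientIndex n) :=
    fun a b hab => funext fun s => by simpa using congrFun hab s
  have hnr : ∀ a : Fin l × Fin 2 → AmbientIndex n,
      a ∉ Set.range (fun (a : Fin l × Fin 2 → Fin n) s => (idxM (a s) : AmbientIndex n)) →
      ∃ s, ∀ i, a s ≠ idxM i := by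
    intro a ha
    by_contra! hc
    choose f hf using hc
    exact ha ⟨f, funext fun s => (hf s).symm⟩
  have hzero : ∀ a b : Fin l × Fin 2 → AmbientIndex n, (∃ s, ∀ i, a s ≠ idxM i) →
      ∏ i, embedTensor T (a (i, 0)) (a (i, 1)) (b (i, 0)) (b (i, 1)) = 0 := by
    rintro a b ⟨⟨i, j⟩, hs⟩
    refine Finset.prod_eq_zero (Finset.mem_univ i) (embedTensor_eq_zero T ?_ _ _)
    fin_cases j
    · exact Or.inl hs
    · exact Or.inr hs
  symm
  refine Fintype.sum_of_injective _ hinj _ _ (fun a ha => ?_) fun a => ?_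
  · exact Finset.sum_eq_zero fun b _ => by rw [hzero a b (hnr a ha), mul_zero]
  · refine Fintype.sum_of_injective _ hinj _ _ (fun b hb => ?_) fun b => ?_
    -- All lower indices are tangential here. If an upper index is not, the delta vanishes, because
    -- the upper indices would have to be a permutation of the lower ones.
    · obtain ⟨s, hs⟩ := hnr b hb
      rw [mul_eq_zero]
      left
      by_contra hne
      obtain ⟨σ, hσ⟩ := exists_perm_of_genDelta_ne_zero hne
      refine hs (a (σ⁻¹ s)) ?_
      rw [hσ (σ⁻¹ s)]
      simp
    · rw [genDelta_idxM]
      rfl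

/-- The Pfaffian contraction of a tensor that agrees to finite order with a tensor on `M`. -/
theorem congrTo_pf (hD : IsOpen D) {k : ℕ} (l : ℕ)
    {GA : ℝ × Model n × ℝ → Matrix (AmbientIndex n) (AmbientIndex n) ℝ}
    {X : ℝ × Model n × ℝ → AmbientIndex n → AmbientIndex n → AmbientIndex n → AmbientIndex n → ℝ}
    {G : Model n → Matrix (Fin n) (Fin n) ℝ} {W : Model n → Fin n → Fin n → Fin n → Fin n → ℝ}
    {v : ℝ × Model n × ℝ → ℝ}
    (hX : ∀ a b c d, ContDiffOn ℝ ∞ (fun q => raiseLast GA X q a b c d) (ambientDomain D ε))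
    (hM : ∀ a b c d, CongrTo (ambientDomain D ε) k
      (fun q => raiseLast GA X q (idxM a) (idxM b) (idxM c) (idxM d))
      (fun q => v q * raiseLast G W q.2.1 a b c d))
    (hZ : ∀ a b, a = idxZero ∨ b = idxZero → ∀ c d, CongrTo (ambientDomain D ε) k
      (fun q => raiseLast GA X q a b c d) (fun _ => 0))
    (hI : ∀ a b c d, c = idxInf ∨ d = idxInf → CongrTo (ambientDomain D ε) k
      (fun q => raiseLast GA X q a b c d) (fun _ => 0)) :
    CongrTo (ambientDomain D ε) k (pf GA l X) (fun q => v q ^ l * pf G l W q.2.1) := by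
  have hΩ : IsOpen (ambientDomain D ε) := isOpen_ambientDomain hD
  have key : ∀ a b : Fin l × Fin 2 → AmbientIndex n, CongrTo (ambientDomain D ε) k
      (fun q => genDelta a b * ∏ i, raiseLast GA X q (a (i, 0)) (a (i, 1)) (b (i, 0)) (b (i, 1)))
      (fun q => genDelta a b * ∏ i, embedTensor (fun a b c d => v q * raiseLast G W q.2.1 a b c d)
        (a (i, 0)) (a (i, 1)) (b (i, 0)) (b (i, 1))) := by
    intro a b
    -- Only summands in which the upper indices permute the lower ones matter. A lower t is
    -- negligible by itself; a lower ρ forces an upper ρ in some factor, which is negligible too.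
    -- The poorly controlled components with a lower ρ are therefore never estimated.
    by_cases hg : genDelta a b = 0
    · simp only [hg, zero_mul]
      exact CongrTo.refl hΩ contDiffOn_const
    refine CongrTo.const_mul hΩ _ ?_
    obtain ⟨σ, hσ⟩ := exists_perm_of_genDelta_ne_zero hg
    by_cases hA : ∃ s, ∀ i, a s ≠ idxM i
    · have h0 : ∀ q, ∏ i, embedTensor (fun a b c d => v q * raiseLast G W q.2.1 a b c d)
          (a (i, 0)) (a (i, 1)) (b (i, 0)) (b (i, 1)) = 0 := by
        intro q
        obtain ⟨⟨i, j⟩, hs⟩ := hA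
        refine Finset.prod_eq_zero (Finset.mem_univ i) (embedTensor_eq_zero _ ?_ _ _)
        fin_cases j
        · exact Or.inl hs
        · exact Or.inr hs
      simp only [h0]
      obtain ⟨s, hs⟩ := hA
      rcases has : a s with _ | i | _
      · refine CongrTo.prod_zero hΩ (fun i => hX _ _ _ _) (Finset.mem_univ s.1) (hZ _ _ ?_ _ _)
        obtain ⟨i, j⟩ := s
        fin_cases j
        · exact Or.inl has
        · exact Or.inr has
      · exact absurd has (hs i)
      · have hb : b (σ s) = idxInf := (hσ s).symm.trans has
        refine CongrTo.prod_zero hΩ (fun i => hX _ _ _ _) (Finset.mem_univ (σ s).1)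
          (hI _ _ _ _ ?_)
        revert hb
        generalize σ s = s'
        obtain ⟨i, j⟩ := s'
        intro hb
        fin_cases j
        · exact Or.inl hb
        · exact Or.inr hb
    · push Not at hA
      choose a' ha' using hA
      have hb' : ∀ s, b s = idxM (a' (σ⁻¹ s)) := fun s => by
        rw [← ha', hσ]
        simp
      refine CongrTo.prod hΩ _ fun i => ?_
      simp only [ha', hb']
      exact hM _ _ _ _
  refine (CongrTo.const_mul hΩ ((1 / 2) ^ l * ((2 * l - 1)‼ : ℝ)) (.sum hΩ Finset.univ fun a =>
    .sum hΩ Finset.univ fun b => key a b)).congr hΩ (fun q _ => rfl) fun q _ => ?_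
  simp only [sum_genDelta_embedTensor, pf, Finset.prod_mul_distrib, Finset.prod_const,
    Finset.card_univ, Fintype.card_fin]
  simp only [mul_left_comm _ (v q ^ l), ← Finset.mul_sum]

end PfCongruence

/-! ### The loss of order under the ambient Laplacian. -/

section LaplacianCongruence

variable {n : ℕ} {h h0 : ℝ → Model n → Matrix (Fin n) (Fin n) ℝ} {D : Set (Model n)} {ε : ℝ}
  {k r : ℕ} {f f0 : ℝ × Model n × ℝ → ℝ}

/-- The ambient Laplacian lowers the order of agreement by only one. -/
theorem IsFamilyOn.congrTo_laplacian (hh : IsFamilyOn h D ε) (hh0 : IsFamilyOn h0 D ε)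
    (hk : ∀ i j, CongrTo (ambientDomain D ε) (k + 2) (famComp h i j) (famComp h0 i j))
    (hr : r ≤ k + 1) (hf : CongrTo (ambientDomain D ε) (r + 1) f f0) :
    CongrTo (ambientDomain D ε) r
      (laplacian (ambientFrame n) (ambientComponents h) f)
      (laplacian (ambientFrame n) (ambientComponents h0) f0) := by
  have hΩ := hh.isOpen_ambientDomain
  have h1 : ∀ a b, CongrTo (ambientDomain D ε) r
      (fun q => ∑ c, ambChr h c a b q * pd (ambientFrame n) c f q)
      (fun q => ∑ c, ambChr h0 c a b q * pd (ambientFrame n) c f0 q) := fun a b =>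
    .sum hΩ _ fun c => ((hh.congrTo_ambChr hh0 hk c a b).mono hr).mul hΩ (hf.pd hΩ c)
  have hI := fun a b => (hh.congrTo_ambInv hh0 hk a b).mono (hr.trans (Nat.le_succ _))
  have key : ∀ a b, CongrTo (ambientDomain D ε) r
      (fun q => ambInv h q a b * (pd (ambientFrame n) a (pd (ambientFrame n) b f) q
        - ∑ c, ambChr h c a b q * pd (ambientFrame n) c f q))
      (fun q => ambInv h0 q a b * (pd (ambientFrame n) a (pd (ambientFrame n) b f0) q
        - ∑ c, ambChr h0 c a b q * pd (ambientFrame n) c f0 q)) := by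
    intro a b
    by_cases ha : a = idxInf
    · by_cases hb : b = idxInf
      · subst ha hb
        have h2 : CongrTo (ambientDomain D ε) r
            (fun q => q.2.2 * pd (ambientFrame n) idxInf (pd (ambientFrame n) idxInf f) q)
            (fun q => q.2.2 * pd (ambientFrame n) idxInf (pd (ambientFrame n) idxInf f0) q) := by
          -- The inverse metric supplies a factor ρ for the second ρ-derivative: two derivatives
          -- cost two orders and the factor restores one. At r = 0 only smoothness is required.
          cases r with
          | zero =>
            have hs := fun (f : ℝ × Model n × ℝ → ℝ) (hf : ContDiffOn ℝ ∞ f (ambientDomain D ε)) =>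
              contDiff_rho.contDiffOn.mul (contDiffOn_pd (e := ambientFrame n) hΩ idxInf
                (contDiffOn_pd (e := ambientFrame n) hΩ idxInf hf))
            exact ⟨hs f hf.left, hs f0 hf.right, trivial⟩
          | succ r => exact ((hf.pd_inf hΩ).pd_inf hΩ).rho_mul hΩ
        refine (((CongrTo.refl (k := r) hΩ (contDiffOn_const (c := (-2 : ℝ)).mul
          (contDiffOn_inv_t.mul contDiffOn_inv_t))).mul hΩ h2).sub hΩ
          ((hI idxInf idxInf).mul hΩ (h1 idxInf idxInf))).congr hΩ (fun q _ => ?_) (fun q _ => ?_)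
        · simp only [ambInv]; ring
        · simp only [ambInv]; ring
      · refine (hI a b).mul hΩ (CongrTo.sub hΩ ?_ (h1 a b))
        refine (((hf.pd hΩ a).pd_tangential hΩ hb)).congr hΩ (fun q hq => ?_) (fun q hq => ?_)
        · exact pd_comm hΩ hf.left hq b a
        · exact pd_comm hΩ hf.right hq b a
    · exact (hI a b).mul hΩ (((hf.pd hΩ b).pd_tangential hΩ ha).sub hΩ (h1 a b))
  refine (CongrTo.sum hΩ Finset.univ fun a => .sum hΩ Finset.univ fun b => key a b).congr hΩ
    (fun q hq => ?_) (fun q hq => ?_)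
  · simp only [laplacian, hh.inv_ambientComponents hq, hh.christoffel_ambientComponents hq]
  · simp only [laplacian, hh0.inv_ambientComponents hq, hh0.christoffel_ambientComponents hq]

end LaplacianCongruence


/-! ### The Laplacian of the model on homogeneous functions. -/

section ModelLaplacian

variable {n : ℕ} {G : Model n → Matrix (Fin n) (Fin n) ℝ} {D : Set (Model n)} {lam ε : ℝ}

/-- The defining function `(t (1 + λ ρ))^{-1}` of the model. -/
noncomputable def modelScale (lam : ℝ) (q : ℝ × Model n × ℝ) : ℝ := (q.1 * (1 + lam * q.2.2))⁻¹

section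

variable (hs : ∀ ρ ∈ Set.Ioo (-ε) ε, 0 < 1 + lam * ρ)
include hs

theorem contDiffOn_modelScale :
    ContDiffOn ℝ ∞ (modelScale (n := n) lam) (ambientDomain D ε) := by
  have := (contDiffOn_inv_t (D := D) (ε := ε)).mul (contDiffOn_one_add_rho_inv (D := D) hs)
  exact this.congr fun q _ => mul_inv _ _

theorem pd_modelScale_pow (hD : IsOpen D) {q : ℝ × Model n × ℝ} (hq : q ∈ ambientDomain D ε)
    (A : AmbientIndex n) (N : ℕ) :
    pd (ambientFrame n) A (fun q => modelScale lam q ^ N) q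
      = -(N * ((ambientFrame n A).1 * q.1⁻¹ + lam * (ambientFrame n A).2.2 * (1 + lam * q.2.2)⁻¹))
        * modelScale lam q ^ N := by
  have hΩ := isOpen_ambientDomain (ε := ε) hD
  have d1 := differentiableAt_of_contDiffOn hΩ (contDiffOn_modelScale (D := D) hs) hq
  have ht : q.1 ≠ 0 := (ne_of_gt hq.1 : _)
  have h1 : pd (ambientFrame n) A (modelScale lam) q
      = -((ambientFrame n A).1 * q.1⁻¹ + lam * (ambientFrame n A).2.2 * (1 + lam * q.2.2)⁻¹)
        * modelScale lam q := by
    have : modelScale (n := n) lam = fun q => q.1⁻¹ * (1 + lam * q.2.2)⁻¹ :=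
      funext fun q => mul_inv _ _
    rw [this, pd_mul (differentiableAt_of_contDiffOn hΩ contDiffOn_inv_t hq)
      (differentiableAt_of_contDiffOn hΩ (contDiffOn_one_add_rho_inv hs) hq), pd_inv_t ht,
      pd_one_add_rho_inv hs hq]
    ring
  induction N with
  | zero => simp [pd_const]
  | succ N ih =>
    simp only [pow_succ]
    rw [pd_mul (d1.fun_pow N) d1, ih, h1]
    push_cast
    ring

end

namespace IsMetricOn

variable (hG : IsMetricOn G D) (hs : ∀ ρ ∈ Set.Ioo (-ε) ε, 0 < 1 + lam * ρ)
  {q : ℝ × Model n × ℝ} (hq : q ∈ ambientDomain D ε) {f : Model n → ℝ} (hf : ContDiffOn ℝ ∞ f D)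
  (N : ℕ)
include hG hs hf

omit hG in
theorem contDiffOn_modelScale_mul :
    ContDiffOn ℝ ∞ (fun q => modelScale lam q ^ N * f q.2.1) (ambientDomain D ε) :=
  ((contDiffOn_modelScale hs).pow N).mul (contDiffOn_horizontal hf)

include hq

theorem pd_zero_modelScale_mul :
    pd (ambientFrame n) idxZero (fun q => modelScale lam q ^ N * f q.2.1) q
      = -(N * q.1⁻¹) * (modelScale lam q ^ N * f q.2.1) := by
  have hΩ := isOpen_ambientDomain (ε := ε) hG.isOpen
  rw [pd_mul ((differentiableAt_of_contDiffOn hΩ (contDiffOn_modelScale hs) hq).fun_pow N)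
    (differentiableAt_of_contDiffOn hΩ (contDiffOn_horizontal hf) hq),
    pd_modelScale_pow hs hG.isOpen hq, pd_horizontal_idxZero hG.isOpen hf hq]
  simp [ambientFrame]
  ring

theorem pd_inf_modelScale_mul :
    pd (ambientFrame n) idxInf (fun q => modelScale lam q ^ N * f q.2.1) q
      = -(N * lam) * ((1 + lam * q.2.2)⁻¹ * (modelScale lam q ^ N * f q.2.1)) := by
  have hΩ := isOpen_ambientDomain (ε := ε) hG.isOpen
  rw [pd_mul ((differentiableAt_of_contDiffOn hΩ (contDiffOn_modelScale hs) hq).fun_pow N)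
    (differentiableAt_of_contDiffOn hΩ (contDiffOn_horizontal hf) hq),
    pd_modelScale_pow hs hG.isOpen hq, pd_horizontal_idxInf hG.isOpen hf hq]
  simp [ambientFrame]
  ring

theorem pd_idxM_modelScale_mul (i : Fin n) :
    pd (ambientFrame n) (idxM i) (fun q => modelScale lam q ^ N * f q.2.1) q
      = modelScale lam q ^ N * pd (stdFrame n) i f q.2.1 := by
  have hΩ := isOpen_ambientDomain (ε := ε) hG.isOpen
  rw [pd_mul ((differentiableAt_of_contDiffOn hΩ (contDiffOn_modelScale hs) hq).fun_pow N)
    (differentiableAt_of_contDiffOn hΩ (contDiffOn_horizontal hf) hq),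
    pd_modelScale_pow hs hG.isOpen hq, pd_horizontal_idxM hG.isOpen hf hq]
  simp [ambientFrame]

theorem pd_pd_inf_modelScale_mul (A : AmbientIndex n) :
    pd (ambientFrame n) A (pd (ambientFrame n) idxInf (fun q => modelScale lam q ^ N * f q.2.1)) q
      = -(N * lam) * (-(lam * (ambientFrame n A).2.2
          * ((1 + lam * q.2.2)⁻¹ * (1 + lam * q.2.2)⁻¹)) * (modelScale lam q ^ N * f q.2.1)
        + (1 + lam * q.2.2)⁻¹
          * pd (ambientFrame n) A (fun q => modelScale lam q ^ N * f q.2.1) q) := by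
  have hΩ := isOpen_ambientDomain (ε := ε) hG.isOpen
  have d1 := differentiableAt_of_contDiffOn hΩ (contDiffOn_one_add_rho_inv (D := D) hs) hq
  have d2 := differentiableAt_of_contDiffOn hΩ (contDiffOn_modelScale_mul hs hf N) hq
  rw [pd_congr hΩ (fun q hq => pd_inf_modelScale_mul hG hs hq hf N) hq,
    pd_const_mul (d1.fun_mul d2), pd_mul d1 d2, pd_one_add_rho_inv hs hq]

/-- The Laplacian of the model on homogeneous functions. -/
theorem laplacian_einsteinFamily :
    laplacian (ambientFrame n) (ambientComponents (einsteinFamily G lam))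
        (fun q => modelScale lam q ^ N * f q.2.1) q
      = modelScale lam q ^ (N + 2) * (laplacian (stdFrame n) G f q.2.1
        + 2 * N * ((N : ℝ) + 1 - n) * (lam * f q.2.1)) := by
  have hΩ := isOpen_ambientDomain (ε := ε) hG.isOpen
  have hh := hG.isFamilyOn_einsteinFamily hs
  have hne := (hs _ hq.2.2).ne'
  have ht : q.1 ≠ 0 := (ne_of_gt hq.1 : _)
  have hF := contDiffOn_modelScale_mul (ε := ε) hs hf N
  have hij : ∀ i j, pd (ambientFrame n) (idxM i) (pd (ambientFrame n) (idxM j)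
      (fun q => modelScale lam q ^ N * f q.2.1)) q
      = modelScale lam q ^ N * pd (stdFrame n) i (pd (stdFrame n) j f) q.2.1 := by
    intro i j
    rw [pd_congr hΩ (fun q hq => pd_idxM_modelScale_mul hG hs hq hf N j) hq,
      pd_idxM_modelScale_mul hG hs hq (contDiffOn_pd hG.isOpen j hf) N i]
  have hterm : ∀ i j, modelScale lam q ^ N * pd (stdFrame n) i (pd (stdFrame n) j f) q.2.1
      - ∑ c, ambChr (einsteinFamily G lam) c (idxM i) (idxM j) q
          * pd (ambientFrame n) c (fun q => modelScale lam q ^ N * f q.2.1) q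
      = modelScale lam q ^ N * ((pd (stdFrame n) i (pd (stdFrame n) j f) q.2.1
          - ∑ k, christoffel (stdFrame n) G q.2.1 k i j * pd (stdFrame n) k f q.2.1)
        - 2 * N * lam * f q.2.1 * G q.2.1 j i) := by
    intro i j
    rw [sum_ambient, ambChr_zero_einsteinFamily hG hq, ambChr_inf_einsteinFamily hG hq,
      pd_zero_modelScale_mul hG hs hq hf, pd_inf_modelScale_mul hG hs hq hf]
    have h1 : ∀ k, ambChr (einsteinFamily G lam) (idxM k) (idxM i) (idxM j) q
        * pd (ambientFrame n) (idxM k) (fun q => modelScale lam q ^ N * f q.2.1) q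
        = modelScale lam q ^ N * (christoffel (stdFrame n) G q.2.1 k i j
          * pd (stdFrame n) k f q.2.1) := by
      intro k
      rw [pd_idxM_modelScale_mul hG hs hq hf]
      simp only [ambChr, famChr_einsteinFamily hG hs hq]
      ring
    simp only [h1, ← Finset.mul_sum, hG.symm _ hq.2.1 j i]
    field_simp
    ring
  -- This trace turns the zeroth order terms of the tangential block into -2Nnλ f.
  have htr : ∑ i, ∑ j, inv G q.2.1 i j * G q.2.1 j i = n := by
    simp [hG.inv_mul hq.2.1]
  have h0I : pd (ambientFrame n) idxInf (pd (ambientFrame n) idxZero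
      (fun q => modelScale lam q ^ N * f q.2.1)) q
      = pd (ambientFrame n) idxZero (pd (ambientFrame n) idxInf
      (fun q => modelScale lam q ^ N * f q.2.1)) q := pd_comm hΩ hF hq _ _
  have hsc : modelScale lam q ^ (N + 2)
      = q.1⁻¹ * q.1⁻¹ * ((1 + lam * q.2.2)⁻¹ * (1 + lam * q.2.2)⁻¹) * modelScale lam q ^ N := by
    rw [pow_add, modelScale, _root_.mul_inv]; ring
  have hM : ∀ i j, ambInv (einsteinFamily G lam) q (idxM i) (idxM j)
      * (modelScale lam q ^ N * pd (stdFrame n) i (pd (stdFrame n) j f) q.2.1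
      - ∑ c, ambChr (einsteinFamily G lam) c (idxM i) (idxM j) q
          * pd (ambientFrame n) c (fun q => modelScale lam q ^ N * f q.2.1) q)
      = modelScale lam q ^ (N + 2) * (inv G q.2.1 i j * (pd (stdFrame n) i (pd (stdFrame n) j f) q.2.1
          - ∑ k, christoffel (stdFrame n) G q.2.1 k i j * pd (stdFrame n) k f q.2.1))
        - modelScale lam q ^ (N + 2) * (2 * N * lam * f q.2.1)
          * (inv G q.2.1 i j * G q.2.1 j i) := by
    intro i j
    rw [hterm, hsc]
    simp only [ambInv, famInv_einsteinFamily hG hs hq]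
    ring
  have hc1 : ∑ c, ambChr (einsteinFamily G lam) c idxZero idxInf q
      * pd (ambientFrame n) c (fun q => modelScale lam q ^ N * f q.2.1) q
      = q.1⁻¹ * pd (ambientFrame n) idxInf (fun q => modelScale lam q ^ N * f q.2.1) q := by
    rw [sum_ambient]; simp [ambChr]
  have hc2 : ∑ c, ambChr (einsteinFamily G lam) c idxInf idxZero q
      * pd (ambientFrame n) c (fun q => modelScale lam q ^ N * f q.2.1) q
      = q.1⁻¹ * pd (ambientFrame n) idxInf (fun q => modelScale lam q ^ N * f q.2.1) q := by
    rw [sum_ambient]; simp [ambChr]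
  have hc3 : ∑ c, ambChr (einsteinFamily G lam) c idxInf idxInf q
      * pd (ambientFrame n) c (fun q => modelScale lam q ^ N * f q.2.1) q = 0 := by
    rw [sum_ambient]; simp [ambChr]
  -- The (t, ρ) block contributes 2N(N+1)λ f; with the tangential contribution this makes 2N(N+1-n)λ
  -- f.
  have hcross : ambInv (einsteinFamily G lam) q idxZero idxInf
        * (pd (ambientFrame n) idxZero (pd (ambientFrame n) idxInf
          (fun q => modelScale lam q ^ N * f q.2.1)) q - q.1⁻¹
          * pd (ambientFrame n) idxInf (fun q => modelScale lam q ^ N * f q.2.1) q)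
      + (ambInv (einsteinFamily G lam) q idxInf idxZero
        * (pd (ambientFrame n) idxZero (pd (ambientFrame n) idxInf
          (fun q => modelScale lam q ^ N * f q.2.1)) q - q.1⁻¹
          * pd (ambientFrame n) idxInf (fun q => modelScale lam q ^ N * f q.2.1) q)
      + ambInv (einsteinFamily G lam) q idxInf idxInf
        * (pd (ambientFrame n) idxInf (pd (ambientFrame n) idxInf
          (fun q => modelScale lam q ^ N * f q.2.1)) q - 0))
      = modelScale lam q ^ (N + 2) * (2 * N * ((N : ℝ) + 1) * (lam * f q.2.1)) := by
    rw [pd_pd_inf_modelScale_mul hG hs hq hf, pd_pd_inf_modelScale_mul hG hs hq hf,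
      pd_zero_modelScale_mul hG hs hq hf, pd_inf_modelScale_mul hG hs hq hf, hsc]
    have hz1 : (ambientFrame n idxZero).2.2 = 0 := rfl
    have hz2 : (ambientFrame n idxInf).2.2 = 1 := rfl
    rw [hz1, hz2]
    simp only [ambInv]
    field_simp
    ring
  have hL : laplacian (ambientFrame n) (ambientComponents (einsteinFamily G lam))
        (fun q => modelScale lam q ^ N * f q.2.1) q
      = (∑ i, ∑ j, ambInv (einsteinFamily G lam) q (idxM i) (idxM j)
      * (modelScale lam q ^ N * pd (stdFrame n) i (pd (stdFrame n) j f) q.2.1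
      - ∑ c, ambChr (einsteinFamily G lam) c (idxM i) (idxM j) q
          * pd (ambientFrame n) c (fun q => modelScale lam q ^ N * f q.2.1) q))
      + modelScale lam q ^ (N + 2) * (2 * N * ((N : ℝ) + 1) * (lam * f q.2.1)) := by
    rw [← hcross]
    unfold laplacian
    simp only [hh.inv_ambientComponents hq, hh.christoffel_ambientComponents hq]
    rw [sum_ambient]
    have hrow : ∀ (a : AmbientIndex n) (Y : AmbientIndex n → ℝ),
        ∑ b, ambInv (einsteinFamily G lam) q a b * Y b
        = ambInv (einsteinFamily G lam) q a idxZero * Y idxZero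
          + ((∑ j, ambInv (einsteinFamily G lam) q a (idxM j) * Y (idxM j))
          + ambInv (einsteinFamily G lam) q a idxInf * Y idxInf) := fun a Y => sum_ambient _
    simp only [hrow, hij, hc1, hc2, hc3, h0I]
    have z1 : ambInv (einsteinFamily G lam) q idxZero idxZero = 0 := rfl
    have z2 : ∀ i, ambInv (einsteinFamily G lam) q idxZero (idxM i) = 0 := fun _ => rfl
    have z3 : ∀ i, ambInv (einsteinFamily G lam) q (idxM i) idxZero = 0 := fun _ => rfl
    have z4 : ∀ i, ambInv (einsteinFamily G lam) q (idxM i) idxInf = 0 := fun _ => rfl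
    have z5 : ∀ i, ambInv (einsteinFamily G lam) q idxInf (idxM i) = 0 := fun _ => rfl
    simp only [z1, z2, z3, z4, z5, zero_mul, Finset.sum_const_zero, zero_add, add_zero]
    ring
  rw [hL]
  simp only [hM, Finset.sum_sub_distrib, ← Finset.mul_sum, htr]
  simp only [laplacian]
  ring

end IsMetricOn

end ModelLaplacian


/-! ### The numerical constants. -/

section Coefficients

/-- The constants in the factorization of the powers of the ambient Laplacian. -/
noncomputable def gjmsConst (n l j : ℕ) : ℝ :=
  2 * ((2 * l + 2 * j : ℕ) : ℝ) * (((2 * l + 2 * j : ℕ) : ℝ) + 1 - n)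

theorem prod_range_add_mul_factorial {l : ℕ} (hl : 1 ≤ l) (k : ℕ) :
    (∏ j ∈ Finset.range k, ((l : ℝ) + j)) * ((l - 1)! : ℝ) = ((l + k - 1)! : ℝ) := by
  induction k with
  | zero => simp
  | succ k ih =>
    rw [Finset.prod_range_succ, mul_right_comm, ih]
    obtain ⟨m, hm⟩ : ∃ m, l + k = m + 1 := ⟨l + k - 1, by omega⟩
    rw [show l + (k + 1) - 1 = m + 1 by omega, show l + k - 1 = m by omega, Nat.factorial_succ]
    have : (l : ℝ) + k = m + 1 := by exact_mod_cast hm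
    rw [this]
    push_cast
    ring

theorem prod_range_odd (k : ℕ) :
    ∏ j ∈ Finset.range k, (2 * ((k : ℝ) - j) - 1) = ((2 * k - 1)‼ : ℝ) := by
  rw [← Finset.prod_range_reflect]
  have : ∀ j ∈ Finset.range k, (2 * ((k : ℝ) - ((k - 1 - j : ℕ) : ℝ)) - 1) = 2 * (j : ℝ) + 1 := by
    intro j hj
    rw [Finset.mem_range] at hj
    rw [Nat.cast_sub (by omega), Nat.cast_sub (by omega)]
    push_cast
    ring
  rw [Finset.prod_congr rfl this]
  clear this
  induction k with
  | zero => simp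
  | succ k ih =>
    rw [Finset.prod_range_succ, ih, show 2 * (k + 1) - 1 = 2 * k + 1 by omega]
    cases k with
    | zero => simp
    | succ k =>
      rw [show 2 * (k + 1) + 1 = (2 * (k + 1) - 1) + 2 by omega, Nat.doubleFactorial_add_two]
      push_cast [show 2 * (k + 1) - 1 + 2 = 2 * k + 3 by omega]
      ring

/-- With k = m - l, each constant factors as -4(l+j)(2(k-j)-1). The factors l+j multiply to
(m-1)!/(l-1)!, which cancels the quotient of factorials, the odd factors form the double factorial,
and (-4)^k against (-2)^{-k} leaves 2^k. -/
theorem coefficient_mul_prod_gjmsConst {m l : ℕ} (hl : 1 ≤ l) (hm : l ≤ m) :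
    (-2 : ℝ) ^ ((l : ℤ) - (m : ℤ)) * (((l - 1)! : ℝ) / ((m - 1)! : ℝ))
      * ∏ j ∈ Finset.range (m - l), gjmsConst (2 * m) l j
      = 2 ^ (m - l) * ((2 * (m - l) - 1)‼ : ℝ) := by
  obtain ⟨k, rfl⟩ := Nat.exists_eq_add_of_le hm
  rw [Nat.add_sub_cancel_left]
  have h1 : ∏ j ∈ Finset.range k, gjmsConst (2 * (l + k)) l j
      = (-4) ^ k * (∏ j ∈ Finset.range k, ((l : ℝ) + j))
        * ∏ j ∈ Finset.range k, (2 * ((k : ℝ) - j) - 1) := by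
    have : ((-4 : ℝ)) ^ k = ∏ _j ∈ Finset.range k, (-4 : ℝ) := by simp
    rw [this, ← Finset.prod_mul_distrib, ← Finset.prod_mul_distrib]
    refine Finset.prod_congr rfl fun j _ => ?_
    unfold gjmsConst
    push_cast
    ring
  have h2 := prod_range_add_mul_factorial hl k
  have h3 : ((l + k - 1)! : ℝ) ≠ 0 := by exact_mod_cast Nat.factorial_ne_zero _
  have h4 : (-2 : ℝ) ^ ((l : ℤ) - ((l + k : ℕ) : ℤ)) * (-4) ^ k = 2 ^ k := by
    rw [show (l : ℤ) - ((l + k : ℕ) : ℤ) = -(k : ℤ) by push_cast; ring, zpow_neg, zpow_natCast,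
      show (-4 : ℝ) = (-2) * 2 by norm_num, mul_pow, inv_mul_cancel_left₀ (by positivity)]
  rw [h1, prod_range_odd, ← h4, ← mul_div_assoc, div_mul_eq_mul_div, div_eq_iff h3]
  linear_combination ((-2 : ℝ) ^ ((l : ℤ) - ((l + k : ℕ) : ℤ)) * (-4) ^ k * ((2 * k - 1)‼ : ℝ)) * h2

end Coefficients

/-! ### Evaluating the ambient invariants of an Einstein metric. -/

section Iterate

variable {n : ℕ} {h : ℝ → Model n → Matrix (Fin n) (Fin n) ℝ} {D : Set (Model n)} {ε lam : ℝ}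
  {k : ℕ} {G : Model n → Matrix (Fin n) (Fin n) ℝ}

theorem IsMetricOn.contDiffOn_shiftedLaplacian (hG : IsMetricOn G D) (c : ℕ → ℝ) {f : Model n → ℝ}
    (hf : ContDiffOn ℝ ∞ f D) (j : ℕ) : ContDiffOn ℝ ∞ (shiftedLaplacian c G lam f j) D := by
  induction j with
  | zero => exact hf
  | succ j ih =>
    exact (hG.contDiffOn_laplacian ih).add (contDiffOn_const.mul (contDiffOn_const.mul ih))

variable (hh : IsFamilyOn h D ε) (hs : ∀ ρ ∈ Set.Ioo (-ε) ε, 0 < 1 + lam * ρ)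
include hh hs

/-- Powers of the ambient Laplacian act on homogeneous functions through a product of second order
operators on `M`. -/
theorem IsFamilyOn.congrTo_iterate_laplacian (hG : IsMetricOn G D)
    (hk : ∀ i j, CongrTo (ambientDomain D ε) (k + 2) (famComp h i j)
      (famComp (einsteinFamily G lam) i j)) {F : ℝ × Model n × ℝ → ℝ} {f : Model n → ℝ}
    (hf : ContDiffOn ℝ ∞ f D) (l j : ℕ) {r : ℕ} (hr : r + j ≤ k + 1)
    (hF : CongrTo (ambientDomain D ε) (r + j) F
      (fun q => modelScale lam q ^ (2 * l) * f q.2.1)) :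
    CongrTo (ambientDomain D ε) r ((laplacian (ambientFrame n) (ambientComponents h))^[j] F)
      (fun q => modelScale lam q ^ (2 * l + 2 * j)
        * shiftedLaplacian (gjmsConst n l) G lam f j q.2.1) := by
  have hΩ := hh.isOpen_ambientDomain
  induction j generalizing r with
  | zero => exact hF
  | succ j ih =>
    -- One more order is demanded after j steps, to be spent on the last Laplacian.
    have h1 := ih (r := r + 1) (by omega) (by rwa [add_assoc, add_comm 1 j])
    rw [Function.iterate_succ_apply']
    refine (hh.congrTo_laplacian (hG.isFamilyOn_einsteinFamily hs) hk (by omega) h1).congr hΩ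
      (fun _ _ => rfl) fun q hq => ?_
    exact (hG.laplacian_einsteinFamily hs hq (hG.contDiffOn_shiftedLaplacian _ hf j) _)

/-- A straight and normal ambient metric of an Einstein metric agrees with the model. -/
theorem IsFamilyOn.congrTo_einsteinFamily (hG : IsEinsteinOn G D lam)
    (h0 : ∀ p ∈ D, h 0 p = G p) {m : ℕ} (hn : n = 2 * m)
    (hR : ∀ A B, VanishesTo (ambientDomain D ε) (m - 1)
      (fun q => ricci (ambientFrame n) (ambientComponents h) q A B)) {k : ℕ} (hkm : k + 1 ≤ m)
    (i j : Fin n) :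
    CongrTo (ambientDomain D ε) (k + 1) (famComp h i j) (famComp (einsteinFamily G lam) i j) := by
  have hΩ := hh.isOpen_ambientDomain
  have hh0 := hG.isFamilyOn_einsteinFamily hs
  induction k generalizing i j with
  | zero =>
    refine ⟨hh.contDiffOn_famComp i j, hh0.contDiffOn_famComp i j, fun q hq hq0 => ?_, trivial⟩
    simp only [famComp, hq0, h0 _ hq.2.1]
    simp [einsteinFamily]
  | succ k ih =>
    refine hh.congrTo_succ hh0 (ih (by omega)) (fun i j => ?_) ?_ i j
    · refine (CongrTo.of_vanishesTo hΩ (hh.isMetricOn.contDiffOn_ricci _ _)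
        ((hR _ _).mono (by omega))).congr hΩ (fun _ _ => rfl) fun q hq => ?_
      exact (hG.ricci_einsteinFamily hs hq (hG.ricci_eq _ hq.2.1) i j).symm
    · have : ((k + 1 + 1 : ℕ) : ℝ) ≤ m := by exact_mod_cast hkm
      rw [hn]
      push_cast at this ⊢
      linarith

/-- The order count: g_ρ agrees with the model modulo ρ^m, the ambient Weyl contraction modulo
ρ^{m-1}, and its (m-l)-fold Laplacian modulo ρ^{l-1}. As l ≥ 2, the value on ρ = 0 is that of the
model, where t(1+λρ) = 1 at t = 1. -/
theorem IsFamilyOn.iterate_laplacian_pf_weyl (hε : 0 < ε) (hG : IsEinsteinOn G D lam)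
    (h0 : ∀ p ∈ D, h 0 p = G p) (hn3 : 3 ≤ n) {m : ℕ} (hn : n = 2 * m)
    (hR : ∀ A B, VanishesTo (ambientDomain D ε) (m - 1)
      (fun q => ricci (ambientFrame n) (ambientComponents h) q A B)) {l : ℕ} (hl : 2 ≤ l)
    (hlm : l ≤ m) {p : Model n} (hp : p ∈ D) :
    ((laplacian (ambientFrame n) (ambientComponents h))^[m - l]
      (pf (ambientComponents h) l (weyl (ambientFrame n) (ambientComponents h)))) (1, p, 0)
      = shiftedLaplacian (gjmsConst n l) G lam (pf G l (weyl (stdFrame n) G)) (m - l) p := by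
  obtain ⟨k, rfl⟩ : ∃ k, m = k + 2 := ⟨m - 2, by omega⟩
  have hΩ := hh.isOpen_ambientDomain
  have hk := fun i j => hh.congrTo_einsteinFamily hs hG h0 hn hR (k := k + 1) le_rfl i j
  have hW := hh.congrTo_raiseLast_weyl (k := k) hR
  have hpf := congrTo_pf hG.isOpen l (GA := ambientComponents h)
    (X := weyl (ambientFrame n) (ambientComponents h)) (G := G) (W := weyl (stdFrame n) G)
    (v := fun q => modelScale lam q ^ 2) (k := k + 1) (fun a b c d => (hW a b c d).left)
    (fun a b c d => (hW _ _ _ _).trans hΩ (hh.congrTo_raiseLast_tangential hG hs hk hn3 a b c d))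
    (fun a b hab c d => (hW _ _ _ _).trans hΩ (hh.congrTo_raiseLast_zero hab c d))
    (fun a b c d hcd => (hW _ _ _ _).trans hΩ (hh.congrTo_raiseLast_infinity hG hs hk a b hcd))
  have hsm : ContDiffOn ℝ ∞ (pf G l (weyl (stdFrame n) G)) D :=
    (IsEinsteinInvariant.pf_weyl hn3 l).contDiffOn hG
  have h1 := hh.congrTo_iterate_laplacian hs hG.toIsMetricOn hk hsm l (k + 2 - l) (r := l - 1)
    (by omega) (((hpf.mono (by omega)).congr hΩ (fun _ _ => rfl) fun q _ => by
      rw [← pow_mul]))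
  have hq : ((1, p, 0) : ℝ × Model n × ℝ) ∈ ambientDomain D ε :=
    ⟨Set.mem_Ioi.2 one_pos, hp, by simp [hε], hε⟩
  have h2 := (h1.mono (show 0 + 1 ≤ l - 1 by omega)).eq_of_rho_eq_zero hq rfl
  rw [h2]
  simp [modelScale]

end Iterate

/-! ### The decomposition in a single coordinate domain. -/

section Main

/-- The coefficient of the `ℓ`-th term of the decomposition of the Pfaffian. -/
noncomputable def pfaffianCoeff (m l : ℕ) : ℝ :=
  (-2 : ℝ) ^ ((l : ℤ) - (m : ℤ)) * (((l - 1)! : ℝ) / ((m - 1)! : ℝ))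

/-- The decomposition of the Pfaffian of an Einstein metric in coordinates. -/
theorem exists_curvScalar_pf_eq {n : ℕ} (hn : Even n) (hn3 : 3 ≤ n) :
    ∃ f ∈ CurvScalar n, ∀ (G : Model n → Matrix (Fin n) (Fin n) ℝ) (D : Set (Model n)) (lam : ℝ),
      IsEinsteinOn G D lam → ∀ (h : ℝ → Model n → Matrix (Fin n) (Fin n) ℝ) (ε : ℝ), 0 < ε →
      IsFamilyOn h D ε → (∀ p ∈ D, h 0 p = G p) →
      (∀ p ∈ D, ∀ t : ℝ, 0 < t → ∀ (A B : AmbientIndex n) (k : ℕ), k < n / 2 - 1 →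
        iteratedDeriv k
          (fun ρ => ricci (ambientFrame n) (ambientComponents h) (t, p, ρ) A B) 0 = 0) →
      ∀ p ∈ D, pf G (n / 2) (riem (stdFrame n) G) p
        = ((n - 1)‼ : ℝ) * (2 * lam) ^ (n / 2)
          + ∑ l ∈ Finset.Icc 2 (n / 2), pfaffianCoeff (n / 2) l
              * ((laplacian (ambientFrame n) (ambientComponents h))^[n / 2 - l]
                (pf (ambientComponents h) l (weyl (ambientFrame n) (ambientComponents h)))) (1, p, 0)
          + laplacian (stdFrame n) G (f G) p := by
  obtain ⟨m, hm⟩ : ∃ m, n = 2 * m := by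
    obtain ⟨m, hm⟩ := hn
    exact ⟨m, by omega⟩
  have hm2 : n / 2 = m := by omega
  -- `H l` is the potential collecting all terms of the l-th product of shifted Laplacians that
  -- contain Δ. It is chosen before any metric, so it depends only on n and l.
  choose H hH hHeq using fun l => (IsEinsteinInvariant.pf_weyl hn3 l).exists_shiftedLaplacian_eq hn3
    (gjmsConst n l) (m - l)
  -- The sign is negative because the Laplacian terms of the P_l must be removed from the right-hand
  -- side.
  obtain ⟨f, hf, hfeq⟩ := IsEinsteinInvariant.sum (Finset.Icc 2 m) fun l =>
    (hH l).const_mul (-pfaffianCoeff m l)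
  refine ⟨f, hf, fun G D lam hG h ε hε hh h0 hR p hp => ?_⟩
  rw [hm2]
  have hsum : ∀ s : Finset ℕ, laplacian (stdFrame n) G
      (fun p => ∑ l ∈ s, -pfaffianCoeff m l * H l G lam p) p
      = ∑ l ∈ s, -pfaffianCoeff m l * laplacian (stdFrame n) G (H l G lam) p := by
    intro s
    have hsm := fun l => (hH l).contDiffOn hG
    induction s using Finset.induction_on with
    | empty =>
      have := hG.laplacian_const_mul (e := stdFrame n) (f := fun _ => 0) contDiffOn_const 0 hp
      simpa using this
    | insert l s hl ih =>
      simp only [Finset.sum_insert hl]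
      rw [hG.laplacian_add (contDiffOn_const.mul (hsm l))
        (ContDiffOn.sum fun l _ => contDiffOn_const.mul (hsm l)) hp,
        hG.laplacian_const_mul (hsm l) _ hp, ih]
  rw [hG.laplacian_congr (fun q hq => (hfeq G D lam hG q hq).symm) hp, hsum]
  -- shrink the interval
  obtain ⟨ε', hε', hle, hs⟩ : ∃ ε', 0 < ε' ∧ ε' ≤ ε ∧ ∀ ρ ∈ Set.Ioo (-ε') ε', 0 < 1 + lam * ρ := by
    -- On this interval |λρ| < 1, so the model family stays nondegenerate. Shrinking is harmless, as
    -- only germs at ρ = 0 enter.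
    refine ⟨min ε (1 / (|lam| + 1)), by positivity, min_le_left _ _, fun ρ hρ => ?_⟩
    have h1 : |ρ| < 1 / (|lam| + 1) := (abs_lt.2 hρ).trans_le (min_le_right _ _)
    rw [lt_div_iff₀ (by positivity)] at h1
    have h2 : |lam * ρ| < 1 := by
      rw [abs_mul]
      nlinarith [abs_nonneg ρ, abs_nonneg lam]
    linarith [neg_abs_le (lam * ρ)]
  have hsub : Set.Ioo (-ε') ε' ⊆ Set.Ioo (-ε) ε := Set.Ioo_subset_Ioo (neg_le_neg hle) hle
  have hh' : IsFamilyOn h D ε' :=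
    { isOpen := hh.isOpen
      smooth := fun i j => (hh.smooth i j).mono (Set.prod_mono subset_rfl hsub)
      symm := fun ρ hρ => hh.symm ρ (hsub hρ)
      det_ne := fun ρ hρ => hh.det_ne ρ (hsub hρ) }
  have hR' : ∀ A B, VanishesTo (ambientDomain D ε') (m - 1)
      (fun q => ricci (ambientFrame n) (ambientComponents h) q A B) := fun A B =>
    vanishesTo_of_iteratedDeriv hh'.isOpen_ambientDomain (hh'.isMetricOn.contDiffOn_ricci A B)
      fun q hq _ k hk => hR q.2.1 hq.2.1 q.1 hq.1 A B k (by rwa [hm2])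
  have hP : ∀ l ∈ Finset.Icc 2 m, pfaffianCoeff m l
      * ((laplacian (ambientFrame n) (ambientComponents h))^[m - l]
        (pf (ambientComponents h) l (weyl (ambientFrame n) (ambientComponents h)))) (1, p, 0)
      = ((2 * (m - l) - 1)‼ : ℝ) * (2 * lam) ^ (m - l) * pf G l (weyl (stdFrame n) G) p
        - -pfaffianCoeff m l * laplacian (stdFrame n) G (H l G lam) p := by
    intro l hl
    rw [Finset.mem_Icc] at hl
    rw [hh'.iterate_laplacian_pf_weyl hs hε' hG h0 hn3 hm hR' hl.1 hl.2 hp]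
    have h1 := hHeq l G D lam hG p hp
    have h2 := coefficient_mul_prod_gjmsConst (show 1 ≤ l by omega) hl.2
    rw [← hm] at h2
    rw [h1, mul_add, mul_pow]
    unfold pfaffianCoeff
    linear_combination (lam ^ (m - l) * pf G l (weyl (stdFrame n) G) p) * h2
  rw [Finset.sum_congr rfl hP, Finset.sum_sub_distrib]
  have := hG.pf_riem_eq hn3 hn hp
  rw [hm2] at this
  rw [this]
  ring

end Main

end Coord

/-! ### Gram matrices of nondegenerate forms. -/

section BilinearForms

variable {n : ℕ}

theorem sum_smul_stdFrame (v : Model n) : ∑ i, v i • stdFrame n i = v := by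
  ext j
  simp [stdFrame, Finset.sum_apply, Pi.single_apply]

theorem bilin_apply_eq_sum (b : Model n →L[ℝ] Model n →L[ℝ] ℝ) (L : Model n →L[ℝ] Model n)
    (v w : Model n) :
    b (L v) (L w) = ∑ k, ∑ l, v k * w l * b (L (stdFrame n k)) (L (stdFrame n l)) := by
  conv_lhs => rw [← sum_smul_stdFrame v, ← sum_smul_stdFrame w]
  simp only [map_sum, map_smul, sum_apply, smul_apply,
    smul_eq_mul, Finset.mul_sum]
  rw [Finset.sum_comm]
  exact Finset.sum_congr rfl fun k _ => Finset.sum_congr rfl fun l _ => by ring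

/-- A vector in the kernel of the Gram matrix would be sent by L to a vector in the radical of b.
Surjectivity of L shows that it lies in the radical, and injectivity gives the contradiction. -/
theorem det_bilin_ne_zero (b : Model n →L[ℝ] Model n →L[ℝ] ℝ) (hsymm : ∀ v w, b v w = b w v)
    (hb : ∀ v, (∀ w, b v w = 0) → v = 0) {L : Model n →L[ℝ] Model n} (hL : Function.Bijective L) :
    (Matrix.of fun i j => b (L (stdFrame n i)) (L (stdFrame n j))).det ≠ 0 := by
  intro h
  obtain ⟨v, hv, hv0⟩ := Matrix.exists_mulVec_eq_zero_iff.2 h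
  have h1 : ∀ w : Model n, b (L w) (L (WithLp.toLp 2 v)) = 0 := by
    intro w
    rw [bilin_apply_eq_sum]
    refine Finset.sum_eq_zero fun k _ => ?_
    have h2 := congrFun hv0 k
    simp only [Matrix.mulVec, dotProduct, Matrix.of_apply, Pi.zero_apply] at h2
    calc _ = w k * ∑ l, b (L (stdFrame n k)) (L (stdFrame n l)) * v l := by
          rw [Finset.mul_sum]
          exact Finset.sum_congr rfl fun l _ => by ring
      _ = 0 := by rw [h2, mul_zero]
  have h3 : L (WithLp.toLp 2 v) = 0 := hb _ fun w => by
    obtain ⟨w', rfl⟩ := hL.2 w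
    rw [hsymm, h1]
  have h4 : WithLp.toLp 2 v = (0 : Model n) := hL.1 (h3.trans (map_zero L).symm)
  exact hv (congrArg WithLp.ofLp h4)

end BilinearForms

/-! ### From charts to the manifold. -/

namespace PseudoRiemannianMetric

open Coord

variable {n : ℕ} {M : Type u} [TopologicalSpace M] [ChartedSpace (Model n) M]
  [IsManifold 𝓘(ℝ, Model n) ∞ M] (g : PseudoRiemannianMetric n M)

/-- The differential of the inverse of the preferred chart at `x₀`. -/
noncomputable def chartDeriv (M : Type u) [TopologicalSpace M] [ChartedSpace (Model n) M] (x₀ : M)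
    (p : Model n) : Model n →L[ℝ] Model n :=
  mfderiv 𝓘(ℝ, Model n) 𝓘(ℝ, Model n) (chartAt (Model n) x₀).symm p

/-- The metric at a point as a bilinear form on the model space. -/
def bilin (x : M) : Model n →L[ℝ] Model n →L[ℝ] ℝ := g.toFun x

omit [IsManifold 𝓘(ℝ, Model n) ∞ M] in
theorem comp_apply (x₀ : M) (p : Model n) (i j : Fin n) :
    g.comp x₀ p i j = g.bilin ((chartAt (Model n) x₀).symm p)
      (chartDeriv M x₀ p (stdFrame n i)) (chartDeriv M x₀ p (stdFrame n j)) := rfl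

theorem isMetricOn_comp (x₀ : M) : IsMetricOn (g.comp x₀) (chartAt (Model n) x₀).target where
  isOpen := (chartAt (Model n) x₀).open_target
  smooth := g.smooth x₀
  symm p _ i j := g.symm _ _ _
  det_ne p hp := by
    have : IsManifold 𝓘(ℝ, Model n) 1 M := .of_le (n := ∞) (by simp)
    refine det_bilin_ne_zero (g.bilin ((chartAt (Model n) x₀).symm p)) (g.symm _)
      (g.nondegenerate _) (L := chartDeriv M x₀ p) ?_
    exact (mdifferentiable_chart (I := 𝓘(ℝ, Model n)) x₀).symm.mfderiv_bijective hp

/-- The transition maps between charts are isometries. -/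
theorem isIsometryOn_transition (x₀ x₁ : M) :
    IsIsometryOn (fun p => chartAt (Model n) x₁ ((chartAt (Model n) x₀).symm p)) (g.comp x₀)
      (g.comp x₁) ((chartAt (Model n) x₀).target ∩
        (chartAt (Model n) x₀).symm ⁻¹' (chartAt (Model n) x₁).source)
      (chartAt (Model n) x₁).target := by
  have h1M : IsManifold 𝓘(ℝ, Model n) 1 M := .of_le (n := ∞) (by simp)
  have hopen : IsOpen ((chartAt (Model n) x₀).target ∩
        (chartAt (Model n) x₀).symm ⁻¹' (chartAt (Model n) x₁).source) :=
    (chartAt (Model n) x₀).isOpen_inter_preimage_symm (chartAt (Model n) x₁).open_source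
  have hsm : ContDiffOn ℝ ∞ (fun p => chartAt (Model n) x₁ ((chartAt (Model n) x₀).symm p))
      ((chartAt (Model n) x₀).target ∩
        (chartAt (Model n) x₀).symm ⁻¹' (chartAt (Model n) x₁).source) := by
    rw [← contMDiffOn_iff_contDiffOn]
    exact (contMDiffOn_chart (I := 𝓘(ℝ, Model n)) (n := ∞) (x := x₁)).comp
      ((contMDiffOn_chart_symm (I := 𝓘(ℝ, Model n)) (n := ∞) (x := x₀)).mono Set.inter_subset_left)
      fun p hp => hp.2
  have hm := g.isMetricOn_comp x₀
  refine ⟨⟨hopen, fun i j => (hm.smooth i j).mono Set.inter_subset_left,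
    fun p hp => hm.symm p hp.1, fun p hp => hm.det_ne p hp.1⟩, g.isMetricOn_comp x₁, hsm,
    fun p hp => (chartAt (Model n) x₁).map_source hp.2, fun p hp i j => ?_⟩
  set Φ := fun p => chartAt (Model n) x₁ ((chartAt (Model n) x₀).symm p) with hΦ
  have hdΦ : DifferentiableAt ℝ Φ p :=
    (hsm.contDiffAt (hopen.mem_nhds hp)).differentiableAt (by simp)
  have hΦp : Φ p ∈ (chartAt (Model n) x₁).target := (chartAt (Model n) x₁).map_source hp.2
  have hpt : (chartAt (Model n) x₁).symm (Φ p) = (chartAt (Model n) x₀).symm p :=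
    (chartAt (Model n) x₁).left_inv hp.2
  -- Near p the inverse of the first chart is the inverse of the second one after the transition
  -- map; the chain rule then relates the two coordinate frames.
  have hchain : chartDeriv M x₀ p = (chartDeriv M x₁ (Φ p)).comp (fderiv ℝ Φ p) := by
    have h1 : (chartAt (Model n) x₀).symm =ᶠ[nhds p] (chartAt (Model n) x₁).symm ∘ Φ := by
      filter_upwards [hopen.mem_nhds hp] with p' hp'
      exact ((chartAt (Model n) x₁).left_inv hp'.2).symm
    have h2 : MDifferentiableAt 𝓘(ℝ, Model n) 𝓘(ℝ, Model n) (chartAt (Model n) x₁).symm (Φ p) :=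
      (mdifferentiable_chart (I := 𝓘(ℝ, Model n)) x₁).mdifferentiableAt_symm hΦp
    have h3 := mfderiv_comp p h2 hdΦ.mdifferentiableAt
    rw [mfderiv_eq_fderiv] at h3
    exact h1.mfderiv_eq.trans h3
  have hjac : ∀ i k, (fderiv ℝ Φ p (stdFrame n i)) k = jac Φ p k i := by
    intro i k
    unfold jac pd
    have : (fun q => Φ q k) = (EuclideanSpace.proj k : Model n →L[ℝ] ℝ) ∘ Φ := rfl
    rw [this, fderiv_comp p (by fun_prop) hdΦ, ContinuousLinearMap.fderiv]
    rfl
  rw [g.comp_apply, hchain]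
  simp only [ContinuousLinearMap.comp_apply]
  rw [bilin_apply_eq_sum]
  change _ = ∑ k, ∑ l, jac Φ p k i * jac Φ p l j * g.comp x₁ (Φ p) k l
  simp only [hjac, g.comp_apply, hpt]

variable {f : (Model n → Matrix (Fin n) (Fin n) ℝ) → Model n → ℝ} {U : ScalarRiemannianInvariant}

/-- The invariant is defined at each point through that point's own preferred chart. Invariance
under the transition isometries expresses it near x₀ by one function in one fixed chart, which is
what smoothness and the Laplacian require. -/
theorem evalInvariant_eq (hf : f ∈ CurvScalar n)
    (hU : ∀ G p, U.evalCoord (stdFrame n) G p = f G p) (x₀ : M) {y : M}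
    (hy : y ∈ (chartAt (Model n) x₀).source) :
    g.evalInvariant U y = f (g.comp x₀) (chartAt (Model n) x₀ y) := by
  unfold evalInvariant
  rw [hU]
  have hy' := mem_chart_source (Model n) y
  have hp : chartAt (Model n) y y ∈ (chartAt (Model n) y).target ∩
        (chartAt (Model n) y).symm ⁻¹' (chartAt (Model n) x₀).source :=
    ⟨mem_chart_target _ y, by
      rw [Set.mem_preimage, (chartAt (Model n) y).left_inv hy']; exact hy⟩
  have := CurvScalar.eq_of_isIsometryOn hf (g.isIsometryOn_transition y x₀) hp
  rwa [(chartAt (Model n) y).left_inv hy'] at this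

theorem contMDiff_evalInvariant (hf : f ∈ CurvScalar n)
    (hU : ∀ G p, U.evalCoord (stdFrame n) G p = f G p) :
    ContMDiff 𝓘(ℝ, Model n) 𝓘(ℝ, ℝ) ∞ (g.evalInvariant U) := by
  intro x
  have hx := mem_chart_source (Model n) x
  have h1 : ContMDiffAt 𝓘(ℝ, Model n) 𝓘(ℝ, Model n) ∞ (chartAt (Model n) x) x :=
    (contMDiffOn_chart (I := 𝓘(ℝ, Model n)) (n := ∞) (x := x)).contMDiffAt
      ((chartAt (Model n) x).open_source.mem_nhds hx)
  have h2 : ContMDiffAt 𝓘(ℝ, Model n) 𝓘(ℝ, ℝ) ∞ (f (g.comp x)) (chartAt (Model n) x x) :=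
    ((CurvScalar.contDiffOn hf (g.isMetricOn_comp x)).contDiffAt
      ((chartAt (Model n) x).open_target.mem_nhds (mem_chart_target _ x))).contMDiffAt
  refine (h2.comp x h1).congr_of_eventuallyEq ?_
  filter_upwards [(chartAt (Model n) x).open_source.mem_nhds hx] with y hy
  exact g.evalInvariant_eq hf hU x hy

theorem laplacian_evalInvariant (hf : f ∈ CurvScalar n)
    (hU : ∀ G p, U.evalCoord (stdFrame n) G p = f G p) (x : M) :
    g.laplacian (g.evalInvariant U) x
      = Coord.laplacian (stdFrame n) (g.comp x) (f (g.comp x)) (chartAt (Model n) x x) := by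
  refine (g.isMetricOn_comp x).laplacian_congr (fun p hp => ?_) (mem_chart_target _ x)
  simp only [Function.comp_apply]
  rw [g.evalInvariant_eq hf hU x ((chartAt (Model n) x).map_target hp),
    (chartAt (Model n) x).right_inv hp]

end PseudoRiemannianMetric

theorem StraightNormalAmbientSpace.isFamilyOn {n : ℕ} {M : Type u} [TopologicalSpace M]
    [ChartedSpace (Model n) M] [IsManifold 𝓘(ℝ, Model n) ∞ M] {g : PseudoRiemannianMetric n M}
    (A : StraightNormalAmbientSpace g) (x : M) :
    Coord.IsFamilyOn (fun ρ => (A.family ρ).comp x) (chartAt (Model n) x).target A.ε where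
  isOpen := (chartAt (Model n) x).open_target
  smooth := A.smooth x
  symm ρ _ := ((A.family ρ).isMetricOn_comp x).symm
  det_ne ρ _ := ((A.family ρ).isMetricOn_comp x).det_ne

theorem mainTheorem9 (n : ℕ) (hn : Even n) (hn3 : 3 ≤ n) :
    ∃ U : ScalarRiemannianInvariant,
      ∀ (M : Type u) [TopologicalSpace M] [ChartedSpace (Model n) M]
        [IsManifold 𝓘(ℝ, Model n) ∞ M] (g : PseudoRiemannianMetric n M), g.IsEinstein →
        ContMDiff 𝓘(ℝ, Model n) 𝓘(ℝ, ℝ) ∞ (g.evalInvariant U) ∧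
        ∀ (A : StraightNormalAmbientSpace g) (x : M),
          g.pfaffian x =
            ((n - 1)‼ : ℝ) * (2 / (n : ℝ) * g.J x) ^ (n / 2)
              + ∑ ℓ ∈ Finset.Icc 2 (n / 2),
                  (-2 : ℝ) ^ ((ℓ : ℤ) - ((n / 2 : ℕ) : ℤ))
                    * (((ℓ - 1)! : ℝ) / ((n / 2 - 1)! : ℝ)) * A.P ℓ x
              + g.laplacian (g.evalInvariant U) x := by
  obtain ⟨f, hf, hfeq⟩ := Coord.exists_curvScalar_pf_eq hn hn3
  obtain ⟨U, hU⟩ := Coord.CurvScalar.exists_invariant hf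
  refine ⟨U, fun M _ _ _ g ⟨lam, hlam⟩ => ⟨g.contMDiff_evalInvariant hf hU, fun A x => ?_⟩⟩
  have hG : Coord.IsEinsteinOn (g.comp x) (chartAt (Model n) x).target lam :=
    ⟨g.isMetricOn_comp x, hlam x⟩
  have hx := mem_chart_target (Model n) x
  have h0 : (n : ℝ) ≠ 0 := by
    have : (3 : ℝ) ≤ n := by exact_mod_cast hn3
    linarith
  -- For an Einstein metric J = nλ, so the constant term of the coordinate decomposition takes the
  -- stated form.
  have hJ : 2 / (n : ℝ) * g.J x = 2 * lam := by
    rw [PseudoRiemannianMetric.J, hG.schoutenTrace_eq hn3 hx]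
    field_simp
  rw [hJ, g.laplacian_evalInvariant hf hU]
  exact hfeq _ _ lam hG (fun ρ => (A.family ρ).comp x) A.ε A.ε_pos (A.isFamilyOn x)
    (fun p _ => by rw [A.family_zero]) (A.ricci_even hn x) _ hx
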